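/- Let $\omega = e^{2\pi i/3}$, $\Lambda = \omega\mathbb Z\oplus\mathbb Z\subset\mathbb C=\mathbb R^2$, $\Lambda^* = \frac{4\pi i}{\sqrt 3}\Lambda$ and $\langle z,w\rangle = \operatorname{Re}(z\bar w)$. Let $K\in\mathbb C$ satisfy $\omega K\equiv K\not\equiv 0 \bmod \Lambda^*$ (for example $K=\frac43\pi$), and let $U:\mathbb C\to\mathbb C$ be a real analytic function such that $$U(z+\gamma)=e^{i\langle\gamma,K\rangle}U(z)\ (\gamma\in\Lambda),\qquad U(\omega z)=\omega U(z),\qquad \overline{U(\bar z)}=-U(-z).$$ For $\alpha\in\mathbb C$ put, with $D_{\bar z}=\frac1i\partial_{\bar z}$, $$H(\alpha)=\begin{pmatrix}0&D(\alpha)^*\\ D(\alpha)&0\end{pmatrix},\qquad D(\alpha)=\begin{pmatrix}2D_{\bar z}&\alpha U(z)\\ \alpha U(-z)&2D_{\bar z}\end{pmatrix}.$$ For $\gamma\in\Lambda$ let $\mathscr L_\gamma u(z)=\operatorname{diag}(e^{i\langle\gamma,K\rangle},e^{-i\langle\gamma,K\rangle})\,u(z+\gamma)$ on $\mathbb C^2$-valued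 functions, extended diagonally to $\mathbb C^4=\mathbb C^2\times\mathbb C^2$. For $k\in\mathbb C$ let $L^2_k$ be the space of $u\in L^2_{\rm loc}(\mathbb C;\mathbb C^4)$ with $\mathscr L_\gamma u=e^{i\langle k,\gamma\rangle}u$ for all $\gamma\in\Lambda$, and let $H^1_k=L^2_k\cap H^1_{\rm loc}$. Let $E_1(\alpha,k)$ be the smallest nonnegative eigenvalue of $H(\alpha)$ on $L^2_k$ with domain $H^1_k$, that is, the smallest $E\ge 0$ for which $H(\alpha)u=Eu$ has a nonzero solution $u\in H^1_k$. Then, for every $\alpha\in\mathbb C$, $E_1(\alpha,k)$ is well defined for every $k\in\mathbb C$ (the smallest nonnegative eigenvalue exists), and $$\exists\,k\notin\{-K,K\}+\Lambda^*\quad E_1(\alpha,k)=0\qquad\Longleftrightarrow\qquad\forall\,k\in\mathbb C\quad E_1(\alpha,k)=0 .$$ In other words, the zero energy band is flat if and only if the lowest Bloch eigenvalue vanishes at some $k$ outside the lattice $\{-K,K\}+\Lambda^*$ of conic points. -/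

import Mathlib

open MeasureTheory
open scoped ContDiff ComplexConjugate Pointwise Matrix

noncomputable section

namespace ChiralTBG

/-- The cube root of unity `ω = e^{2πi/3}`. -/
def ω₃ : ℂ := Complex.exp (2 * Real.pi * Complex.I / 3)

/-- The real pairing `⟨z, w⟩ = Re (z w̄)` on `ℂ = ℝ²`. -/
def pair (z w : ℂ) : ℝ := (z * conj w).re

/-- The lattice `Λ = ωℤ ⊕ ℤ`. -/
def lattice : Set ℂ := {γ | ∃ m n : ℤ, γ = (m : ℂ) * ω₃ + (n : ℂ)}

/-- The dual lattice `Λ* = (4πi/√3) Λ`. -/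
def dualLattice : Set ℂ :=
  (fun γ : ℂ => 4 * (Real.pi : ℂ) * Complex.I / (Real.sqrt 3 : ℂ) * γ) '' lattice

/-- `K` is a nonzero fixed point of multiplication by `ω` on `ℂ / Λ*`:
`ωK ≡ K ≢ 0 mod Λ*`.  (For instance `K = 4π/3`.) -/
structure IsDiracPoint (K : ℂ) : Prop where
  rot : ω₃ * K - K ∈ dualLattice
  ne_zero : K ∉ dualLattice

/-- The assumptions on the potential `U`: it is real analytic on `ℂ = ℝ²` and has the translation,
rotation and reflection symmetries of the chiral model. -/
structure IsChiralPotential (K : ℂ) (U : ℂ → ℂ) : Prop where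
  analytic : ∀ z, AnalyticAt ℝ U z
  translation : ∀ γ ∈ lattice, ∀ z, U (z + γ) = Complex.exp (Complex.I * pair γ K) * U z
  rotation : ∀ z, U (ω₃ * z) = ω₃ * U z
  reflection : ∀ z, conj (U (conj z)) = -U (-z)

/-- `ℂ²`.  (Only its topology matters below, so the choice of norm is immaterial.) -/
abbrev C2 : Type := Fin 2 → ℂ

/-- `ℂ⁴ = ℂ² × ℂ²`. -/
abbrev C4 : Type := C2 × C2

/-- `u ∈ L²_loc(ℂ; F)`. -/
def MemL2loc {F : Type*} [NormedAddCommGroup F] (u : ℂ → F) : Prop :=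
  ∀ s : Set ℂ, IsCompact s → MemLp u 2 (volume.restrict s)

/-- `g` is the weak (distributional) derivative of `f` in the direction `v ∈ ℂ = ℝ²`.
Used only for `f`, `g` in `L²_loc`, where both integrals converge. -/
def IsWeakDeriv {F : Type*} [NormedAddCommGroup F] [NormedSpace ℝ F]
    (v : ℂ) (f g : ℂ → F) : Prop :=
  ∀ φ : ℂ → ℝ, ContDiff ℝ ∞ φ → HasCompactSupport φ →
    ∫ z, (fderiv ℝ φ z v) • f z = -∫ z, φ z • g z

/-- The matrix `diag (e^{i⟨γ, K⟩}, e^{-i⟨γ, K⟩})`. -/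
def twist (K γ : ℂ) : Matrix (Fin 2) (Fin 2) ℂ :=
  Matrix.diagonal ![Complex.exp (Complex.I * pair γ K), Complex.exp (-(Complex.I * pair γ K))]

/-- The twisted translations `𝓛_γ u (z) = diag (e^{i⟨γ, K⟩}, e^{-i⟨γ, K⟩}) u (z + γ)`, extended
diagonally to `ℂ⁴ = ℂ² × ℂ²`. -/
def transl (K γ : ℂ) (u : ℂ → C4) : ℂ → C4 := fun z =>
  (twist K γ *ᵥ (u (z + γ)).1, twist K γ *ᵥ (u (z + γ)).2)

/-- `u ∈ L²_k(ℂ/Λ; ℂ⁴)`: `u ∈ L²_loc` and `𝓛_γ u = e^{i⟨k, γ⟩} u` (a.e.) for all `γ ∈ Λ`. -/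
structure MemL2k (K k : ℂ) (u : ℂ → C4) : Prop where
  memL2loc : MemL2loc u
  floquet : ∀ γ ∈ lattice,
    transl K γ u =ᵐ[volume] fun z => Complex.exp (Complex.I * pair k γ) • u z

/-- `u ∈ H¹_k(ℂ/Λ; ℂ⁴)`, with weak partial derivatives `ux = ∂u/∂x` and `uy = ∂u/∂y`
(for `z = x + iy`), which belong to `L²_loc`. -/
structure MemH1kWith (K k : ℂ) (u ux uy : ℂ → C4) : Prop where
  memL2k : MemL2k K k u
  memL2loc_x : MemL2loc ux
  memL2loc_y : MemL2loc uy
  deriv_x : IsWeakDeriv 1 u ux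
  deriv_y : IsWeakDeriv Complex.I u uy

/-- The zeroth order part of `D(α)`. -/
def potMatrix (U : ℂ → ℂ) (α z : ℂ) : Matrix (Fin 2) (Fin 2) ℂ :=
  !![0, α * U z; α * U (-z), 0]

/-- The value at `z` of `D(α) v`, where `D(α) = 2 D_z̄ + potMatrix` and
`2 D_z̄ = (2/i) ∂_z̄ = (1/i)(∂_x + i ∂_y)`, in terms of the values `v`, `vx`, `vy` at `z` of the
function and of its two partial derivatives. -/
def opD (U : ℂ → ℂ) (α z : ℂ) (v vx vy : C2) : C2 :=
  (-Complex.I) • (vx + Complex.I • vy) + potMatrix U α z *ᵥ v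

/-- The value at `z` of `D(α)* v`, where `D(α)* = 2 D_z + potMatrixᴴ` is the formal adjoint of
`D(α)` and `2 D_z = (2/i) ∂_z = (1/i)(∂_x - i ∂_y)`. -/
def opDstar (U : ℂ → ℂ) (α z : ℂ) (v vx vy : C2) : C2 :=
  (-Complex.I) • (vx - Complex.I • vy) + (potMatrix U α z)ᴴ *ᵥ v

/-- The value at `z` of `H(α) u`, where `H(α)` is the block operator with rows `(0, D(α)*)` and
`(D(α), 0)`. -/
def opH (U : ℂ → ℂ) (α z : ℂ) (u ux uy : C4) : C4 :=
  (opDstar U α z u.2 ux.2 uy.2, opD U α z u.1 ux.1 uy.1)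

/-- `E` is an eigenvalue of `H(α)` on `L²_k(ℂ/Λ; ℂ⁴)` with domain `H¹_k(ℂ/Λ; ℂ⁴)`: there is a
nonzero `u ∈ H¹_k` with `H(α) u = E u`. -/
def IsBlochEigenvalue (K : ℂ) (U : ℂ → ℂ) (α k : ℂ) (E : ℝ) : Prop :=
  ∃ u ux uy : ℂ → C4, MemH1kWith K k u ux uy ∧ ¬ (u =ᵐ[volume] 0) ∧
    ∀ᵐ z ∂volume, opH U α z (u z) (ux z) (uy z) = (E : ℂ) • u z

/-- The lowest Bloch eigenvalue `E₁(α, k)`: the smallest nonnegative eigenvalue of `H(α)` on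
`L²_k(ℂ/Λ; ℂ⁴)`. -/
def E₁ (K : ℂ) (U : ℂ → ℂ) (α k : ℂ) : ℝ :=
  sInf {E : ℝ | 0 ≤ E ∧ IsBlochEigenvalue K U α k E}

end ChiralTBG

end

/-!
On the Fourier side `D(α)` on `L²_k` becomes `diag λ + V` with `|λ| → ∞` and `V` bounded. Hence a
compact resolvent argument shows that the least nonnegative eigenvalue of `H(α)` exists, and
`E₁(α, k) = 0` if and only if `D(α)` or `D(α)*` has a kernel on `L²_k`. An antilinear symmetry
exchanges `D(α)*` at `k` with `D(α)` at `-k`, so only the kernel of `D(α)` matters.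

At `k = K` the rotation by `ω` protects a kernel element `v` of `D(α)`: the constant mode is a
rotation invariant kernel element at `α = 0`, and the rotation class which is the target of `D(α)`
contains no constant mode, so the invariant kernel persists for every `α`.

Let `u` be a kernel element at some `k ∉ {-K, K} + Λ*`. The Wronskian `u₀ v₁ - u₁ v₀` is holomorphic
with the nontrivial quasimomentum `k + K`, hence vanishes by Liouville's theorem. If `u` had no
zero, `v = f u` would hold with `f` holomorphic of nontrivial quasimomentum `K - k`, so `f = 0`.
Therefore `u` vanishes at some `z₀`, and multiplying it by a meromorphic quotient of theta functions
of quasimomentum `k' - k` with simple poles at `z₀ + Λ` gives a kernel element at an arbitrary `k'`.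
-/

noncomputable section

namespace ChiralTBG

open Filter Topology

section CompactOperators

lemma isUnit_one_add_mul_swap {R : Type*} [Ring R] {a b : R} (h : IsUnit (1 + a * b)) :
    IsUnit (1 + b * a) := by
  obtain ⟨c, hc, hc'⟩ := isUnit_iff_exists.1 h
  refine isUnit_iff_exists.2 ⟨1 - b * c * a, ?_, ?_⟩
  · calc (1 + b * a) * (1 - b * c * a) = 1 + b * a - b * ((1 + a * b) * c) * a := by noncomm_ring
      _ = 1 := by rw [hc]; noncomm_ring
  · calc (1 - b * c * a) * (1 + b * a) = 1 + b * a - b * (c * (1 + a * b)) * a := by noncomm_ring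
      _ = 1 := by rw [hc']; noncomm_ring

lemma exists_add_apply_eq_zero_or_isUnit {𝕜 X : Type*} [NontriviallyNormedField 𝕜]
    [NormedAddCommGroup X] [NormedSpace 𝕜 X] [CompleteSpace X] {T : X →L[𝕜] X}
    (hT : IsCompactOperator T) : (∃ x ≠ 0, x + T x = 0) ∨ IsUnit (1 + T) := by
  rcases hT.hasEigenvalue_or_mem_resolventSet (μ := -1) (by simp) with h | h
  · obtain ⟨x, hx⟩ := h.exists_hasEigenvector
    have hTx : T x = (-1 : 𝕜) • x := hx.apply_eq_smul
    exact .inl ⟨x, hx.2, by simp [hTx]⟩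
  · rw [spectrum.mem_resolventSet_iff, ← IsUnit.neg_iff] at h
    exact .inr (by simpa [add_comm] using h)

variable {𝕜 X : Type*} [NontriviallyNormedField 𝕜] [NormedAddCommGroup X] [NormedSpace 𝕜 X]

lemma units_apply_eq_iff (u : (X →L[𝕜] X)ˣ) {x y : X} :
    (u : X →L[𝕜] X) x = y ↔ x = (↑u⁻¹ : X →L[𝕜] X) y := by
  constructor
  · rintro rfl
    exact (congr($(u.inv_mul) x)).symm
  · rintro rfl
    exact congr($(u.mul_inv) y)

variable {E F : Type*} [NormedAddCommGroup E] [InnerProductSpace ℂ E] [CompleteSpace E]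
  [NormedAddCommGroup F] [InnerProductSpace ℂ F] [CompleteSpace F]

open ContinuousLinearMap in
lemma exists_adjoint_apply_eq_norm_sq_smul {A : E →L[ℂ] F} (hA : IsCompactOperator A)
    (hA0 : A ≠ 0) : ∃ x ≠ 0, adjoint A (A x) = ((‖A‖ ^ 2 : ℝ) : ℂ) • x := by
  have : Nontrivial E := by
    obtain ⟨x, hx⟩ := DFunLike.exists_ne hA0
    exact ⟨x, 0, fun h => hx (by simp [h])⟩
  have hmem : ((‖A‖ ^ 2 : ℝ) : ℂ) ∈ spectrum ℂ (adjoint A ∘L A) := by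
    rw [sq, ← norm_adjoint_comp_self A]
    exact spectrum.algebraMap_mem ℂ
      (CStarAlgebra.norm_mem_spectrum_of_nonneg (ContinuousLinearMap.nonneg_iff_isPositive _ |>.2
        (isPositive_adjoint_comp_self A)))
  have hne : ((‖A‖ ^ 2 : ℝ) : ℂ) ≠ 0 := by simpa using hA0
  obtain ⟨x, hx⟩ :=
    (((hA.clm_comp (adjoint A)).hasEigenvalue_iff_mem_spectrum hne).2 hmem).exists_hasEigenvector
  exact ⟨x, hx.2, hx.apply_eq_smul⟩

open ContinuousLinearMap in
lemma one_le_norm_mul_of_adjoint_system {A : F →L[ℂ] E} {t : ℝ} (ht : 0 ≤ t) {u : E} {w : F}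
    (h0 : u ≠ 0 ∨ w ≠ 0) (hu : u = A ((t : ℂ) • w)) (hw : w = adjoint A ((t : ℂ) • u)) :
    1 ≤ ‖A‖ * t := by
  have hu_le : ‖u‖ ≤ ‖A‖ * t * ‖w‖ := by
    calc ‖u‖ = ‖A ((t : ℂ) • w)‖ := by rw [← hu]
      _ ≤ ‖A‖ * ‖(t : ℂ) • w‖ := A.le_opNorm _
      _ = ‖A‖ * t * ‖w‖ := by rw [norm_smul, Complex.norm_real, Real.norm_of_nonneg ht, mul_assoc]
  have hw_le : ‖w‖ ≤ ‖A‖ * t * ‖u‖ := by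
    calc ‖w‖ = ‖adjoint A ((t : ℂ) • u)‖ := by rw [← hw]
      _ ≤ ‖adjoint A‖ * ‖(t : ℂ) • u‖ := (adjoint A).le_opNorm _
      _ = ‖A‖ * t * ‖u‖ := by
        rw [norm_smul, Complex.norm_real, Real.norm_of_nonneg ht, mul_assoc,
          LinearIsometryEquiv.norm_map]
  have hpos : 0 < ‖u‖ + ‖w‖ := by
    rcases h0 with h | h
    · exact add_pos_of_pos_of_nonneg (norm_pos_iff.2 h) (norm_nonneg w)
    · exact add_pos_of_nonneg_of_pos (norm_nonneg u) (norm_pos_iff.2 h)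
  refine le_of_mul_le_mul_right ?_ hpos
  linarith

open ContinuousLinearMap in
lemma isLeast_inv_norm_adjoint_system {A : F →L[ℂ] E} (hA : IsCompactOperator A) (hA0 : A ≠ 0) :
    IsLeast {t : ℝ | 0 ≤ t ∧ ∃ (u : E) (w : F), (u ≠ 0 ∨ w ≠ 0) ∧ u = A ((t : ℂ) • w) ∧
      w = adjoint A ((t : ℂ) • u)} ‖A‖⁻¹ := by
  have hpos : 0 < ‖A‖ := norm_pos_iff.2 hA0
  have hne : (‖A‖ : ℂ) ≠ 0 := by exact_mod_cast hpos.ne'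
  constructor
  · obtain ⟨w, hw0, hw⟩ := exists_adjoint_apply_eq_norm_sq_smul hA hA0
    refine ⟨by positivity, A (((‖A‖⁻¹ : ℝ) : ℂ) • w), w, .inr hw0, rfl, ?_⟩
    rw [map_smul, map_smul, map_smul, hw, smul_smul, smul_smul]
    push_cast
    field_simp
    rw [one_smul]
  · rintro t ⟨ht, u, w, h0, hu, hw⟩
    rw [inv_le_iff_one_le_mul₀' hpos]
    exact one_le_norm_mul_of_adjoint_system ht h0 hu hw

end CompactOperators

section DiagonalOperators

open scoped ENNReal

variable {ι : Type*}

/-- The Hilbert space `ℓ²(ι)`. -/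
abbrev Ell2 (ι : Type*) : Type _ := lp (fun _ : ι => ℂ) 2

/-- The algebra `ℓ^∞(ι)` of bounded families, the symbols of diagonal operators. -/
abbrev EllInfty (ι : Type*) : Type _ := lp (fun _ : ι => ℂ) ∞

lemma memℓp_two_iff {f : ι → ℂ} : Memℓp f 2 ↔ Summable fun i => ‖f i‖ ^ 2 := by
  simpa using memℓp_gen_iff (E := fun _ : ι => ℂ) (f := f) (p := 2) (by norm_num)

lemma summable_norm_sq (x : Ell2 ι) : Summable fun i => ‖x i‖ ^ 2 :=
  memℓp_two_iff.1 (lp.memℓp x)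

lemma ell2_norm_sq (x : Ell2 ι) : ‖x‖ ^ 2 = ∑' i, ‖x i‖ ^ 2 := by
  simpa using lp.norm_rpow_eq_tsum (p := 2) (by norm_num) x

lemma ell2_inner (x y : Ell2 ι) : inner ℂ x y = ∑' i, conj (x i) * y i := by
  simp [lp.inner_eq_tsum, mul_comm]

/-- The diagonal operator on `ℓ²(ι)` with entries `d`. -/
def diagOp (d : EllInfty ι) : Ell2 ι →L[ℂ] Ell2 ι :=
  lp.mapCLM 2 (fun i => ContinuousLinearMap.mul ℂ ℂ (d i)) (norm_nonneg d) fun i => by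
    simpa using lp.norm_apply_le_norm ENNReal.top_ne_zero d i

@[simp] lemma diagOp_apply (d : EllInfty ι) (x : Ell2 ι) (i : ι) : diagOp d x i = d i * x i := rfl

lemma norm_diagOp_le (d : EllInfty ι) : ‖diagOp d‖ ≤ ‖d‖ := lp.norm_mapCLM_le ..

lemma adjoint_diagOp (d : EllInfty ι) :
    ContinuousLinearMap.adjoint (diagOp d) = diagOp (star d) := by
  refine ((ContinuousLinearMap.eq_adjoint_iff _ _).2 fun x y => ?_).symm
  simp only [ell2_inner, diagOp_apply, lp.star_apply]
  refine tsum_congr fun i => ?_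
  simp
  ring

lemma memℓp_infty_of_tendsto {d : ι → ℂ} (h : Tendsto d cofinite (𝓝 0)) : Memℓp d ∞ :=
  memℓp_infty h.norm.bddAbove_range_of_cofinite

lemma isCompactOperator_diagOp_of_finite {d : EllInfty ι} {s : Finset ι}
    (hd : ∀ i ∉ s, d i = 0) : IsCompactOperator (diagOp d) := by
  classical
  have hsum : diagOp d = ∑ i ∈ s, d i • (lp.singleContinuousLinearMap ℂ (fun _ : ι => ℂ) 2 i).comp
      (lp.evalCLM ℂ (fun _ : ι => ℂ) 2 i) := by
    ext x j
    have happly : ∀ i, (d i • (lp.singleContinuousLinearMap ℂ (fun _ : ι => ℂ) 2 i).comp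
        (lp.evalCLM ℂ (fun _ : ι => ℂ) 2 i)) x = d i • lp.single 2 i (x i) := fun i => rfl
    simp only [diagOp_apply, _root_.sum_apply, happly, lp.coeFn_sum, Finset.sum_apply,
      lp.coeFn_smul, Pi.smul_apply, lp.single_apply, Pi.single_apply, smul_eq_mul, mul_ite,
      mul_zero, Finset.sum_ite_eq]
    split_ifs with hj
    · rfl
    · rw [hd j hj, zero_mul]
  rw [hsum]
  refine (compactOperator (RingHom.id ℂ) (Ell2 ι) (Ell2 ι)).sum_mem fun i _ => ?_
  have heval : IsCompactOperator (lp.evalCLM ℂ (fun _ : ι => ℂ) 2 i) :=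
    isCompactOperator_of_locallyCompactSpace_dom _
  exact (heval.clm_comp (lp.singleContinuousLinearMap ℂ (fun _ : ι => ℂ) 2 i)).smul (d i)

lemma isCompactOperator_diagOp {d : EllInfty ι} (h : Tendsto d cofinite (𝓝 0)) :
    IsCompactOperator (diagOp d) := by
  classical
  refine isClosed_setOfPred_isCompactOperator.closure_subset
    (Metric.mem_closure_iff.2 fun ε hε => ?_)
  have hfin : {i | ¬ ‖d i‖ < ε / 2}.Finite :=
    h.norm.eventually (gt_mem_nhds (by simpa using hε))
  let t : EllInfty ι := ∑ i ∈ hfin.toFinset, lp.single ∞ i (d i)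
  have ht : ∀ i, t i = if i ∈ hfin.toFinset then d i else 0 := fun i => by
    simp only [t, lp.coeFn_sum, Finset.sum_apply, lp.single_apply, Pi.single_apply,
      Finset.sum_ite_eq]
  refine ⟨diagOp t, isCompactOperator_diagOp_of_finite fun i hi => by rw [ht, if_neg hi], ?_⟩
  have hsub : diagOp d - diagOp t = diagOp (d - t) := by
    ext x i
    exact (sub_mul (d i) (t i) (x i)).symm
  rw [dist_eq_norm, hsub]
  refine (norm_diagOp_le _).trans_lt (lt_of_le_of_lt ?_ (half_lt_self hε))
  refine lp.norm_le_of_forall_le (by positivity) fun i => ?_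
  rw [lp.coeFn_sub, Pi.sub_apply, ht]
  split_ifs with hi
  · rw [sub_self, norm_zero]
    exact (half_pos hε).le
  · simpa using le_of_lt (not_not.1 (mt hfin.mem_toFinset.2 hi))

end DiagonalOperators

section DiagonalPerturbations

open scoped ENNReal

open ContinuousLinearMap (adjoint)

variable {ι : Type*}

/-- `E` is an eigenvalue of the off-diagonal operator with blocks `diag lam + V` and
`(diag lam + V)*` on `ℓ²(ι) ⊕ ℓ²(ι)`. The diagonal part is unbounded, so the eigenvalue equation is
read coordinatewise. -/
def IsModeEigenvalue (lam : ι → ℂ) (V : Ell2 ι →L[ℂ] Ell2 ι) (E : ℝ) : Prop :=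
  ∃ x y : Ell2 ι, (x ≠ 0 ∨ y ≠ 0) ∧ (∀ i, lam i * x i + V x i = E * y i) ∧
    ∀ i, conj (lam i) * y i + adjoint V y i = E * x i

lemma tendsto_inv_of_tendsto_norm_atTop {lam : ι → ℂ}
    (hlam : Tendsto (fun i => ‖lam i‖) cofinite atTop) :
    Tendsto (fun i => (lam i)⁻¹) cofinite (𝓝 0) := by
  rw [tendsto_zero_iff_norm_tendsto_zero]
  simp only [norm_inv]
  exact hlam.inv_tendsto_atTop

lemma forall_mul_add_eq_iff {m : ι → ℂ} (hm : ∀ i, m i ≠ 0) {g : EllInfty ι}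
    (hg : ∀ i, g i = (m i)⁻¹) (W : Ell2 ι →L[ℂ] Ell2 ι) (x f : Ell2 ι) :
    (∀ i, m i * x i + W x i = f i) ↔ (1 + diagOp g * W) x = diagOp g f := by
  have hcoord : (1 + diagOp g * W) x = diagOp g f ↔ ∀ i, x i + g i * W x i = g i * f i :=
    ⟨fun h i => congr($h i), fun h => lp.ext (funext h)⟩
  rw [hcoord]
  refine forall_congr' fun i => ?_
  have := hm i
  rw [hg]
  field_simp

lemma exists_compact_inverse_of_forall_ne_zero {m : ι → ℂ} (hm : ∀ i, m i ≠ 0)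
    (hlim : Tendsto (fun i => ‖m i‖) cofinite atTop) (W : Ell2 ι →L[ℂ] Ell2 ι) :
    (∃ x : Ell2 ι, x ≠ 0 ∧ ∀ i, m i * x i + W x i = 0) ∨
    ∃ A : Ell2 ι →L[ℂ] Ell2 ι, IsCompactOperator A ∧
      (∀ x f, (∀ i, m i * x i + W x i = f i) ↔ x = A f) ∧
      ∀ y g, (∀ i, conj (m i) * y i + adjoint W y i = g i) ↔ y = adjoint A g := by
  have hinv := tendsto_inv_of_tendsto_norm_atTop hlim
  let g : EllInfty ι := ⟨fun i => (m i)⁻¹, memℓp_infty_of_tendsto hinv⟩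
  have hg : ∀ i, g i = (m i)⁻¹ := fun _ => rfl
  have hG : IsCompactOperator (diagOp g) := isCompactOperator_diagOp hinv
  rcases exists_add_apply_eq_zero_or_isUnit (T := diagOp g * W) (hG.comp_clm W) with
    ⟨x, hx0, hx⟩ | hu
  · exact .inl ⟨x, hx0, (forall_mul_add_eq_iff hm hg W x 0).2 (by simpa using hx)⟩
  · obtain ⟨v, hv⟩ := isUnit_one_add_mul_swap hu
    obtain ⟨u, hu⟩ := hu
    have hvu : (↑u⁻¹ * diagOp g : Ell2 ι →L[ℂ] Ell2 ι) = diagOp g * ↑v⁻¹ := by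
      rw [Units.inv_mul_eq_iff_eq_mul, ← mul_assoc, Units.eq_mul_inv_iff_mul_eq, hu, hv]
      noncomm_ring
    refine .inr ⟨↑u⁻¹ * diagOp g, hG.clm_comp (↑u⁻¹ : Ell2 ι →L[ℂ] Ell2 ι), fun x f => ?_,
      fun y f => ?_⟩
    · rw [forall_mul_add_eq_iff hm hg, ← hu, units_apply_eq_iff]
      rfl
    · have hstar : 1 + diagOp (star g) * adjoint W =
          ((star v : (Ell2 ι →L[ℂ] Ell2 ι)ˣ) : Ell2 ι →L[ℂ] Ell2 ι) := by
        rw [Units.coe_star, hv, star_add, star_one, star_mul, ← adjoint_diagOp]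
        rfl
      rw [forall_mul_add_eq_iff (m := fun i => conj (m i)) (g := star g) (by simpa using hm)
        (fun i => by simp [lp.star_apply, hg]), hstar, units_apply_eq_iff, hvu,
        ContinuousLinearMap.mul_def, ContinuousLinearMap.adjoint_comp, adjoint_diagOp]
      rfl

lemma exists_compact_inverse {lam : ι → ℂ}
    (hlam : Tendsto (fun i => ‖lam i‖) cofinite atTop) (V : Ell2 ι →L[ℂ] Ell2 ι) :
    (∃ x : Ell2 ι, x ≠ 0 ∧ ∀ i, lam i * x i + V x i = 0) ∨
    ∃ A : Ell2 ι →L[ℂ] Ell2 ι, IsCompactOperator A ∧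
      (∀ x f, (∀ i, lam i * x i + V x i = f i) ↔ x = A f) ∧
      ∀ y g, (∀ i, conj (lam i) * y i + adjoint V y i = g i) ↔ y = adjoint A g := by
  classical
  let p : EllInfty ι := ⟨fun i => if lam i = 0 then 1 else 0, memℓp_infty ⟨1, by
    rintro _ ⟨i, rfl⟩
    dsimp only
    split_ifs <;> simp⟩⟩
  have hp : ∀ i, p i = if lam i = 0 then 1 else 0 := fun _ => rfl
  have hm : ∀ i, lam i + p i ≠ 0 := fun i => by
    rw [hp]
    split_ifs with h <;> simp [h]
  have hlim : Tendsto (fun i => ‖lam i + p i‖) cofinite atTop := by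
    refine hlam.congr' ?_
    filter_upwards [hlam.eventually_gt_atTop 0] with i hi
    rw [hp, if_neg (norm_pos_iff.1 hi), add_zero]
  have hV : ∀ x i, (lam i + p i) * x i + (V - diagOp p) x i = lam i * x i + V x i := fun x i => by
    simp only [_root_.sub_apply, lp.coeFn_sub, Pi.sub_apply, diagOp_apply]
    ring
  have hV' : ∀ x i, conj (lam i + p i) * x i + adjoint (V - diagOp p) x i =
      conj (lam i) * x i + adjoint V x i := fun x i => by
    simp only [map_sub, adjoint_diagOp, _root_.sub_apply, lp.coeFn_sub, Pi.sub_apply, diagOp_apply,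
      lp.star_apply, map_add, RCLike.star_def]
    ring
  simpa only [hV, hV'] using exists_compact_inverse_of_forall_ne_zero hm hlim (V - diagOp p)

theorem exists_isLeast_modeEigenvalue [Nonempty ι] {lam : ι → ℂ}
    (hlam : Tendsto (fun i => ‖lam i‖) cofinite atTop) (V : Ell2 ι →L[ℂ] Ell2 ι) :
    ∃ E, IsLeast {E : ℝ | 0 ≤ E ∧ IsModeEigenvalue lam V E} E := by
  classical
  rcases exists_compact_inverse hlam V with ⟨x, hx0, hx⟩ | ⟨A, hA, hsolve, hsolve'⟩
  · exact ⟨0, ⟨le_rfl, x, 0, .inl hx0, by simpa using hx, by simp⟩, fun E hE => hE.1⟩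
  have hA0 : A ≠ 0 := by
    rintro rfl
    obtain ⟨i⟩ := ‹Nonempty ι›
    have h := (hsolve 0 (lp.single 2 i 1)).2 rfl i
    simp at h
  refine ⟨‖A‖⁻¹, ?_⟩
  convert isLeast_inv_norm_adjoint_system hA hA0 using 5 with E
  refine exists₂_congr fun x y => and_congr Iff.rfl ?_
  rw [← hsolve, ← hsolve']
  rfl

theorem exists_kernel_of_symmetry_class {lam : ι → ℂ}
    (hlam : Tendsto (fun i => ‖lam i‖) cofinite atTop)
    (V : Ell2 ι →L[ℂ] Ell2 ι) {i₀ : ι} (h0 : ∀ i, lam i = 0 ↔ i = i₀)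
    {Y : Submodule ℂ (Ell2 ι)} (hYc : IsClosed (Y : Set (Ell2 ι)))
    (hY0 : ∀ f ∈ Y, f i₀ = 0) (hYe : ∀ e : Ell2 ι, (∀ i, lam i * e i = 0) → V e ∈ Y)
    (hYV : ∀ f ∈ Y, ∀ x : Ell2 ι, (∀ i, x i = (lam i)⁻¹ * f i) → V x ∈ Y) :
    ∃ x : Ell2 ι, x ≠ 0 ∧ ∀ i, lam i * x i + V x i = 0 := by
  classical
  have hinv := tendsto_inv_of_tendsto_norm_atTop hlam
  let g : EllInfty ι := ⟨fun i => (lam i)⁻¹, memℓp_infty_of_tendsto hinv⟩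
  have hg : ∀ f ∈ Y, ∀ i, lam i * diagOp g f i = f i := fun f hf i => by
    by_cases hi : i = i₀
    · subst hi
      simp [hY0 f hf, (h0 i).2 rfl]
    · exact mul_inv_cancel_left₀ (mt (h0 i).1 hi) _
  have hmaps : ∀ f : Y, V (diagOp g f) ∈ Y := fun f => hYV f f.2 _ fun _ => rfl
  have : CompleteSpace Y := hYc.completeSpace_coe
  let T : Y →L[ℂ] Y := (V ∘L diagOp g ∘L Y.subtypeL).codRestrict Y hmaps
  have hT : IsCompactOperator T :=
    (((isCompactOperator_diagOp hinv).comp_clm Y.subtypeL).clm_comp V).codRestrict hmaps hYc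
  rcases exists_add_apply_eq_zero_or_isUnit hT with ⟨f, hf0, hf⟩ | ⟨u, hu⟩
  · have hf' : (f : Ell2 ι) + V (diagOp g f) = 0 := congr(($hf : Ell2 ι))
    refine ⟨diagOp g f, fun hz => hf0 ?_, fun i => ?_⟩
    · rw [hz, map_zero, add_zero] at hf'
      exact Subtype.ext hf'
    · rw [hg f f.2]
      exact congr($hf' i)
  · let e : Ell2 ι := lp.single 2 i₀ 1
    have he : ∀ i, lam i * e i = 0 := fun i => by
      by_cases hi : i = i₀
      · rw [(h0 i).2 hi, zero_mul]
      · rw [lp.single_apply_ne 2 i₀ 1 hi, mul_zero]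
    obtain ⟨f, hf⟩ : ∃ f : Y, (f : Ell2 ι) + V (diagOp g f) = -V e := by
      let b : Y := ⟨-V e, Y.neg_mem (hYe e he)⟩
      have hb := (units_apply_eq_iff u (y := b)).2 rfl
      rw [hu] at hb
      exact ⟨_, congr(($hb : Ell2 ι))⟩
    refine ⟨e + diagOp g f, fun hz => ?_, fun i => ?_⟩
    · have h := congr(($hz : Ell2 ι) i₀)
      simp [e, hY0 f f.2] at h
    · have hi : f.1 i + V (diagOp g f) i = -V e i := congr($hf i)
      simp only [map_add, lp.coeFn_add, Pi.add_apply]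
      linear_combination he i + hg f f.2 i + hi

end DiagonalPerturbations

section ShiftOperators

variable {ι M : Type*}

lemma memℓp_comp_perm (σ : Equiv.Perm ι) (x : Ell2 ι) : Memℓp (fun i => x (σ i)) 2 :=
  memℓp_two_iff.2 ((σ.summable_iff (f := fun i => ‖x i‖ ^ 2)).2 (summable_norm_sq x))

/-- Composition with a permutation of the index set, as an operator on `ℓ²(ι)`. -/
def permOp (σ : Equiv.Perm ι) : Ell2 ι →L[ℂ] Ell2 ι :=
  LinearMap.mkContinuous
    { toFun := fun x => ⟨fun i => x (σ i), memℓp_comp_perm σ x⟩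
      map_add' := fun x y => rfl
      map_smul' := fun c x => rfl } 1 (fun x => by
        refine lp.norm_le_of_tsum_le (by norm_num) (by positivity) ?_
        simp only [ENNReal.toReal_ofNat, Real.rpow_ofNat, one_mul]
        rw [ell2_norm_sq]
        exact (σ.tsum_eq fun i => ‖x i‖ ^ 2).le)

@[simp] lemma permOp_apply (σ : Equiv.Perm ι) (x : Ell2 ι) (i : ι) : permOp σ x i = x (σ i) := rfl

lemma norm_permOp_le (σ : Equiv.Perm ι) : ‖permOp σ‖ ≤ 1 :=
  LinearMap.mkContinuous_norm_le _ zero_le_one _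

lemma adjoint_permOp (σ : Equiv.Perm ι) :
    ContinuousLinearMap.adjoint (permOp σ) = permOp σ.symm := by
  refine ((ContinuousLinearMap.eq_adjoint_iff _ _).2 fun x y => ?_).symm
  simp only [ell2_inner, permOp_apply]
  rw [← σ.tsum_eq]
  simp only [Equiv.symm_apply_apply]

/-- The operator `x ↦ ∑ₘ c(m) x ∘ σ(m)` on `ℓ²(ι)`; it is `0` by the convention for divergent sums
unless `∑ₘ c(m) permOp (σ m)` converges in operator norm. -/
def shiftOp (c : M → ℂ) (σ : M → Equiv.Perm ι) : Ell2 ι →L[ℂ] Ell2 ι :=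
  ∑' m, c m • permOp (σ m)

lemma summable_smul_permOp {c : M → ℂ} (hc : Summable fun m => ‖c m‖) (σ : M → Equiv.Perm ι) :
    Summable fun m => c m • permOp (σ m) := by
  refine Summable.of_norm_bounded hc fun m => ?_
  rw [norm_smul]
  exact mul_le_of_le_one_right (norm_nonneg _) (norm_permOp_le _)

lemma shiftOp_apply {c : M → ℂ} (hc : Summable fun m => ‖c m‖) (σ : M → Equiv.Perm ι)
    (x : Ell2 ι) (i : ι) : shiftOp c σ x i = ∑' m, c m * x (σ m i) :=
  (((lp.evalCLM ℂ (fun _ : ι => ℂ) 2 i).comp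
    (ContinuousLinearMap.apply ℂ (Ell2 ι) x)).hasSum
    (summable_smul_permOp hc σ).hasSum).tsum_eq.symm

lemma adjoint_shiftOp {c : M → ℂ} (hc : Summable fun m => ‖c m‖) {σ : M → Equiv.Perm ι}
    (hσ : ∀ m, Function.Involutive (σ m)) :
    ContinuousLinearMap.adjoint (shiftOp c σ) = shiftOp (fun m => conj (c m)) σ := by
  have h := (ContinuousLinearMap.adjoint (𝕜 := ℂ) (E := Ell2 ι)
    (F := Ell2 ι)).toContinuousLinearEquiv.toContinuousLinearMap.hasSum
      (summable_smul_permOp hc σ).hasSum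
  refine h.tsum_eq.symm.trans (tsum_congr fun m => ?_)
  have hsymm : (σ m).symm = σ m := (hσ m).symm_eq_self_of_involutive
  change ContinuousLinearMap.adjoint (c m • permOp (σ m)) = _
  rw [map_smulₛₗ, adjoint_permOp, hsymm]

end ShiftOperators

section Decay

variable {ι M : Type*} {wt : ι → ℝ} {wtM : M → ℝ} {a L : ι → ℝ} {c : M → ℝ} {σ : M → ι → ι}

lemma pow_mul_tsum_le (hwt : ∀ i, 0 ≤ wt i) (hwtM : ∀ m, 0 ≤ wtM m) (ha : ∀ i, 0 ≤ a i)
    (hc0 : ∀ m, 0 ≤ c m) (hσ : ∀ m i, wt i ≤ wtM m * wt (σ m i)) {s : ℕ}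
    (hc : Summable fun m => c m * wtM m ^ s) {D : ℝ} (hD : ∀ i, wt i ^ s * a i ≤ D) {i : ι}
    (hi : Summable fun m => c m * a (σ m i)) :
    wt i ^ s * ∑' m, c m * a (σ m i) ≤ ∑' m, c m * wtM m ^ s * D := by
  rw [← tsum_mul_left]
  refine (hi.mul_left _).tsum_le_tsum (fun m => ?_) (hc.mul_right D)
  calc wt i ^ s * (c m * a (σ m i))
      ≤ (wtM m * wt (σ m i)) ^ s * (c m * a (σ m i)) :=
        mul_le_mul_of_nonneg_right (pow_le_pow_left₀ (hwt i) (hσ m i) s)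
          (mul_nonneg (hc0 m) (ha _))
    _ = c m * wtM m ^ s * (wt (σ m i) ^ s * a (σ m i)) := by ring
    _ ≤ c m * wtM m ^ s * D :=
        mul_le_mul_of_nonneg_left (hD _) (mul_nonneg (hc0 m) (pow_nonneg (hwtM m) s))

/-- Elliptic regularity on the Fourier side: the symbol `L` dominates the weight `wt`, so each use
of the equation gains one power of `wt`. -/
lemma exists_forall_pow_mul_le_of_convolution_le (hwt : ∀ i, 0 ≤ wt i) (hwtM : ∀ m, 0 ≤ wtM m)
    (ha : ∀ i, 0 ≤ a i) {B : ℝ} (hB : ∀ i, a i ≤ B) {C : ℝ} (hC : 0 ≤ C)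
    (hL : ∀ i, wt i ≤ C * (1 + L i)) (hc0 : ∀ m, 0 ≤ c m)
    (hc : ∀ s : ℕ, Summable fun m => c m * wtM m ^ s)
    (hσ : ∀ m i, wt i ≤ wtM m * wt (σ m i)) {E : ℝ} (hE : 0 ≤ E)
    (h : ∀ i, L i * a i ≤ E * a i + ∑' m, c m * a (σ m i)) (s : ℕ) :
    ∃ B, ∀ i, wt i ^ s * a i ≤ B := by
  have hcs : ∀ i, Summable fun m => c m * a (σ m i) := fun i => by
    refine Summable.of_nonneg_of_le (fun m => mul_nonneg (hc0 m) (ha _)) (fun m => ?_)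
      ((hc 0).mul_right B)
    simpa using mul_le_mul_of_nonneg_left (hB (σ m i)) (hc0 m)
  induction s with
  | zero => exact ⟨B, by simpa using hB⟩
  | succ s ih =>
    obtain ⟨D, hD⟩ := ih
    refine ⟨C * (D + (E * D + ∑' m, c m * wtM m ^ s * D)), fun i => ?_⟩
    have hws : 0 ≤ wt i ^ s := pow_nonneg (hwt i) s
    have hsum := pow_mul_tsum_le hwt hwtM ha hc0 hσ (hc s) hD (hcs i)
    calc wt i ^ (s + 1) * a i = wt i * (wt i ^ s * a i) := by ring
      _ ≤ C * (1 + L i) * (wt i ^ s * a i) :=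
          mul_le_mul_of_nonneg_right (hL i) (mul_nonneg hws (ha i))
      _ = C * (wt i ^ s * a i + wt i ^ s * (L i * a i)) := by ring
      _ ≤ C * (wt i ^ s * a i + wt i ^ s * (E * a i + ∑' m, c m * a (σ m i))) := by
          gcongr
          exact h i
      _ = C * (wt i ^ s * a i + (E * (wt i ^ s * a i) + wt i ^ s * ∑' m, c m * a (σ m i))) := by
          ring
      _ ≤ C * (D + (E * D + ∑' m, c m * wtM m ^ s * D)) := by
          gcongr <;> exact hD i

end Decay

section HexagonalGeometry

lemma omega_eq : ω₃ = -1 / 2 + (Real.sqrt 3 / 2 : ℝ) * Complex.I := by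
  have h : (2 * Real.pi * Complex.I / 3 : ℂ) = ((2 * Real.pi / 3 : ℝ) : ℂ) * Complex.I := by
    push_cast; ring
  have hπ : 2 * Real.pi / 3 = Real.pi - Real.pi / 3 := by ring
  rw [ω₃, h, Complex.exp_mul_I, ← Complex.ofReal_cos, ← Complex.ofReal_sin, hπ, Real.cos_pi_sub,
    Real.sin_pi_sub, Real.cos_pi_div_three, Real.sin_pi_div_three]
  push_cast; ring

lemma omega_re : ω₃.re = -1 / 2 := by rw [omega_eq]; simp

lemma omega_im : ω₃.im = Real.sqrt 3 / 2 := by rw [omega_eq]; simp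

lemma omega_sq : ω₃ ^ 2 = -1 - ω₃ := by
  have h3 : ((Real.sqrt 3 : ℝ) : ℂ) ^ 2 = 3 := by
    rw [← Complex.ofReal_pow, Real.sq_sqrt (by norm_num)]; simp
  rw [omega_eq]
  push_cast
  linear_combination (1 / 4 : ℂ) * (Complex.I ^ 2) * h3 + (3 / 4 : ℂ) * Complex.I_sq

lemma omega_ne_zero : ω₃ ≠ 0 := Complex.exp_ne_zero _

lemma omega_ne_one : ω₃ ≠ 1 := by
  intro h
  have := congrArg Complex.re h
  rw [omega_re] at this
  norm_num at this

lemma conj_omega_mul : conj ω₃ * ω₃ = 1 := by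
  have := Real.sq_sqrt (show (0 : ℝ) ≤ 3 by norm_num)
  have h : Complex.normSq ω₃ = 1 := by
    rw [Complex.normSq_apply, omega_re, omega_im]
    linarith
  rw [mul_comm, Complex.mul_conj, h, Complex.ofReal_one]

lemma pair_eq (z w : ℂ) : pair z w = z.re * w.re + z.im * w.im := by simp [pair]

lemma pair_comm (z w : ℂ) : pair z w = pair w z := by simp [pair_eq]; ring

lemma pair_add_left (a b c : ℂ) : pair (a + b) c = pair a c + pair b c := by
  simp [pair_eq]; ring

lemma pair_add_right (a b c : ℂ) : pair a (b + c) = pair a b + pair a c := by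
  simp [pair_eq]; ring

lemma pair_neg_left (a b : ℂ) : pair (-a) b = -pair a b := by simp [pair_eq]; ring

lemma pair_neg_right (a b : ℂ) : pair a (-b) = -pair a b := by simp [pair_eq]; ring

lemma pair_zero_left (a : ℂ) : pair 0 a = 0 := by simp [pair_eq]

lemma pair_omega_mul (p z : ℂ) : pair (ω₃ * p) (ω₃ * z) = pair p z := by
  have h : ω₃ * p * conj (ω₃ * z) = p * conj z := by
    rw [map_mul]; linear_combination (p * conj z) * conj_omega_mul
  rw [pair, h, pair]

end HexagonalGeometry

section PlaneWave

/-- The plane wave `z ↦ e^{i⟨p, z⟩}`. -/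
def wave (p z : ℂ) : ℂ := Complex.exp (Complex.I * pair p z)

lemma wave_add_left (p q z : ℂ) : wave (p + q) z = wave p z * wave q z := by
  rw [wave, wave, wave, ← Complex.exp_add, pair_add_left]; push_cast; ring_nf

lemma wave_add_right (p z w : ℂ) : wave p (z + w) = wave p z * wave p w := by
  rw [wave, wave, wave, ← Complex.exp_add, pair_add_right]; push_cast; ring_nf

lemma wave_zero_left (z : ℂ) : wave 0 z = 1 := by simp [wave, pair_zero_left]

lemma wave_ne_zero (p z : ℂ) : wave p z ≠ 0 := Complex.exp_ne_zero _

lemma norm_wave (p z : ℂ) : ‖wave p z‖ = 1 := by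
  rw [wave, mul_comm]; exact Complex.norm_exp_ofReal_mul_I _

lemma wave_neg_left (p z : ℂ) : wave (-p) z = (wave p z)⁻¹ := by
  rw [wave, wave, ← Complex.exp_neg, pair_neg_left]; push_cast; ring_nf

lemma wave_neg_right (p z : ℂ) : wave p (-z) = (wave p z)⁻¹ := by
  rw [wave, wave, ← Complex.exp_neg, pair_neg_right]; push_cast; ring_nf

lemma wave_neg_mul_wave (p z : ℂ) : wave (-p) z * wave p z = 1 := by
  rw [wave_neg_left, inv_mul_cancel₀ (wave_ne_zero p z)]

lemma conj_wave (p z : ℂ) : conj (wave p z) = wave (-p) z := by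
  rw [wave, wave, ← Complex.exp_conj, pair_neg_left]; simp

lemma wave_omega_mul (p z : ℂ) : wave (ω₃ * p) (ω₃ * z) = wave p z := by
  rw [wave, wave, pair_omega_mul]

/-- The linear form `v ↦ i⟨p, v⟩`, the logarithmic derivative of `wave p`. -/
def waveForm (p : ℂ) : ℂ →L[ℝ] ℂ :=
  Complex.I • (Complex.ofRealCLM ∘L
    (p.re • Complex.reCLM + p.im • Complex.imCLM))

lemma waveForm_apply (p v : ℂ) : waveForm p v = Complex.I * pair p v := by
  simp [waveForm, pair_eq, mul_add]

lemma wave_eq_exp_waveForm (p : ℂ) : wave p = fun z => Complex.exp (waveForm p z) := by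
  ext z
  rw [waveForm_apply, wave]

lemma norm_waveForm_le (p : ℂ) : ‖waveForm p‖ ≤ 2 * ‖p‖ := by
  refine ContinuousLinearMap.opNorm_le_bound _ (by positivity) fun v => ?_
  rw [waveForm_apply, norm_mul, Complex.norm_I, one_mul, Complex.norm_real, pair]
  refine (Complex.abs_re_le_norm _).trans ?_
  rw [norm_mul, RCLike.norm_conj]
  nlinarith [norm_nonneg p, norm_nonneg v, mul_nonneg (norm_nonneg p) (norm_nonneg v)]

lemma hasFDerivAt_wave (p z : ℂ) : HasFDerivAt (wave p) (wave p z • waveForm p) z := by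
  simp only [wave_eq_exp_waveForm]
  exact (waveForm p).hasFDerivAt.cexp

lemma contDiff_wave (p : ℂ) : ContDiff ℝ ∞ (wave p) := by
  rw [wave_eq_exp_waveForm]
  exact Complex.contDiff_exp.comp (waveForm p).contDiff

lemma continuous_wave (p : ℂ) : Continuous (wave p) := (contDiff_wave p).continuous

end PlaneWave

section DualLattice

/-- The point of the dual lattice with `⟨freq n, s + t ω⟩ = 2π (n₁ s + n₂ t)`. -/
def freq (n : ℤ × ℤ) : ℂ :=
  4 * (Real.pi : ℂ) * Complex.I / (Real.sqrt 3 : ℂ) * ((-n.1 : ℂ) * ω₃ + n.2)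

lemma dualLattice_eq_range : dualLattice = Set.range freq := by
  ext z
  constructor
  · rintro ⟨γ, ⟨m, n, rfl⟩, rfl⟩
    exact ⟨(-m, n), by simp [freq]⟩
  · rintro ⟨n, rfl⟩
    exact ⟨_, ⟨-n.1, n.2, rfl⟩, by simp [freq]⟩

lemma freq_add (m n : ℤ × ℤ) : freq (m + n) = freq m + freq n := by
  simp [freq]; ring

lemma freq_neg (m : ℤ × ℤ) : freq (-m) = -freq m := by
  simp [freq]; ring

lemma freq_sub (m n : ℤ × ℤ) : freq (m - n) = freq m - freq n := by
  rw [sub_eq_add_neg, freq_add, freq_neg, sub_eq_add_neg]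

lemma freq_zero : freq 0 = 0 := by simp [freq]

lemma sqrt3_pos : 0 < Real.sqrt 3 := Real.sqrt_pos.2 (by norm_num)

lemma freq_re (n : ℤ × ℤ) : (freq n).re = 2 * Real.pi * n.1 := by
  have h := sqrt3_pos.ne'
  have e : freq n = ((4 * Real.pi / Real.sqrt 3 : ℝ) : ℂ) *
      (Complex.I * ((-n.1 : ℂ) * ω₃ + n.2)) := by
    rw [freq]; push_cast; ring
  rw [e, Complex.re_ofReal_mul]
  simp [omega_re, omega_im]
  field_simp
  ring

lemma freq_im (n : ℤ × ℤ) : (freq n).im = 2 * Real.pi * (n.1 + 2 * n.2) / Real.sqrt 3 := by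
  have h := sqrt3_pos.ne'
  have e : freq n = ((4 * Real.pi / Real.sqrt 3 : ℝ) : ℂ) *
      (Complex.I * ((-n.1 : ℂ) * ω₃ + n.2)) := by
    rw [freq]; push_cast; ring
  rw [e, Complex.im_ofReal_mul]
  simp [omega_re, omega_im]
  field_simp
  ring

/-- Lattice coordinates: `(s, t) ↦ s + t ω`. -/
def latPt (x : ℝ × ℝ) : ℂ := x.1 + x.2 * ω₃

lemma latPt_re (x : ℝ × ℝ) : (latPt x).re = x.1 - x.2 / 2 := by
  simp [latPt, omega_re]; ring

lemma latPt_im (x : ℝ × ℝ) : (latPt x).im = x.2 * (Real.sqrt 3 / 2) := by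
  simp [latPt, omega_im]

lemma latPt_add (x y : ℝ × ℝ) : latPt (x + y) = latPt x + latPt y := by
  simp [latPt]; ring

lemma pair_freq_latPt (n : ℤ × ℤ) (x : ℝ × ℝ) :
    pair (freq n) (latPt x) = 2 * Real.pi * (n.1 * x.1 + n.2 * x.2) := by
  have h := sqrt3_pos.ne'
  rw [pair_eq, freq_re, freq_im, latPt_re, latPt_im]
  field_simp
  ring

lemma latPt_int_mem (m n : ℤ) : latPt (m, n) ∈ lattice :=
  ⟨n, m, by simp [latPt]; ring⟩

lemma mem_lattice_iff (γ : ℂ) : γ ∈ lattice ↔ ∃ m n : ℤ, γ = latPt (m, n) := by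
  constructor
  · rintro ⟨m, n, rfl⟩; exact ⟨n, m, by simp [latPt]; ring⟩
  · rintro ⟨m, n, rfl⟩; exact latPt_int_mem m n

lemma one_mem_lattice : (1 : ℂ) ∈ lattice := ⟨0, 1, by simp⟩

lemma omega_mem_lattice : ω₃ ∈ lattice := ⟨1, 0, by simp⟩

lemma wave_freq_latPt (n : ℤ × ℤ) (x : ℝ × ℝ) :
    wave (freq n) (latPt x) = Complex.exp (2 * Real.pi * Complex.I * (n.1 * x.1 + n.2 * x.2)) := by
  rw [wave, pair_freq_latPt]; push_cast; ring_nf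

lemma wave_freq_lattice (n : ℤ × ℤ) {γ : ℂ} (hγ : γ ∈ lattice) : wave (freq n) γ = 1 := by
  obtain ⟨a, b, rfl⟩ := (mem_lattice_iff γ).1 hγ
  rw [wave_freq_latPt, Complex.exp_eq_one_iff]
  exact ⟨n.1 * a + n.2 * b, by push_cast; ring⟩

lemma mem_dualLattice_of_wave_eq_one {k : ℂ} (h1 : wave k 1 = 1) (h2 : wave k ω₃ = 1) :
    k ∈ dualLattice := by
  have key : ∀ z, wave k z = 1 → ∃ n : ℤ, pair k z = 2 * Real.pi * n := by
    intro z hz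
    rw [wave, Complex.exp_eq_one_iff] at hz
    obtain ⟨n, hn⟩ := hz
    refine ⟨n, ?_⟩
    have : (pair k z : ℂ) = ((2 * Real.pi * n : ℝ) : ℂ) := by
      push_cast
      linear_combination (-Complex.I) * hn + (pair k z - 2 * Real.pi * n : ℂ) * Complex.I_sq
    exact_mod_cast this
  obtain ⟨a, ha⟩ := key 1 h1
  obtain ⟨b, hb⟩ := key ω₃ h2
  rw [dualLattice_eq_range]
  refine ⟨(a, b), Complex.ext ?_ ?_⟩
  · rw [freq_re, ← ha]; simp [pair_eq]
  · rw [freq_im]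
    rw [pair_eq] at ha hb
    simp only [Complex.one_re, Complex.one_im, omega_re, omega_im] at ha hb
    have h := sqrt3_pos.ne'
    field_simp
    linarith

lemma dualLattice_add {p q : ℂ} (hp : p ∈ dualLattice) (hq : q ∈ dualLattice) :
    p + q ∈ dualLattice := by
  rw [dualLattice_eq_range] at *
  obtain ⟨m, rfl⟩ := hp
  obtain ⟨n, rfl⟩ := hq
  exact ⟨m + n, freq_add m n⟩

lemma dualLattice_neg {p : ℂ} (hp : p ∈ dualLattice) : -p ∈ dualLattice := by
  rw [dualLattice_eq_range] at *
  obtain ⟨m, rfl⟩ := hp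
  exact ⟨-m, freq_neg m⟩

/-- The action of multiplication by `ω` on dual lattice indices. -/
def rotIdx : Equiv.Perm (ℤ × ℤ) where
  toFun n := (-(n.1 + n.2), n.1)
  invFun n := (n.2, -n.1 - n.2)
  left_inv n := by ext <;> simp
  right_inv n := by ext <;> simp

lemma freq_rotIdx (n : ℤ × ℤ) : freq (rotIdx n) = ω₃ * freq n := by
  have := omega_sq
  simp only [freq, rotIdx, Equiv.coe_fn_mk]
  push_cast
  linear_combination (4 * (Real.pi : ℂ) * Complex.I / (Real.sqrt 3 : ℂ) * n.1) * this

lemma freq_injective : Function.Injective freq := by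
  intro m n h
  have h1 := congrArg Complex.re h
  have h2 := congrArg Complex.im h
  have hs := sqrt3_pos.ne'
  rw [freq_re, freq_re] at h1
  rw [freq_im, freq_im] at h2
  have e1 : (m.1 : ℝ) = n.1 := by
    have : 2 * Real.pi ≠ 0 := by positivity
    exact mul_left_cancel₀ this h1
  rw [e1] at h2
  field_simp at h2
  have e2 : (m.2 : ℝ) = n.2 := by linarith
  exact Prod.ext (by exact_mod_cast e1) (by exact_mod_cast e2)

lemma omega_dualLattice {p : ℂ} (hp : p ∈ dualLattice) : ω₃ * p ∈ dualLattice := by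
  rw [dualLattice_eq_range] at *
  obtain ⟨m, rfl⟩ := hp
  exact ⟨rotIdx m, freq_rotIdx m⟩

lemma IsDiracPoint.three_mul_mem {K : ℂ} (hK : IsDiracPoint K) : 3 * K ∈ dualLattice := by
  have h1 := hK.rot
  have h2 := omega_dualLattice h1
  have : 3 * K = -((ω₃ * K - K) + ((ω₃ * K - K) + ω₃ * (ω₃ * K - K))) := by
    linear_combination K * omega_sq
  rw [this]
  exact dualLattice_neg (dualLattice_add h1 (dualLattice_add h1 h2))

lemma IsDiracPoint.two_mul_notMem {K : ℂ} (hK : IsDiracPoint K) : 2 * K ∉ dualLattice := by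
  intro h
  refine hK.ne_zero ?_
  rw [show K = 3 * K + -(2 * K) by ring]
  exact dualLattice_add hK.three_mul_mem (dualLattice_neg h)

end DualLattice

section Weight

/-- The weight `1 + |n₁| + |n₂|` on dual lattice indices; submultiplicative, and comparable to
`1 + ‖freq n‖`. -/
def weight (n : ℤ × ℤ) : ℝ := 1 + |(n.1 : ℝ)| + |(n.2 : ℝ)|

lemma one_le_weight (n : ℤ × ℤ) : 1 ≤ weight n := by
  have := abs_nonneg (n.1 : ℝ); have := abs_nonneg (n.2 : ℝ); unfold weight; linarith

lemma weight_pos (n : ℤ × ℤ) : 0 < weight n := zero_lt_one.trans_le (one_le_weight n)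

lemma weight_add_le (m n : ℤ × ℤ) : weight (m + n) ≤ weight m * weight n := by
  simp only [weight, Prod.fst_add, Prod.snd_add, Int.cast_add]
  have h1 := abs_add_le (m.1 : ℝ) n.1
  have h2 := abs_add_le (m.2 : ℝ) n.2
  have a := abs_nonneg (m.1 : ℝ); have b := abs_nonneg (m.2 : ℝ)
  have c := abs_nonneg (n.1 : ℝ); have d := abs_nonneg (n.2 : ℝ)
  nlinarith [mul_nonneg a c, mul_nonneg a d, mul_nonneg b c, mul_nonneg b d]

lemma weight_neg (m : ℤ × ℤ) : weight (-m) = weight m := by simp [weight]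

lemma weight_le_norm_freq (n : ℤ × ℤ) : weight n ≤ 1 + ‖freq n‖ := by
  have h1 := Complex.abs_re_le_norm (freq n)
  have h2 := Complex.abs_im_le_norm (freq n)
  rw [freq_re] at h1
  rw [freq_im] at h2
  have hs : Real.sqrt 3 ≤ 2 := by
    rw [Real.sqrt_le_left (by norm_num)]; norm_num
  have hp := Real.pi_gt_three
  rw [abs_mul, abs_of_pos (by positivity)] at h1
  rw [abs_div, abs_mul, abs_of_pos (show 0 < 2 * Real.pi by positivity), abs_of_pos sqrt3_pos,
    div_le_iff₀ sqrt3_pos] at h2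
  have h3 : |(n.2 : ℝ)| ≤ |(n.1 + 2 * n.2 : ℝ)| / 2 + |(n.1 : ℝ)| / 2 := by
    have : (n.2 : ℝ) = (n.1 + 2 * n.2) / 2 - n.1 / 2 := by ring
    calc |(n.2 : ℝ)| = |(n.1 + 2 * n.2 : ℝ) / 2 - n.1 / 2| := by rw [← this]
      _ ≤ |(n.1 + 2 * n.2 : ℝ) / 2| + |(n.1 : ℝ) / 2| := abs_sub _ _
      _ = _ := by rw [abs_div, abs_div]; simp
  have h4 : 6 * |(n.1 : ℝ)| ≤ ‖freq n‖ :=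
    (mul_le_mul_of_nonneg_right (by linarith) (abs_nonneg _)).trans h1
  have h5 : 6 * |(n.1 + 2 * n.2 : ℝ)| ≤ ‖freq n‖ * 2 :=
    (mul_le_mul_of_nonneg_right (by linarith) (abs_nonneg _)).trans
      (h2.trans (mul_le_mul_of_nonneg_left hs (norm_nonneg _)))
  unfold weight
  have := norm_nonneg (freq n)
  linarith

lemma weight_le_norm_freq_add (p : ℂ) (n : ℤ × ℤ) :
    weight n ≤ (1 + ‖p‖) * (1 + ‖freq n + p‖) := by
  have h1 := weight_le_norm_freq n
  have h2 : ‖freq n‖ ≤ ‖freq n + p‖ + ‖p‖ := by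
    simpa only [add_sub_cancel_right] using norm_sub_le (freq n + p) p
  nlinarith [norm_nonneg p, norm_nonneg (freq n + p)]

lemma norm_freq_le (n : ℤ × ℤ) : ‖freq n‖ ≤ 40 * weight n := by
  have hπ := Real.pi_lt_four
  have hs : 1 ≤ Real.sqrt 3 := by rw [Real.one_le_sqrt]; norm_num
  have ha := abs_nonneg (n.1 : ℝ)
  have hb := abs_nonneg (n.2 : ℝ)
  have htri : |(n.1 + 2 * n.2 : ℝ)| ≤ |(n.1 : ℝ)| + 2 * |(n.2 : ℝ)| := by
    simpa only [abs_mul, Nat.abs_ofNat] using abs_add_le (n.1 : ℝ) (2 * n.2)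
  have hre : |(freq n).re| ≤ 8 * |(n.1 : ℝ)| := by
    rw [freq_re, abs_mul, abs_of_pos (by positivity)]
    nlinarith
  have him : |(freq n).im| ≤ 8 * (|(n.1 : ℝ)| + 2 * |(n.2 : ℝ)|) := by
    rw [freq_im, abs_div, abs_mul, abs_of_pos (show 0 < 2 * Real.pi by positivity),
      abs_of_pos sqrt3_pos]
    refine (div_le_self (by positivity) hs).trans ?_
    exact mul_le_mul (by linarith) htri (abs_nonneg _) (by norm_num)
  refine (Complex.norm_le_abs_re_add_abs_im _).trans ?_
  unfold weight
  linarith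

lemma exists_norm_freq_add_le (p : ℂ) : ∃ C, 0 ≤ C ∧ ∀ n, ‖freq n + p‖ ≤ C * weight n := by
  refine ⟨40 + ‖p‖, by positivity, fun n => (norm_add_le _ _).trans ?_⟩
  nlinarith [norm_freq_le n, one_le_weight n, norm_nonneg p]

lemma finite_weight_le (R : ℝ) : {n : ℤ × ℤ | weight n ≤ R}.Finite := by
  refine ((Set.finite_Icc (-⌈R⌉) ⌈R⌉).prod (Set.finite_Icc (-⌈R⌉) ⌈R⌉)).subset ?_
  intro n hn
  simp only [weight, Set.mem_ofPred_eq] at hn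
  have a := abs_nonneg (n.1 : ℝ); have b := abs_nonneg (n.2 : ℝ)
  have hR := Int.le_ceil R
  have h1 : |(n.1 : ℝ)| ≤ ⌈R⌉ := by linarith
  have h2 : |(n.2 : ℝ)| ≤ ⌈R⌉ := by linarith
  rw [abs_le] at h1 h2
  exact ⟨⟨by exact_mod_cast h1.1, by exact_mod_cast h1.2⟩,
    ⟨by exact_mod_cast h2.1, by exact_mod_cast h2.2⟩⟩

lemma tendsto_norm_freq_add (p : ℂ) :
    Tendsto (fun n => ‖freq n + p‖) cofinite atTop := by
  rw [tendsto_atTop]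
  intro R
  refine ((finite_weight_le ((1 + ‖p‖) * (1 + R))).subset ?_)
  intro n hn
  simp only [Set.mem_compl_iff, Set.mem_ofPred_eq, not_le] at hn ⊢
  refine (weight_le_norm_freq_add p n).trans ?_
  gcongr

lemma summable_weight_inv : Summable fun n : ℤ × ℤ => (weight n ^ 4)⁻¹ := by
  have h1 : Summable fun n : ℤ => ((1 + |(n : ℝ)|) ^ 2)⁻¹ := by
    have h := (Real.summable_one_div_int_pow (p := 2)).2 (by norm_num)
    rw [← (Set.finite_singleton (0 : ℤ)).summable_compl_iff] at h ⊢
    refine Summable.of_nonneg_of_le (fun n => inv_nonneg.2 (sq_nonneg _)) (fun n => ?_) h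
    have hn : (n : ℤ) ≠ 0 := n.2
    have hn' : 0 < |((n : ℤ) : ℝ)| := abs_pos.2 (by exact_mod_cast hn)
    simp only [Function.comp_apply]
    rw [one_div, ← sq_abs ((n : ℤ) : ℝ)]
    refine inv_anti₀ (by positivity) (pow_le_pow_left₀ hn'.le (by linarith) 2)
  have h2 := Summable.mul_of_nonneg h1 h1 (fun n => by positivity) (fun n => by positivity)
  refine Summable.of_nonneg_of_le (fun n => by have := weight_pos n; positivity) (fun n => ?_) h2
  have a := abs_nonneg (n.1 : ℝ); have b := abs_nonneg (n.2 : ℝ)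
  rw [← mul_inv, show weight n ^ 4 = weight n ^ 2 * weight n ^ 2 by ring]
  refine inv_anti₀ (by positivity) (mul_le_mul ?_ ?_ (by positivity) (by positivity))
  · exact pow_le_pow_left₀ (by linarith) (by unfold weight; linarith) 2
  · exact pow_le_pow_left₀ (by linarith) (by unfold weight; linarith) 2

end Weight

section TorusFourier

/-- The half-open unit square, in lattice coordinates a fundamental domain of `lattice`. -/
def unitSquare : Set (ℝ × ℝ) := Set.Ioc 0 1 ×ˢ Set.Ioc 0 1

lemma measurableSet_unitSquare : MeasurableSet unitSquare :=
  measurableSet_Ioc.prod measurableSet_Ioc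

/-- The Fourier monomials on the unit square. -/
def sqExp (n : ℤ × ℤ) (x : ℝ × ℝ) : ℂ :=
  Complex.exp (2 * Real.pi * Complex.I * (n.1 * x.1 + n.2 * x.2))

attribute [local instance] instMeasureSpaceUnitAddCircle

/-- The lift of a point of the two-dimensional torus to the unit square; it transports Mathlib's
Fourier basis of the torus to the square. -/
def torusLift (t : UnitAddTorus (Fin 2)) : ℝ × ℝ :=
  MeasurableEquiv.finTwoArrow (UnitAddTorus.measurableEquivPiIoc (fun _ => (0 : ℝ)) t : Fin 2 → ℝ)

lemma measurePreserving_torusLift :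
    MeasurePreserving torusLift volume (volume.restrict unitSquare) := by
  have h1 := UnitAddTorus.measurePreserving_equivPiIoc (fun _ : Fin 2 => (0 : ℝ))
  have hm : MeasurableSet {x : Fin 2 → ℝ | ∀ i, x i ∈ Set.Ioc (0 : ℝ) (0 + 1)} :=
    MeasurableSet.univ_pi' fun _ => measurableSet_Ioc
  have h2 := measurePreserving_subtype_coe (μa := (volume : Measure (Fin 2 → ℝ))) hm
  have h3 := (volume_preserving_finTwoArrow ℝ).restrict_preimage measurableSet_unitSquare
  have h4 : (MeasurableEquiv.finTwoArrow (α := ℝ)) ⁻¹' unitSquare =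
      {x : Fin 2 → ℝ | ∀ i, x i ∈ Set.Ioc (0 : ℝ) (0 + 1)} := by
    ext x
    simp [unitSquare, MeasurableEquiv.finTwoArrow, Fin.forall_fin_two]
  rw [h4] at h3
  exact h3.comp (h2.comp h1)

lemma mFourier_eq_sqExp (n : Fin 2 → ℤ) (t : UnitAddTorus (Fin 2)) :
    UnitAddTorus.mFourier n t = sqExp (n 0, n 1) (torusLift t) := by
  have hlift : ∀ i, (((UnitAddTorus.measurableEquivPiIoc (fun _ : Fin 2 => (0 : ℝ)) t) :
      Fin 2 → ℝ) i : UnitAddCircle) = t i :=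
    fun i => congrFun
      ((UnitAddTorus.measurableEquivPiIoc fun _ : Fin 2 => (0 : ℝ)).symm_apply_apply t) i
  rw [UnitAddTorus.mFourier, ContinuousMap.coe_mk, Fin.prod_univ_two, ← hlift 0, ← hlift 1,
    fourier_coe_apply, fourier_coe_apply, ← Complex.exp_add, sqExp]
  congr 1
  simp only [torusLift, MeasurableEquiv.finTwoArrow, MeasurableEquiv.piFinTwo_apply,
    Complex.ofReal_one]
  ring

lemma mFourierCoeff_comp_torusLift {f : ℝ × ℝ → ℂ}
    (hf : AEStronglyMeasurable f (volume.restrict unitSquare)) (n : Fin 2 → ℤ) :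
    UnitAddTorus.mFourierCoeff (f ∘ torusLift) n =
      ∫ x in unitSquare, sqExp (-n 0, -n 1) x * f x := by
  have h : AEStronglyMeasurable (fun x => sqExp (-n 0, -n 1) x * f x)
      (volume.restrict unitSquare) := by
    refine AEStronglyMeasurable.mul ?_ hf
    refine Continuous.aestronglyMeasurable ?_
    unfold sqExp; fun_prop
  have h1 := integral_map measurePreserving_torusLift.aemeasurable
    (by rw [measurePreserving_torusLift.map_eq]; exact h)
  rw [measurePreserving_torusLift.map_eq] at h1
  rw [h1]
  simp only [UnitAddTorus.mFourierCoeff, mFourier_eq_sqExp]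
  rfl

lemma exists_torus_Lp {f : ℝ × ℝ → ℂ} (hf : MemLp f 2 (volume.restrict unitSquare)) :
    ∃ F : Lp ℂ 2 (volume : Measure (UnitAddTorus (Fin 2))),
      (F =ᵐ[volume] f ∘ torusLift) ∧
      ∀ n, UnitAddTorus.mFourierBasis.repr F n = ∫ x in unitSquare, sqExp (-n 0, -n 1) x * f x := by
  have h := hf.comp_measurePreserving measurePreserving_torusLift
  refine ⟨h.toLp _, h.coeFn_toLp, fun n => ?_⟩
  rw [UnitAddTorus.mFourierBasis_repr, ← mFourierCoeff_comp_torusLift hf.1]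
  refine integral_congr_ae ?_
  filter_upwards [h.coeFn_toLp] with t ht
  rw [ht]

lemma ae_eq_zero_of_sqCoeff_eq_zero {f : ℝ × ℝ → ℂ} (hf : MemLp f 2 (volume.restrict unitSquare))
    (h : ∀ n, ∫ x in unitSquare, sqExp (-n) x * f x = 0) : f =ᵐ[volume.restrict unitSquare] 0 := by
  obtain ⟨F, hF1, hF2⟩ := exists_torus_Lp hf
  have hF0 : F = 0 := by
    apply UnitAddTorus.mFourierBasis.repr.injective
    rw [map_zero]
    ext n
    rw [hF2]
    exact h (n 0, n 1)
  have h1 : f ∘ torusLift =ᵐ[volume] 0 := by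
    refine hF1.symm.trans ?_
    rw [hF0]; exact Lp.coeFn_zero _ _ _
  have h2 := eLpNorm_comp_measurePreserving (p := 2) hf.1 measurePreserving_torusLift
  rw [eLpNorm_congr_ae h1] at h2
  have h3 : eLpNorm f 2 (volume.restrict unitSquare) = 0 := by rw [← h2]; simp
  exact (eLpNorm_eq_zero_iff hf.1 (by norm_num)).1 h3

lemma summable_sq_sqCoeff {f : ℝ × ℝ → ℂ} (hf : MemLp f 2 (volume.restrict unitSquare)) :
    Summable fun n : ℤ × ℤ => ‖∫ x in unitSquare, sqExp (-n) x * f x‖ ^ 2 := by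
  obtain ⟨F, -, hF⟩ := exists_torus_Lp hf
  have h := summable_norm_sq (UnitAddTorus.mFourierBasis.repr F)
  have h1 := (finTwoArrowEquiv ℤ).symm.summable_iff.2 h
  refine h1.congr fun n => ?_
  simp only [Function.comp_apply, hF]
  rfl

lemma integral_sqExp (n : ℤ × ℤ) : ∫ x in unitSquare, sqExp n x = if n = 0 then 1 else 0 := by
  have h := mFourierCoeff_comp_torusLift (f := fun _ => 1) aestronglyMeasurable_const
    (fun i => if i = 0 then -n.1 else -n.2)
  simp only [Fin.isValue, ↓reduceIte, neg_neg, one_ne_zero, mul_one] at h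
  rw [show n = (n.1, n.2) from rfl, ← h]
  have h2 := orthonormal_iff_ite.1 (UnitAddTorus.orthonormal_mFourier (d := Fin 2))
    (fun i => if i = 0 then -n.1 else -n.2) 0
  simp only [ContinuousMap.inner_toLp, ← UnitAddTorus.mFourier_neg,
    UnitAddTorus.mFourier_zero] at h2
  simp only [UnitAddTorus.mFourierCoeff, Function.comp_apply, smul_eq_mul]
  simp only [ContinuousMap.one_apply, one_mul] at h2
  simp only [mul_one]
  rw [h2]
  congr 1
  rw [funext_iff, Fin.forall_fin_two]
  simp [Prod.ext_iff]

end TorusFourier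

section LatticeCoordinates

/-- `latPt` as a linear equivalence. -/
def latLin : (ℝ × ℝ) ≃ₗ[ℝ] ℂ where
  toFun := latPt
  map_add' := latPt_add
  map_smul' c x := by simp [latPt]; ring
  invFun z := (z.re + z.im / Real.sqrt 3, 2 * z.im / Real.sqrt 3)
  left_inv x := by
    have := sqrt3_pos.ne'
    ext
    · simp only [latPt_re, latPt_im]; field_simp; ring
    · simp only [latPt_im]; field_simp
  right_inv z := by
    have := sqrt3_pos.ne'
    apply Complex.ext
    · simp only [latPt_re]; field_simp; ring
    · simp only [latPt_im]; field_simp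

/-- `latPt` as a continuous linear equivalence. -/
def latEquiv : (ℝ × ℝ) ≃L[ℝ] ℂ := latLin.toContinuousLinearEquiv

@[simp] lemma latEquiv_apply (x : ℝ × ℝ) : latEquiv x = latPt x := rfl

lemma continuous_latPt : Continuous latPt := latEquiv.continuous

lemma hasFDerivAt_latPt (x : ℝ × ℝ) :
    HasFDerivAt latPt (latEquiv : ℝ × ℝ →L[ℝ] ℂ) x := latEquiv.hasFDerivAt

lemma measurableEmbedding_latPt : MeasurableEmbedding latPt :=
  latEquiv.toHomeomorph.measurableEmbedding

lemma exists_map_latPt : ∃ c : NNReal, 0 < c ∧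
    Measure.map latPt volume = c • (volume : Measure ℂ) := by
  have : (Measure.map latPt (volume : Measure (ℝ × ℝ))).IsAddHaarMeasure :=
    latEquiv.isAddHaarMeasure_map volume
  exact ⟨_, Measure.addHaarScalarFactor_pos_of_isAddHaarMeasure _ _,
    Measure.isAddLeftInvariant_eq_smul _ _⟩

lemma ae_latPt_iff {p : ℂ → Prop} : (∀ᵐ x : ℝ × ℝ, p (latPt x)) ↔ ∀ᵐ z, p z := by
  obtain ⟨c, hc, h⟩ := exists_map_latPt
  have h1 : (∀ᵐ z ∂(Measure.map latPt volume), p z) ↔ ∀ᵐ x : ℝ × ℝ, p (latPt x) :=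
    measurableEmbedding_latPt.ae_map_iff
  rw [← h1, h]
  exact Measure.ae_smul_measure_iff (by simpa using hc.ne')

lemma exists_integral_latPt : ∃ c : ℝ, c ≠ 0 ∧
    ∀ F : ℂ → ℂ, ∫ x, F (latPt x) = c * ∫ z, F z := by
  obtain ⟨c, hc, h⟩ := exists_map_latPt
  refine ⟨c, by exact_mod_cast hc.ne', fun F => ?_⟩
  rw [← measurableEmbedding_latPt.integral_map, h, integral_smul_nnreal_measure, NNReal.smul_def,
    Complex.real_smul]

lemma memLp_comp_latPt {f : ℂ → ℂ} (hf : MemL2loc f) {s : Set (ℝ × ℝ)}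
    (hs : Bornology.IsBounded s) : MemLp (f ∘ latPt) 2 (volume.restrict s) := by
  obtain ⟨c, -, h⟩ := exists_map_latPt
  have hK : IsCompact (latPt '' closure s) :=
    (Metric.isCompact_of_isClosed_isBounded isClosed_closure hs.closure).image continuous_latPt
  have h1 := (hf _ hK).smul_measure (c := (c : ENNReal)) (by simp)
  have h2 : MeasurePreserving latPt volume (c • (volume : Measure ℂ)) :=
    ⟨continuous_latPt.measurable, h⟩
  have h3 := h2.restrict_preimage hK.measurableSet
  have h4 : MemLp (f ∘ latPt) 2 (volume.restrict (latPt ⁻¹' (latPt '' closure s))) := by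
    refine MemLp.comp_measurePreserving ?_ h3
    rw [Measure.restrict_smul]
    exact h1
  refine h4.mono_measure (Measure.restrict_mono ?_ le_rfl)
  exact fun x hx => ⟨x, subset_closure hx, rfl⟩

lemma isBounded_unitSquare : Bornology.IsBounded unitSquare :=
  (Metric.isBounded_Ioc 0 1).prod (Metric.isBounded_Ioc 0 1)

lemma volume_unitSquare_lt_top : volume unitSquare < ⊤ := isBounded_unitSquare.measure_lt_top

instance : IsFiniteMeasure (volume.restrict unitSquare) :=
  ⟨by simpa using volume_unitSquare_lt_top⟩

lemma memL2loc_of_continuous {F : Type*} [NormedAddCommGroup F] {f : ℂ → F}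
    (hf : Continuous f) : MemL2loc f := by
  intro s hs
  have : IsFiniteMeasure (volume.restrict s) := ⟨by simpa using hs.measure_lt_top⟩
  obtain ⟨C, hC⟩ := hs.exists_bound_of_continuousOn hf.continuousOn
  exact MemLp.of_bound hf.aestronglyMeasurable C (ae_restrict_of_forall_mem hs.measurableSet hC)

end LatticeCoordinates

section FloquetFourier

/-- Quasi-periodicity `f(z + γ) = e^{i⟨p, γ⟩} f(z)` for almost every `z`, the condition available
for members of `L²_loc`. -/
def AEFloquet (p : ℂ) (f : ℂ → ℂ) : Prop :=
  ∀ γ ∈ lattice, ∀ᵐ z, f (z + γ) = wave p γ * f z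

/-- Quasi-periodicity `f(z + γ) = e^{i⟨p, γ⟩} f(z)` at every point. -/
def IsFloquet (p : ℂ) (f : ℂ → ℂ) : Prop :=
  ∀ γ ∈ lattice, ∀ z, f (z + γ) = wave p γ * f z

lemma IsFloquet.ae {p : ℂ} {f : ℂ → ℂ} (h : IsFloquet p f) : AEFloquet p f :=
  fun γ hγ => Eventually.of_forall (h γ hγ)

lemma isFloquet_wave (p : ℂ) : IsFloquet p (wave p) := fun γ _ z => by
  rw [wave_add_right, mul_comm]

lemma IsFloquet.mul {p q : ℂ} {f g : ℂ → ℂ} (hf : IsFloquet p f) (hg : IsFloquet q g) :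
    IsFloquet (p + q) (fun z => f z * g z) := fun γ hγ z => by
  simp only [hf γ hγ, hg γ hγ, wave_add_left]; ring

lemma IsFloquet.add {p : ℂ} {f g : ℂ → ℂ} (hf : IsFloquet p f) (hg : IsFloquet p g) :
    IsFloquet p (fun z => f z + g z) := fun γ hγ z => by
  simp only [hf γ hγ, hg γ hγ]; ring

lemma IsFloquet.const_mul {p : ℂ} {f : ℂ → ℂ} (c : ℂ) (hf : IsFloquet p f) :
    IsFloquet p (fun z => c * f z) := fun γ hγ z => by
  simp only [hf γ hγ]; ring

lemma IsFloquet.shift {p q : ℂ} {f : ℂ → ℂ} (hf : IsFloquet p f) (h : q - p ∈ dualLattice) :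
    IsFloquet q f := by
  rw [dualLattice_eq_range] at h
  obtain ⟨n, hn⟩ := h
  intro γ hγ z
  have : q = freq n + p := by rw [hn]; ring
  rw [hf γ hγ, this, wave_add_left, wave_freq_lattice n hγ, one_mul]

/-- The Fourier coefficient of `f` at the frequency `p`, over the fundamental cell. It is meaningful
when `f` is quasi-periodic with quasi-momentum in `p + Λ*`. -/
def floquetCoeff (p : ℂ) (f : ℂ → ℂ) : ℂ := ∫ x in unitSquare, wave (-p) (latPt x) * f (latPt x)

lemma floquetCoeff_eq_sqCoeff (p : ℂ) (n : ℤ × ℤ) (f : ℂ → ℂ) :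
    floquetCoeff (freq n + p) f =
      ∫ x in unitSquare, sqExp (-n) x * (wave (-p) (latPt x) * f (latPt x)) := by
  unfold floquetCoeff
  congr 1; ext x
  rw [neg_add, wave_add_left, ← freq_neg, wave_freq_latPt, mul_assoc]
  rfl

lemma memLp_wave_mul {f : ℂ → ℂ} (hf : MemL2loc f) (p : ℂ) :
    MemLp (fun x => wave p (latPt x) * f (latPt x)) 2 (volume.restrict unitSquare) := by
  have h := memLp_comp_latPt hf isBounded_unitSquare
  refine h.of_le (((continuous_wave p).comp continuous_latPt).aestronglyMeasurable.mul h.1) ?_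
  exact Eventually.of_forall fun x => by simp [norm_wave]

lemma integrable_wave_mul {f : ℂ → ℂ} (hf : MemL2loc f) (p : ℂ) :
    Integrable (fun x => wave p (latPt x) * f (latPt x)) (volume.restrict unitSquare) :=
  (memLp_wave_mul hf p).integrable (by norm_num)

lemma summable_sq_floquetCoeff {f : ℂ → ℂ} (hf : MemL2loc f) (p : ℂ) :
    Summable fun n => ‖floquetCoeff (freq n + p) f‖ ^ 2 := by
  simp only [floquetCoeff_eq_sqCoeff]
  exact summable_sq_sqCoeff (memLp_wave_mul hf (-p))

lemma floquetCoeff_congr_ae {f g : ℂ → ℂ} (h : f =ᵐ[volume] g) (p : ℂ) :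
    floquetCoeff p f = floquetCoeff p g := by
  unfold floquetCoeff
  refine integral_congr_ae (ae_restrict_of_ae ?_)
  filter_upwards [ae_latPt_iff.2 h] with x hx
  rw [hx]

lemma floquetCoeff_add {f g : ℂ → ℂ} (hf : MemL2loc f) (hg : MemL2loc g) (p : ℂ) :
    floquetCoeff p (fun z => f z + g z) = floquetCoeff p f + floquetCoeff p g := by
  unfold floquetCoeff
  rw [← integral_add (integrable_wave_mul hf _) (integrable_wave_mul hg _)]
  simp only [mul_add]

lemma floquetCoeff_const_mul (c : ℂ) (f : ℂ → ℂ) (p : ℂ) :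
    floquetCoeff p (fun z => c * f z) = c * floquetCoeff p f := by
  unfold floquetCoeff
  rw [← integral_const_mul]
  congr 1; ext x; ring

lemma floquetCoeff_wave (m n : ℤ × ℤ) (p : ℂ) :
    floquetCoeff (freq n + p) (wave (freq m + p)) = if m = n then 1 else 0 := by
  rw [floquetCoeff_eq_sqCoeff]
  have h : ∀ x, sqExp (-n) x * (wave (-p) (latPt x) * wave (freq m + p) (latPt x)) =
      sqExp (m - n) x := by
    intro x
    rw [wave_add_left, mul_left_comm (wave (-p) _), wave_neg_mul_wave, mul_one, wave_freq_latPt,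
      sqExp, sqExp, ← Complex.exp_add]
    congr 1
    simp only [Prod.fst_neg, Prod.snd_neg, Prod.fst_sub, Prod.snd_sub]
    push_cast
    ring
  simp only [h, integral_sqExp, sub_eq_zero]

lemma floquetCoeff_series_mul {b : ℤ × ℤ → ℂ} (hb : Summable fun m => ‖b m‖) (r : ℤ × ℤ → ℂ)
    {f : ℂ → ℂ} (hf : MemL2loc f) (q : ℂ) :
    floquetCoeff q (fun z => (∑' m, b m * wave (r m) z) * f z) =
      ∑' m, b m * floquetCoeff (q - r m) f := by
  have hterm : ∀ m x, wave (-q) (latPt x) * (b m * wave (r m) (latPt x) * f (latPt x)) =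
      b m * (wave (-(q - r m)) (latPt x) * f (latPt x)) := by
    intro m x
    rw [show -(q - r m) = -q + r m by ring, wave_add_left]; ring
  have h := hasSum_integral_of_summable_integral_norm (μ := volume.restrict unitSquare)
    (F := fun m x => wave (-q) (latPt x) * (b m * wave (r m) (latPt x) * f (latPt x)))
    (fun m => by
      simp only [hterm]
      exact (integrable_wave_mul hf _).const_mul _) (by
      simp only [norm_mul, norm_wave, one_mul, mul_one, integral_const_mul]
      exact hb.mul_right _)
  refine Eq.trans ?_ (h.tsum_eq.symm.trans ?_)
  · unfold floquetCoeff
    congr 1; ext x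
    rw [tsum_mul_left, tsum_mul_right]
  · refine tsum_congr fun m => ?_
    simp only [hterm, integral_const_mul, floquetCoeff]

lemma AEFloquet.eq_zero_of_unitSquare {p : ℂ} {f : ℂ → ℂ} (hf : AEFloquet p f)
    (h : ∀ᵐ x ∂(volume.restrict unitSquare), f (latPt x) = 0) : f =ᵐ[volume] 0 := by
  rw [ae_restrict_iff' measurableSet_unitSquare] at h
  have h1 : ∀ᵐ x : ℝ × ℝ, ∀ m : ℤ × ℤ, (x + ((m.1 : ℝ), (m.2 : ℝ)) ∈ unitSquare →
      f (latPt (x + ((m.1 : ℝ), (m.2 : ℝ)))) = 0) := by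
    rw [ae_all_iff]
    intro m
    exact (measurePreserving_add_right (volume : Measure (ℝ × ℝ))
      ((m.1 : ℝ), (m.2 : ℝ))).quasiMeasurePreserving.ae h
  have h2 : ∀ᵐ x : ℝ × ℝ, ∀ m : ℤ × ℤ, f (latPt x + latPt ((m.1 : ℝ), (m.2 : ℝ))) =
      wave p (latPt ((m.1 : ℝ), (m.2 : ℝ))) * f (latPt x) := by
    rw [ae_all_iff]
    intro m
    exact ae_latPt_iff.2 (hf _ (latPt_int_mem m.1 m.2))
  refine ae_latPt_iff.1 ?_
  filter_upwards [h1, h2] with x hx1 hx2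
  have hfract : ∀ s : ℝ, s + ((1 - ⌈s⌉ : ℤ) : ℝ) ∈ Set.Ioc (0 : ℝ) 1 := by
    intro s
    have := Int.ceil_lt_add_one s
    have := Int.le_ceil s
    constructor <;> push_cast <;> linarith
  have h3 := hx1 (1 - ⌈x.1⌉, 1 - ⌈x.2⌉) ⟨hfract _, hfract _⟩
  rw [latPt_add, hx2] at h3
  exact (mul_eq_zero.1 h3).resolve_left (wave_ne_zero _ _)

lemma AEFloquet.eq_zero_of_floquetCoeff {p : ℂ} {f : ℂ → ℂ} (hf : AEFloquet p f) (hL : MemL2loc f)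
    (h : ∀ n, floquetCoeff (freq n + p) f = 0) : f =ᵐ[volume] 0 := by
  refine hf.eq_zero_of_unitSquare ?_
  have h1 := ae_eq_zero_of_sqCoeff_eq_zero (memLp_wave_mul hL (-p)) (fun n => by
    rw [← floquetCoeff_eq_sqCoeff, h])
  filter_upwards [h1] with x hx
  exact (mul_eq_zero.1 hx).resolve_left (wave_ne_zero _ _)

/-- The constant coefficient first order operator `a ∂_x + b ∂_y`. -/
def diffOp (a b : ℂ) (g : ℂ → ℂ) (z : ℂ) : ℂ := a * fderiv ℝ g z 1 + b * fderiv ℝ g z Complex.I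

/-- The symbol of `a ∂_x + b ∂_y`: its eigenvalue on the plane wave `wave p`. -/
def diffSymbol (a b p : ℂ) : ℂ := Complex.I * (a * p.re + b * p.im)

lemma diffOp_wave (a b p z : ℂ) : diffOp a b (wave p) z = diffSymbol a b p * wave p z := by
  rw [diffOp, (hasFDerivAt_wave p z).fderiv, diffSymbol]
  simp [waveForm_apply, pair_eq]
  ring

lemma diffOp_mul (a b : ℂ) {f g : ℂ → ℂ} {z : ℂ} (hf : DifferentiableAt ℝ f z)
    (hg : DifferentiableAt ℝ g z) :
    diffOp a b (fun w => f w * g w) z = diffOp a b f z * g z + f z * diffOp a b g z := by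
  have h : HasFDerivAt (fun w => f w * g w) _ z := hf.hasFDerivAt.mul hg.hasFDerivAt
  rw [diffOp, diffOp, diffOp, h.fderiv]
  simp
  ring

lemma diffSymbol_neg (a b p : ℂ) : diffSymbol a b (-p) = -diffSymbol a b p := by
  simp only [diffSymbol, Complex.neg_re, Complex.neg_im]
  push_cast
  ring

lemma diffOp_eq_latPt_basis (a b : ℂ) (f : ℂ → ℂ) (z : ℂ) :
    diffOp a b f z = (a + b / Real.sqrt 3) * fderiv ℝ f z (latPt (1, 0)) +
      (2 * b / Real.sqrt 3) * fderiv ℝ f z (latPt (0, 1)) := by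
  have h3 : (Real.sqrt 3 : ℂ) ≠ 0 := by exact_mod_cast sqrt3_pos.ne'
  have e1 : latPt (1, 0) = 1 := by simp [latPt]
  have e2 : latPt (0, 1) = (-1 / 2 : ℝ) • (1 : ℂ) + (Real.sqrt 3 / 2 : ℝ) • Complex.I := by
    simp [latPt, omega_eq]
  rw [diffOp, e1, e2, map_add, map_smul, map_smul, Complex.real_smul, Complex.real_smul]
  push_cast
  field_simp
  ring

lemma unitSquare_ae_eq_Icc : unitSquare =ᵐ[volume] Set.Icc ((0 : ℝ), (0 : ℝ)) (1, 1) := by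
  rw [← Set.Icc_prod_Icc]
  exact Measure.set_prod_ae_eq Ioc_ae_eq_Icc Ioc_ae_eq_Icc

lemma integral_unitSquare_diffOp_eq_zero {a b : ℂ} {H Q : ℂ → ℂ} (hH : Continuous H)
    (hQ : Continuous Q) {s : Set ℂ} (hs : s.Countable) (hd : ∀ z ∉ s, DifferentiableAt ℝ H z)
    (hHQ : ∀ z ∉ s, Q z = diffOp a b H z) (hper : ∀ γ ∈ lattice, ∀ z, H (z + γ) = H z) :
    ∫ x in unitSquare, Q (latPt x) = 0 := by
  set A : ℂ := a + b / Real.sqrt 3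
  set B : ℂ := 2 * b / Real.sqrt 3
  set S : Set (ℝ × ℝ) := latPt ⁻¹' s
  have hS : S.Countable := hs.preimage latEquiv.injective
  set H' : ℝ × ℝ → ℝ × ℝ →L[ℝ] ℂ := fun x =>
    (fderiv ℝ H (latPt x)).comp (latEquiv : ℝ × ℝ →L[ℝ] ℂ)
  have hderiv : ∀ (c : ℂ) (x), x ∉ S → HasFDerivAt (fun y => c * H (latPt y)) (c • H' x) x :=
    fun c x hx => ((hd _ hx).hasFDerivAt.comp x (hasFDerivAt_latPt x)).const_mul c
  have hcont : ∀ c : ℂ, ContinuousOn (fun y => c * H (latPt y)) (Set.Icc (0, 0) (1, 1)) :=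
    fun c => (continuous_const.mul (hH.comp continuous_latPt)).continuousOn
  have hae : (fun x => (A • H' x) (1, 0) + (B • H' x) (0, 1)) =ᵐ[volume]
      fun x => Q (latPt x) := by
    filter_upwards [hS.ae_notMem volume] with x hx
    rw [hHQ _ hx, diffOp_eq_latPt_basis]
    rfl
  have hint : IntegrableOn (fun x => Q (latPt x)) (Set.Icc (0, 0) (1, 1)) :=
    (hQ.comp continuous_latPt).continuousOn.integrableOn_compact isCompact_Icc
  have hdiv := integral_divergence_prod_Icc_of_hasFDerivAt_off_countable_of_le
    (fun y => A * H (latPt y)) (fun y => B * H (latPt y)) _ _ (0, 0) (1, 1)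
    (by simp [Prod.le_def]) S hS (hcont A) (hcont B) (fun x hx => hderiv A x hx.2)
    (fun x hx => hderiv B x hx.2) (hint.congr (ae_restrict_of_ae hae.symm))
  have htop : ∀ x : ℝ, H (latPt (x, 1)) = H (latPt (x, 0)) := fun x => by
    rw [show latPt (x, 1) = latPt (x, 0) + ω₃ by simp [latPt], hper ω₃ omega_mem_lattice]
  have hright : ∀ y : ℝ, H (latPt (1, y)) = H (latPt (0, y)) := fun y => by
    rw [show latPt (1, y) = latPt (0, y) + 1 by simp [latPt]; ring, hper 1 one_mem_lattice]
  rw [setIntegral_congr_set unitSquare_ae_eq_Icc, ← integral_congr_ae (ae_restrict_of_ae hae), hdiv]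
  simp only [htop, hright, sub_self, zero_add]

lemma floquetCoeff_diffOp {a b p q : ℂ} {g G : ℂ → ℂ} (hg : Continuous g) (hG : Continuous G)
    {s : Set ℂ} (hs : s.Countable) (hd : ∀ z ∉ s, DifferentiableAt ℝ g z)
    (hgG : ∀ z ∉ s, G z = diffOp a b g z) (hF : IsFloquet p g) (hq : q - p ∈ dualLattice) :
    floquetCoeff q G = diffSymbol a b q * floquetCoeff q g := by
  have hwave : ∀ z, DifferentiableAt ℝ (wave (-q)) z := fun z =>
    (hasFDerivAt_wave _ z).differentiableAt
  have hdiff : ∀ z ∉ s, wave (-q) z * (G z - diffSymbol a b q * g z) =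
      diffOp a b (fun w => wave (-q) w * g w) z := fun z hz => by
    rw [diffOp_mul a b (hwave z) (hd z hz), diffOp_wave, diffSymbol_neg, ← hgG z hz]
    ring
  have hper : ∀ γ ∈ lattice, ∀ z, wave (-q) (z + γ) * g (z + γ) = wave (-q) z * g z :=
    fun γ hγ z => by
      simpa only [neg_add_cancel, wave_zero_left, one_mul] using
        ((isFloquet_wave (-q)).mul (hF.shift hq)) γ hγ z
  have hzero := integral_unitSquare_diffOp_eq_zero ((continuous_wave _).mul hg)
    ((continuous_wave _).mul (hG.sub (continuous_const.mul hg))) hs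
    (fun z hz => (hwave z).mul (hd z hz)) hdiff hper
  have hsplit : ∫ x in unitSquare, wave (-q) (latPt x) * (G (latPt x) -
      diffSymbol a b q * g (latPt x)) = floquetCoeff q G - diffSymbol a b q * floquetCoeff q g := by
    unfold floquetCoeff
    rw [← integral_const_mul, ← integral_sub (integrable_wave_mul (memL2loc_of_continuous hG) _)
      ((integrable_wave_mul (memL2loc_of_continuous hg) _).const_mul _)]
    congr 1; ext x; ring
  exact sub_eq_zero.1 (hsplit.symm.trans hzero)

end FloquetFourier

section PartitionOfUnity

/-- A smooth step from `0` to `1`, constant outside `[1/4, 3/4]`. -/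
def stepFn (s : ℝ) : ℝ := Real.smoothTransition (2 * s - 1 / 2)

lemma stepFn_of_le {s : ℝ} (h : s ≤ 1 / 4) : stepFn s = 0 :=
  Real.smoothTransition.zero_of_nonpos (by linarith)

lemma stepFn_of_ge {s : ℝ} (h : 3 / 4 ≤ s) : stepFn s = 1 :=
  Real.smoothTransition.one_of_one_le (by linarith)

lemma contDiff_stepFn : ContDiff ℝ ∞ stepFn :=
  Real.smoothTransition.contDiff.comp (by fun_prop)

/-- A smooth bump whose integer translates form a partition of unity. -/
def bumpFn (s : ℝ) : ℝ := stepFn s - stepFn (s - 1)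

lemma contDiff_bumpFn : ContDiff ℝ ∞ bumpFn :=
  contDiff_stepFn.sub (contDiff_stepFn.comp (by fun_prop))

lemma bumpFn_eq_zero {s : ℝ} (h : s ∉ Set.Icc (1 / 4 : ℝ) (7 / 4)) : bumpFn s = 0 := by
  rw [Set.mem_Icc, not_and_or, not_le, not_le] at h
  rcases h with h | h
  · rw [bumpFn, stepFn_of_le h.le, stepFn_of_le (by linarith), sub_zero]
  · rw [bumpFn, stepFn_of_ge (by linarith), stepFn_of_ge (by linarith), sub_self]

lemma bumpFn_add_bumpFn {s : ℝ} (h1 : -1 / 4 ≤ s) (h2 : s ≤ 5 / 4) :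
    bumpFn s + bumpFn (s + 1) = 1 := by
  rw [bumpFn, bumpFn, stepFn_of_ge (s := s + 1) (by linarith),
    stepFn_of_le (s := s - 1) (by linarith), show s + 1 - 1 = s by ring]
  ring

lemma differentiable_bumpFn : Differentiable ℝ bumpFn :=
  contDiff_bumpFn.differentiable (by simp)

lemma continuous_deriv_bumpFn : Continuous (deriv bumpFn) :=
  contDiff_bumpFn.continuous_deriv (by simp)

lemma deriv_bumpFn_eq_zero {s : ℝ} (h : s ∉ Set.Icc (1 / 4 : ℝ) (7 / 4)) :
    deriv bumpFn s = 0 := by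
  have : bumpFn =ᶠ[𝓝 s] fun _ => 0 := by
    filter_upwards [isClosed_Icc.isOpen_compl.mem_nhds h] with t ht
    exact bumpFn_eq_zero ht
  rw [this.deriv_eq, deriv_const]

lemma deriv_bumpFn_add {s : ℝ} (h1 : 0 ≤ s) (h2 : s ≤ 1) :
    deriv bumpFn s + deriv bumpFn (s + 1) = 0 := by
  have h : (fun t => bumpFn t + bumpFn (t + 1)) =ᶠ[𝓝 s] fun _ => 1 := by
    filter_upwards [Icc_mem_nhds (a := -1 / 4) (b := 5 / 4) (x := s) (by linarith) (by linarith)]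
      with t ht
    exact bumpFn_add_bumpFn ht.1 ht.2
  have hconst := h.deriv_eq
  have hsum : HasDerivAt (fun t => bumpFn t + bumpFn (t + 1))
      (deriv bumpFn s + deriv bumpFn (s + 1)) s :=
    (differentiable_bumpFn s).hasDerivAt.add
      ((differentiable_bumpFn (s + 1)).hasDerivAt.comp_add_const s 1)
  rwa [deriv_const, hsum.deriv] at hconst

lemma integral_add_three {α : Type*} [MeasurableSpace α] {μ : Measure α} {f g h : α → ℂ}
    (hf : Integrable f μ) (hg : Integrable g μ) (hh : Integrable h μ) :
    ∫ x, (f x + g x + h x) ∂μ = ∫ x, f x ∂μ + ∫ x, g x ∂μ + ∫ x, h x ∂μ := by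
  rw [integral_add (f := fun x => f x + g x) (hf.add hg) hh, integral_add hf hg]

lemma setIntegral_translate_unitSquare (F : ℝ × ℝ → ℂ) (a b : ℝ) :
    ∫ x in Set.Ioc a (a + 1) ×ˢ Set.Ioc b (b + 1), F x = ∫ x in unitSquare, F (x + (a, b)) := by
  have h := (measurePreserving_add_right (volume : Measure (ℝ × ℝ)) (a, b)).setIntegral_preimage_emb
    (measurableEmbedding_addRight _) F (Set.Ioc a (a + 1) ×ˢ Set.Ioc b (b + 1))
  rw [← h]
  congr 2
  ext x
  simp only [unitSquare, Set.mem_preimage, Set.mem_prod, Set.mem_Ioc, Prod.fst_add, Prod.snd_add]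
  constructor
  · rintro ⟨⟨_, _⟩, _, _⟩; refine ⟨⟨?_, ?_⟩, ?_, ?_⟩ <;> linarith
  · rintro ⟨⟨_, _⟩, _, _⟩; refine ⟨⟨?_, ?_⟩, ?_, ?_⟩ <;> linarith

lemma integral_unfold {F : ℝ × ℝ → ℂ} (hF : Integrable F)
    (h0 : ∀ x, x ∉ Set.Ioc (0 : ℝ) 2 ×ˢ Set.Ioc (0 : ℝ) 2 → F x = 0) :
    ∫ x, F x = ∫ x in unitSquare,
      (F (x + (0, 0)) + F (x + (0, 1)) + F (x + (1, 0)) + F (x + (1, 1))) := by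
  have hI : ∀ v : ℝ × ℝ, Integrable (fun x => F (x + v)) (volume.restrict unitSquare) := fun v =>
    (hF.comp_add_right v).integrableOn
  rw [integral_add (f := fun x => F (x + (0, 0)) + F (x + (0, 1)) + F (x + (1, 0)))
    (((hI _).add (hI _)).add (hI _)) (hI _), integral_add_three (hI _) (hI _) (hI _)]
  have hu : Set.Ioc (0 : ℝ) 2 = Set.Ioc (0 : ℝ) (0 + 1) ∪ Set.Ioc 1 (1 + 1) := by
    rw [zero_add, Set.Ioc_union_Ioc_eq_Ioc] <;> norm_num
  have hd : Disjoint (Set.Ioc (0 : ℝ) (0 + 1)) (Set.Ioc 1 (1 + 1)) := by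
    rw [zero_add]; exact Set.Ioc_disjoint_Ioc_of_le le_rfl
  have m : ∀ a b : ℝ, MeasurableSet (Set.Ioc a (a + 1) ×ˢ Set.Ioc b (b + 1)) := fun a b =>
    measurableSet_Ioc.prod measurableSet_Ioc
  rw [← setIntegral_eq_integral_of_forall_compl_eq_zero h0, hu, Set.union_prod,
    setIntegral_union (Set.disjoint_prod.2 (Or.inl hd))
      (measurableSet_Ioc.prod (measurableSet_Ioc.union measurableSet_Ioc))
      hF.integrableOn hF.integrableOn, Set.prod_union, Set.prod_union,
    setIntegral_union (Set.disjoint_prod.2 (Or.inr hd)) (m _ _) hF.integrableOn hF.integrableOn,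
    setIntegral_union (Set.disjoint_prod.2 (Or.inr hd)) (m _ _) hF.integrableOn hF.integrableOn]
  simp only [setIntegral_translate_unitSquare]
  ring

section BumpMul

variable {η₁ η₂ : ℝ → ℝ} {u : ℂ → ℂ}

lemma integrable_bump_mul (h₁ : Continuous η₁) (h₂ : Continuous η₂)
    (hη₁ : ∀ s ∉ Set.Icc (1 / 4 : ℝ) (7 / 4), η₁ s = 0)
    (hη₂ : ∀ s ∉ Set.Icc (1 / 4 : ℝ) (7 / 4), η₂ s = 0) (hu : MemL2loc u) :
    Integrable fun x : ℝ × ℝ => (η₁ x.1 * η₂ x.2 : ℂ) * u (latPt x) := by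
  set s := Set.Icc (1 / 4 : ℝ) (7 / 4) ×ˢ Set.Icc (1 / 4 : ℝ) (7 / 4)
  have hs : IsCompact s := isCompact_Icc.prod isCompact_Icc
  have : IsFiniteMeasure (volume.restrict s) := ⟨by simpa using hs.measure_lt_top⟩
  have hui : Integrable (u ∘ latPt) (volume.restrict s) :=
    (memLp_comp_latPt hu hs.isBounded).integrable (by norm_num)
  have hη : Continuous fun x : ℝ × ℝ => (η₁ x.1 * η₂ x.2 : ℂ) := by fun_prop
  obtain ⟨C, hC⟩ := hs.exists_bound_of_continuousOn hη.continuousOn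
  refine (integrableOn_iff_integrable_of_support_subset fun x hx => ?_).1
    (hui.bdd_mul hη.aestronglyMeasurable (ae_restrict_of_forall_mem hs.measurableSet hC))
  by_contra h
  rcases not_and_or.1 (Set.mem_prod.not.1 h) with h | h
  · exact hx (by simp [hη₁ _ h])
  · exact hx (by simp [hη₂ _ h])

lemma integral_bump_mul (h₁ : Continuous η₁) (h₂ : Continuous η₂)
    (hη₁ : ∀ s ∉ Set.Icc (1 / 4 : ℝ) (7 / 4), η₁ s = 0)
    (hη₂ : ∀ s ∉ Set.Icc (1 / 4 : ℝ) (7 / 4), η₂ s = 0) (hu : MemL2loc u)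
    (hper : AEFloquet 0 u) :
    ∫ x : ℝ × ℝ, (η₁ x.1 * η₂ x.2 : ℂ) * u (latPt x) =
      ∫ x in unitSquare, ((η₁ x.1 + η₁ (x.1 + 1)) * (η₂ x.2 + η₂ (x.2 + 1)) : ℂ) *
        u (latPt x) := by
  have hsub : Set.Icc (1 / 4 : ℝ) (7 / 4) ⊆ Set.Ioc 0 2 := fun s hs =>
    ⟨by linarith [hs.1], by linarith [hs.2]⟩
  rw [integral_unfold (integrable_bump_mul h₁ h₂ hη₁ hη₂ hu) fun x hx => ?_]
  · refine integral_congr_ae (ae_restrict_of_ae ?_)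
    have htrans : ∀ m n : ℤ, ∀ᵐ x : ℝ × ℝ, u (latPt (x + ((m : ℝ), (n : ℝ)))) = u (latPt x) :=
      fun m n => by
        filter_upwards [ae_latPt_iff.2 (hper _ (latPt_int_mem m n))] with x hx
        rw [latPt_add, hx, wave_zero_left, one_mul]
    have h01 := htrans 0 1
    have h10 := htrans 1 0
    have h11 := htrans 1 1
    simp only [Int.cast_zero, Int.cast_one] at h01 h10 h11
    filter_upwards [h01, h10, h11] with x e01 e10 e11
    simp only [e01, e10, e11, Prod.mk_zero_zero, add_zero, Prod.fst_add, Prod.snd_add]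
    ring
  · rcases not_and_or.1 (Set.mem_prod.not.1 hx) with h | h
    · simp [hη₁ _ fun h' => h (hsub h')]
    · simp [hη₂ _ fun h' => h (hsub h')]

end BumpMul

/-- The first lattice coordinate `s` of `s + t ω`. -/
def coordS : ℂ →L[ℝ] ℝ := (ContinuousLinearMap.fst ℝ ℝ ℝ).comp (latEquiv.symm : ℂ →L[ℝ] ℝ × ℝ)

/-- The second lattice coordinate `t` of `s + t ω`. -/
def coordT : ℂ →L[ℝ] ℝ := (ContinuousLinearMap.snd ℝ ℝ ℝ).comp (latEquiv.symm : ℂ →L[ℝ] ℝ × ℝ)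

lemma coordS_latPt (x : ℝ × ℝ) : coordS (latPt x) = x.1 :=
  congrArg Prod.fst (latEquiv.symm_apply_apply x)

lemma coordT_latPt (x : ℝ × ℝ) : coordT (latPt x) = x.2 :=
  congrArg Prod.snd (latEquiv.symm_apply_apply x)

lemma latPt_coord (z : ℂ) : latPt (coordS z, coordT z) = z := latEquiv.apply_symm_apply z

/-- A smooth compactly supported cutoff whose lattice translates form a partition of unity. -/
def cutoff (z : ℂ) : ℂ := ((bumpFn (coordS z) * bumpFn (coordT z) : ℝ) : ℂ)

lemma contDiff_cutoff : ContDiff ℝ ∞ cutoff :=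
  Complex.ofRealCLM.contDiff.comp
    ((contDiff_bumpFn.comp coordS.contDiff).mul (contDiff_bumpFn.comp coordT.contDiff))

lemma hasCompactSupport_cutoff : HasCompactSupport cutoff := by
  refine HasCompactSupport.intro (K := latPt '' (Set.Icc (1 / 4 : ℝ) (7 / 4) ×ˢ
    Set.Icc (1 / 4 : ℝ) (7 / 4)))
    ((isCompact_Icc.prod isCompact_Icc).image continuous_latPt) fun z hz => ?_
  have h : ¬ (coordS z ∈ Set.Icc (1 / 4 : ℝ) (7 / 4) ∧ coordT z ∈ Set.Icc (1 / 4 : ℝ) (7 / 4)) :=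
    fun h => hz ⟨(coordS z, coordT z), h, latPt_coord z⟩
  rw [not_and_or] at h
  rcases h with h | h
  · simp [cutoff, bumpFn_eq_zero h]
  · simp [cutoff, bumpFn_eq_zero h]

lemma diffOp_cutoff_latPt (a b : ℂ) (x : ℝ × ℝ) :
    diffOp a b cutoff (latPt x) =
      (a * coordS 1 + b * coordS Complex.I) * (deriv bumpFn x.1 * bumpFn x.2) +
      (a * coordT 1 + b * coordT Complex.I) * (bumpFn x.1 * deriv bumpFn x.2) := by
  have hS : HasFDerivAt (fun z => bumpFn (coordS z)) (deriv bumpFn x.1 • coordS) (latPt x) := by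
    have := (differentiable_bumpFn (coordS (latPt x))).hasDerivAt.comp_hasFDerivAt (latPt x)
      coordS.hasFDerivAt
    rwa [coordS_latPt] at this
  have hT : HasFDerivAt (fun z => bumpFn (coordT z)) (deriv bumpFn x.2 • coordT) (latPt x) := by
    have := (differentiable_bumpFn (coordT (latPt x))).hasDerivAt.comp_hasFDerivAt (latPt x)
      coordT.hasFDerivAt
    rwa [coordT_latPt] at this
  have h := Complex.ofRealCLM.hasFDerivAt.comp (latPt x) (hS.mul hT)
  have h2 : HasFDerivAt cutoff _ (latPt x) := h
  rw [diffOp, h2.fderiv]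
  simp only [ContinuousLinearMap.comp_apply, add_apply, smul_apply, coordS_latPt, coordT_latPt,
    smul_eq_mul, Complex.ofRealCLM_apply]
  push_cast
  ring

lemma diffOp_cutoff_latPt_mul (a b w : ℂ) (x : ℝ × ℝ) :
    diffOp a b cutoff (latPt x) * w =
      (a * coordS 1 + b * coordS Complex.I) * ((deriv bumpFn x.1 * bumpFn x.2 : ℂ) * w) +
      (a * coordT 1 + b * coordT Complex.I) * ((bumpFn x.1 * deriv bumpFn x.2 : ℂ) * w) := by
  rw [diffOp_cutoff_latPt]
  ring

lemma cutoff_latPt (x : ℝ × ℝ) : cutoff (latPt x) = (bumpFn x.1 * bumpFn x.2 : ℂ) := by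
  rw [cutoff, coordS_latPt, coordT_latPt, Complex.ofReal_mul]

section CutoffMul

variable {u : ℂ → ℂ}

lemma integrable_cutoff_mul (hu : MemL2loc u) :
    Integrable fun x : ℝ × ℝ => cutoff (latPt x) * u (latPt x) := by
  simp only [cutoff_latPt]
  exact integrable_bump_mul contDiff_bumpFn.continuous contDiff_bumpFn.continuous
    (fun _ => bumpFn_eq_zero) (fun _ => bumpFn_eq_zero) hu

lemma integral_cutoff_mul (hu : MemL2loc u) (hper : AEFloquet 0 u) :
    ∫ x : ℝ × ℝ, cutoff (latPt x) * u (latPt x) = ∫ x in unitSquare, u (latPt x) := by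
  simp only [cutoff_latPt]
  rw [integral_bump_mul contDiff_bumpFn.continuous contDiff_bumpFn.continuous
    (fun _ => bumpFn_eq_zero) (fun _ => bumpFn_eq_zero) hu hper]
  refine setIntegral_congr_fun measurableSet_unitSquare fun x hx => ?_
  have e₁ : (bumpFn x.1 + bumpFn (x.1 + 1) : ℂ) = 1 := by
    exact_mod_cast bumpFn_add_bumpFn (s := x.1) (by linarith [hx.1.1]) (by linarith [hx.1.2])
  have e₂ : (bumpFn x.2 + bumpFn (x.2 + 1) : ℂ) = 1 := by
    exact_mod_cast bumpFn_add_bumpFn (s := x.2) (by linarith [hx.2.1]) (by linarith [hx.2.2])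
  simp only [e₁, e₂, one_mul]

lemma integrable_diffOp_cutoff_mul (a b : ℂ) (hu : MemL2loc u) :
    Integrable fun x : ℝ × ℝ => diffOp a b cutoff (latPt x) * u (latPt x) := by
  simp only [diffOp_cutoff_latPt_mul]
  exact ((integrable_bump_mul continuous_deriv_bumpFn contDiff_bumpFn.continuous
      (fun _ => deriv_bumpFn_eq_zero) (fun _ => bumpFn_eq_zero) hu).const_mul _).add
    ((integrable_bump_mul contDiff_bumpFn.continuous continuous_deriv_bumpFn
      (fun _ => bumpFn_eq_zero) (fun _ => deriv_bumpFn_eq_zero) hu).const_mul _)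

lemma integral_diffOp_cutoff_mul (a b : ℂ) (hu : MemL2loc u) (hper : AEFloquet 0 u) :
    ∫ x : ℝ × ℝ, diffOp a b cutoff (latPt x) * u (latPt x) = 0 := by
  have hS : ∫ x : ℝ × ℝ, (deriv bumpFn x.1 * bumpFn x.2 : ℂ) * u (latPt x) = 0 := by
    rw [integral_bump_mul continuous_deriv_bumpFn contDiff_bumpFn.continuous
      (fun _ => deriv_bumpFn_eq_zero) (fun _ => bumpFn_eq_zero) hu hper]
    refine setIntegral_eq_zero_of_forall_eq_zero fun x hx => ?_
    have e : (deriv bumpFn x.1 + deriv bumpFn (x.1 + 1) : ℂ) = 0 := by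
      exact_mod_cast deriv_bumpFn_add hx.1.1.le hx.1.2
    simp only [e, zero_mul]
  have hT : ∫ x : ℝ × ℝ, (bumpFn x.1 * deriv bumpFn x.2 : ℂ) * u (latPt x) = 0 := by
    rw [integral_bump_mul contDiff_bumpFn.continuous continuous_deriv_bumpFn
      (fun _ => bumpFn_eq_zero) (fun _ => deriv_bumpFn_eq_zero) hu hper]
    refine setIntegral_eq_zero_of_forall_eq_zero fun x hx => ?_
    have e : (deriv bumpFn x.2 + deriv bumpFn (x.2 + 1) : ℂ) = 0 := by
      exact_mod_cast deriv_bumpFn_add hx.2.1.le hx.2.2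
    simp only [e, zero_mul, mul_zero]
  simp only [diffOp_cutoff_latPt_mul]
  rw [integral_add, integral_const_mul, integral_const_mul, hS, hT, mul_zero, mul_zero, add_zero]
  · exact (integrable_bump_mul continuous_deriv_bumpFn contDiff_bumpFn.continuous
      (fun _ => deriv_bumpFn_eq_zero) (fun _ => bumpFn_eq_zero) hu).const_mul _
  · exact (integrable_bump_mul contDiff_bumpFn.continuous continuous_deriv_bumpFn
      (fun _ => bumpFn_eq_zero) (fun _ => deriv_bumpFn_eq_zero) hu).const_mul _

end CutoffMul

end PartitionOfUnity

section WeakDerivatives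

lemma MemL2loc.wave_mul {f : ℂ → ℂ} (hf : MemL2loc f) (p : ℂ) :
    MemL2loc fun z => wave p z * f z := fun s hs => by
  refine (hf s hs).of_le ((continuous_wave p).aestronglyMeasurable.mul (hf s hs).1) ?_
  exact Eventually.of_forall fun z => by rw [norm_mul, norm_wave, one_mul]

lemma AEFloquet.wave_neg_mul {p q : ℂ} {f : ℂ → ℂ} (hf : AEFloquet p f)
    (hq : q - p ∈ dualLattice) : AEFloquet 0 fun z => wave (-q) z * f z := by
  rw [dualLattice_eq_range] at hq
  obtain ⟨n, hn⟩ := hq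
  intro γ hγ
  have hcancel : wave (-q) γ * wave p γ = 1 := by
    rw [← wave_add_left, show -q + p = -(q - p) by ring, ← hn, ← freq_neg, wave_freq_lattice _ hγ]
  filter_upwards [hf γ hγ] with z hz
  rw [hz, wave_add_right, wave_zero_left]
  linear_combination wave (-q) z * f z * hcancel

lemma floquetCoeff_of_weak {a b p q : ℂ} {f g : ℂ → ℂ} (hf : MemL2loc f) (hg : MemL2loc g)
    (hFf : AEFloquet p f) (hFg : AEFloquet p g)
    (hw : ∀ Φ : ℂ → ℂ, ContDiff ℝ ∞ Φ → HasCompactSupport Φ →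
      ∫ z, diffOp a b Φ z * f z = -∫ z, Φ z * g z)
    (hq : q - p ∈ dualLattice) : floquetCoeff q g = diffSymbol a b q * floquetCoeff q f := by
  obtain ⟨c, -, hc⟩ := exists_integral_latPt
  set Φ : ℂ → ℂ := fun z => cutoff z * wave (-q) z with hΦ
  have hweak := hw Φ (contDiff_cutoff.mul (contDiff_wave _)) hasCompactSupport_cutoff.mul_right
  have hright : c * ∫ z, Φ z * g z = floquetCoeff q g := by
    rw [← hc fun z => Φ z * g z]
    simp only [hΦ, mul_assoc]
    exact integral_cutoff_mul (hg.wave_mul (-q)) (hFg.wave_neg_mul hq)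
  have hprod : ∀ z, diffOp a b Φ z * f z = diffOp a b cutoff z * (wave (-q) z * f z) -
      diffSymbol a b q * (cutoff z * (wave (-q) z * f z)) := fun z => by
    rw [hΦ, diffOp_mul a b ((contDiff_cutoff.differentiable (by simp)) _)
      (hasFDerivAt_wave _ _).differentiableAt, diffOp_wave, diffSymbol_neg]
    ring
  have hleft : c * ∫ z, diffOp a b Φ z * f z = -(diffSymbol a b q * floquetCoeff q f) := by
    have hu := hf.wave_mul (-q)
    have hper := hFf.wave_neg_mul hq
    rw [← hc fun z => diffOp a b Φ z * f z]
    simp only [hprod]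
    rw [integral_sub (integrable_diffOp_cutoff_mul a b hu) ((integrable_cutoff_mul hu).const_mul _),
      integral_diffOp_cutoff_mul a b hu hper, integral_const_mul, integral_cutoff_mul hu hper,
      zero_sub, floquetCoeff]
  rw [hweak, mul_neg, hright] at hleft
  exact neg_injective hleft

end WeakDerivatives

section SmoothSeries

/-- Sequences on `ℤ²` decaying faster than every power, the Fourier side of smoothness. -/
def RapidDecay (x : ℤ × ℤ → ℂ) : Prop := ∀ s : ℕ, ∃ B, ∀ n, weight n ^ s * ‖x n‖ ≤ B

lemma RapidDecay.summable_mul {x : ℤ × ℤ → ℂ} (hx : RapidDecay x) (s : ℕ) :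
    Summable fun n => ‖x n‖ * weight n ^ s := by
  obtain ⟨B, hB⟩ := hx (s + 4)
  refine Summable.of_nonneg_of_le
    (fun n => mul_nonneg (norm_nonneg _) (pow_nonneg (weight_pos n).le s)) (fun n => ?_)
    (summable_weight_inv.mul_left B)
  have h := weight_pos n
  rw [← div_eq_mul_inv, le_div_iff₀ (by positivity)]
  calc ‖x n‖ * weight n ^ s * weight n ^ 4 = weight n ^ (s + 4) * ‖x n‖ := by ring
    _ ≤ B := hB n

lemma RapidDecay.summable {x : ℤ × ℤ → ℂ} (hx : RapidDecay x) : Summable fun n => ‖x n‖ := by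
  simpa using hx.summable_mul 0

lemma RapidDecay.mul_of_le {x d : ℤ × ℤ → ℂ} (hx : RapidDecay x) {C : ℝ} (hC : 0 ≤ C)
    (hd : ∀ n, ‖d n‖ ≤ C * weight n) : RapidDecay fun n => d n * x n := by
  intro s
  obtain ⟨B, hB⟩ := hx (s + 1)
  refine ⟨C * B, fun n => ?_⟩
  have h := weight_pos n
  rw [norm_mul]
  calc weight n ^ s * (‖d n‖ * ‖x n‖) ≤ weight n ^ s * (C * weight n * ‖x n‖) := by
        have := hd n
        gcongr
    _ = C * (weight n ^ (s + 1) * ‖x n‖) := by ring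
    _ ≤ C * B := by have := hB n; gcongr

/-- The Floquet function with Fourier coefficients `x` at the frequencies `freq n + p`. -/
def floquetSeries (p : ℂ) (x : ℤ × ℤ → ℂ) (z : ℂ) : ℂ := ∑' n, x n * wave (freq n + p) z

lemma summable_floquetSeries {x : ℤ × ℤ → ℂ} (hx : Summable fun n => ‖x n‖) (p z : ℂ) :
    Summable fun n => x n * wave (freq n + p) z :=
  Summable.of_norm (by simpa [norm_wave] using hx)

lemma continuous_floquetSeries {x : ℤ × ℤ → ℂ} (hx : Summable fun n => ‖x n‖) (p : ℂ) :
    Continuous (floquetSeries p x) :=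
  continuous_tsum (fun n => continuous_const.mul (continuous_wave _)) hx
    (fun n z => by simp [norm_wave])

lemma isFloquet_floquetSeries (p : ℂ) (x : ℤ × ℤ → ℂ) : IsFloquet p (floquetSeries p x) := by
  intro γ hγ z
  rw [floquetSeries, floquetSeries, ← tsum_mul_left]
  refine tsum_congr fun n => ?_
  rw [wave_add_right, wave_add_left (freq n) p γ, wave_freq_lattice n hγ]; ring

lemma floquetCoeff_floquetSeries {x : ℤ × ℤ → ℂ} (hx : Summable fun n => ‖x n‖) (p : ℂ)
    (n : ℤ × ℤ) : floquetCoeff (freq n + p) (floquetSeries p x) = x n := by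
  have h := floquetCoeff_series_mul hx (fun m => freq m + p) (f := fun _ => 1)
    (memL2loc_of_continuous continuous_const) (freq n + p)
  simp only [mul_one] at h
  have h1 : (fun _ : ℂ => (1 : ℂ)) = wave (freq 0 + 0) := by
    ext z; rw [freq_zero, add_zero, wave_zero_left]
  have h2 : ∀ m, floquetCoeff (freq n + p - (freq m + p)) (fun _ => 1) =
      if m = n then 1 else 0 := by
    intro m
    rw [h1, show freq n + p - (freq m + p) = freq (n - m) + 0 by rw [freq_sub]; ring,
      floquetCoeff_wave]
    simp [eq_comm, sub_eq_zero]
  simp only [h2, mul_ite, mul_one, mul_zero, tsum_ite_eq] at h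
  exact h

lemma norm_diffSymbol_le (a b p : ℂ) : ‖diffSymbol a b p‖ ≤ (‖a‖ + ‖b‖) * ‖p‖ := by
  rw [diffSymbol, norm_mul, Complex.norm_I, one_mul]
  refine (norm_add_le _ _).trans ?_
  rw [norm_mul, norm_mul, Complex.norm_real, Complex.norm_real, add_mul]
  gcongr
  · exact Complex.abs_re_le_norm p
  · exact Complex.abs_im_le_norm p

lemma RapidDecay.diffSymbol_mul {x : ℤ × ℤ → ℂ} (hx : RapidDecay x) (a b p : ℂ) :
    RapidDecay fun n => diffSymbol a b (freq n + p) * x n := by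
  obtain ⟨C, hC0, hC⟩ := exists_norm_freq_add_le p
  refine hx.mul_of_le (C := (‖a‖ + ‖b‖) * C) (by positivity) fun n => ?_
  refine (norm_diffSymbol_le _ _ _).trans ?_
  rw [mul_assoc]
  exact mul_le_mul_of_nonneg_left (hC n) (by positivity)

lemma hasFDerivAt_floquetSeries {x : ℤ × ℤ → ℂ} (hx : RapidDecay x) (p z : ℂ) :
    HasFDerivAt (floquetSeries p x) (∑' n, x n • (wave (freq n + p) z • waveForm (freq n + p))) z ∧
      Summable fun n => x n • (wave (freq n + p) z • waveForm (freq n + p)) := by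
  obtain ⟨C, -, hC⟩ := exists_norm_freq_add_le p
  have hu : Summable fun n => 2 * C * (‖x n‖ * weight n ^ 1) := (hx.summable_mul 1).mul_left _
  have hb : ∀ n (w : ℂ), ‖x n • (wave (freq n + p) w • waveForm (freq n + p))‖ ≤
      2 * C * (‖x n‖ * weight n ^ 1) := by
    intro n w
    rw [norm_smul, norm_smul, norm_wave, one_mul, pow_one]
    calc ‖x n‖ * ‖waveForm (freq n + p)‖ ≤ ‖x n‖ * (2 * (C * weight n)) := by
          refine mul_le_mul_of_nonneg_left ((norm_waveForm_le _).trans ?_) (norm_nonneg _)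
          exact mul_le_mul_of_nonneg_left (hC n) (by norm_num)
      _ = _ := by ring
  refine ⟨?_, Summable.of_norm_bounded hu fun n => hb n z⟩
  exact hasFDerivAt_tsum hu (fun n w => (hasFDerivAt_wave _ w).const_mul (x n)) hb
    (summable_floquetSeries hx.summable p 0) z

lemma differentiable_floquetSeries {x : ℤ × ℤ → ℂ} (hx : RapidDecay x) (p : ℂ) :
    Differentiable ℝ (floquetSeries p x) := fun z =>
  (hasFDerivAt_floquetSeries hx p z).1.differentiableAt

lemma diffOp_floquetSeries {x : ℤ × ℤ → ℂ} (hx : RapidDecay x) (a b p z : ℂ) :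
    diffOp a b (floquetSeries p x) z =
      floquetSeries p (fun n => diffSymbol a b (freq n + p) * x n) z := by
  obtain ⟨h1, h2⟩ := hasFDerivAt_floquetSeries hx p z
  have e : ∀ v, (∑' n, x n • (wave (freq n + p) z • waveForm (freq n + p))) v =
      ∑' n, x n * (wave (freq n + p) z * (Complex.I * pair (freq n + p) v)) := by
    intro v
    have := (ContinuousLinearMap.apply ℝ ℂ v).map_tsum h2
    refine Eq.trans this (tsum_congr fun n => ?_)
    simp [waveForm_apply]
  have s : ∀ v,
      Summable fun n => x n * (wave (freq n + p) z * (Complex.I * pair (freq n + p) v)) := by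
    intro v
    refine ((ContinuousLinearMap.apply ℝ ℂ v).summable h2).congr fun n => ?_
    simp [waveForm_apply]
  rw [diffOp, h1.fderiv, e, e, ← tsum_mul_left, ← tsum_mul_left,
    ← ((s 1).mul_left a).tsum_add ((s Complex.I).mul_left b), floquetSeries]
  refine tsum_congr fun n => ?_
  simp only [diffSymbol, pair_eq, Complex.one_re, Complex.one_im, Complex.I_re, Complex.I_im,
    mul_one, mul_zero, add_zero, zero_add]
  ring

lemma continuous_fderiv_floquetSeries {x : ℤ × ℤ → ℂ} (hx : RapidDecay x) (p v : ℂ) :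
    Continuous fun z => fderiv ℝ (floquetSeries p x) z v := by
  have h : ∀ z, fderiv ℝ (floquetSeries p x) z v = diffOp v.re v.im (floquetSeries p x) z := by
    intro z
    have hv : v = v.re • (1 : ℂ) + v.im • Complex.I := by simp [Complex.re_add_im]
    conv_lhs => rw [hv]
    rw [map_add, map_smul, map_smul, diffOp, Complex.real_smul, Complex.real_smul]
  simp only [h, diffOp_floquetSeries hx]
  exact continuous_floquetSeries (hx.diffSymbol_mul _ _ _).summable p

end SmoothSeries

section SmoothCoefficients

lemma norm_floquetCoeff_le {f : ℂ → ℂ} (p : ℂ) :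
    ‖floquetCoeff p f‖ ≤ ∫ x in unitSquare, ‖f (latPt x)‖ := by
  refine (norm_integral_le_integral_norm _).trans_eq ?_
  simp [norm_wave]

lemma IsFloquet.fderiv {p : ℂ} {g : ℂ → ℂ} (hF : IsFloquet p g) {γ : ℂ} (hγ : γ ∈ lattice)
    (hg : Differentiable ℝ g) (z : ℂ) :
    fderiv ℝ g (z + γ) = wave p γ • fderiv ℝ g z := by
  have h1 : (fun w => g (w + γ)) = fun w => wave p γ * g w := by ext w; exact hF γ hγ w
  have h2 := congrArg (fun f => _root_.fderiv ℝ f z) h1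
  simp only [fderiv_comp_add_right] at h2
  rw [h2]
  exact ((hg z).hasFDerivAt.const_mul (wave p γ)).fderiv

lemma IsFloquet.diffOp {p a b : ℂ} {g : ℂ → ℂ} (hF : IsFloquet p g) (hg : Differentiable ℝ g) :
    IsFloquet p (diffOp a b g) := by
  intro γ hγ z
  rw [ChiralTBG.diffOp, hF.fderiv hγ hg, ChiralTBG.diffOp]
  simp only [smul_apply, smul_eq_mul]
  ring

lemma contDiff_diffOp {g : ℂ → ℂ} (hg : ContDiff ℝ ∞ g) (a b : ℂ) :
    ContDiff ℝ ∞ (diffOp a b g) := by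
  have h : ContDiff ℝ ∞ (fderiv ℝ g) := hg.fderiv_right (by simp)
  exact (contDiff_const.mul (h.clm_apply contDiff_const)).add
    (contDiff_const.mul (h.clm_apply contDiff_const))

lemma norm_diffSymbol_one_I (p : ℂ) : ‖diffSymbol 1 Complex.I p‖ = ‖p‖ := by
  have : diffSymbol 1 Complex.I p = Complex.I * p := by
    rw [diffSymbol]; congr 1
    conv_rhs => rw [← Complex.re_add_im p]
    ring
  rw [this, norm_mul, Complex.norm_I, one_mul]

lemma exists_norm_pow_mul_floquetCoeff_le {p : ℂ} (s : ℕ) :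
    ∀ {g : ℂ → ℂ}, ContDiff ℝ ∞ g → IsFloquet p g →
      ∃ B, ∀ n, ‖freq n + p‖ ^ s * ‖floquetCoeff (freq n + p) g‖ ≤ B := by
  induction s with
  | zero => exact fun {g} _ _ => ⟨_, fun n => by simpa using norm_floquetCoeff_le _⟩
  | succ s ih =>
    intro g hg hF
    have hd : Differentiable ℝ g := hg.differentiable (by simp)
    obtain ⟨B, hB⟩ := ih (contDiff_diffOp hg 1 Complex.I) (hF.diffOp hd)
    refine ⟨B, fun n => ?_⟩
    have h1 := floquetCoeff_diffOp (a := 1) (b := Complex.I) (q := freq n + p) hg.continuous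
      (contDiff_diffOp hg 1 Complex.I).continuous Set.countable_empty (fun z _ => hd z)
      (fun z _ => rfl) hF (by rw [dualLattice_eq_range]; exact ⟨n, by ring⟩)
    have h2 := hB n
    rw [h1, norm_mul, norm_diffSymbol_one_I] at h2
    calc _ = ‖freq n + p‖ ^ s * (‖freq n + p‖ * ‖floquetCoeff (freq n + p) g‖) := by ring
      _ ≤ B := h2

lemma rapidDecay_floquetCoeff {p : ℂ} {g : ℂ → ℂ} (hg : ContDiff ℝ ∞ g) (hF : IsFloquet p g) :
    RapidDecay fun n => floquetCoeff (freq n + p) g := by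
  intro s
  obtain ⟨B0, hB0⟩ := exists_norm_pow_mul_floquetCoeff_le 0 hg hF
  obtain ⟨B, hB⟩ := exists_norm_pow_mul_floquetCoeff_le s hg hF
  refine ⟨(1 + ‖p‖) ^ s * (2 ^ (s - 1) * (B0 + B)), fun n => ?_⟩
  have h1 := weight_le_norm_freq_add p n
  have h2 : weight n ^ s ≤ (1 + ‖p‖) ^ s * (2 ^ (s - 1) * (1 ^ s + ‖freq n + p‖ ^ s)) := by
    calc weight n ^ s ≤ ((1 + ‖p‖) * (1 + ‖freq n + p‖)) ^ s :=
          pow_le_pow_left₀ (weight_pos n).le h1 s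
      _ = (1 + ‖p‖) ^ s * (1 + ‖freq n + p‖) ^ s := mul_pow _ _ _
      _ ≤ _ := by
          gcongr
          exact add_pow_le zero_le_one (norm_nonneg _) s
  calc weight n ^ s * ‖floquetCoeff (freq n + p) g‖
      ≤ (1 + ‖p‖) ^ s * (2 ^ (s - 1) * (1 ^ s + ‖freq n + p‖ ^ s)) *
          ‖floquetCoeff (freq n + p) g‖ := by gcongr
    _ = (1 + ‖p‖) ^ s * (2 ^ (s - 1) * (‖freq n + p‖ ^ 0 * ‖floquetCoeff (freq n + p) g‖ +
          ‖freq n + p‖ ^ s * ‖floquetCoeff (freq n + p) g‖)) := by rw [one_pow, pow_zero]; ring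
    _ ≤ _ := by
        have := hB0 n
        have := hB n
        gcongr

lemma IsFloquet.eq_of_floquetCoeff {p : ℂ} {f g : ℂ → ℂ} (hF : IsFloquet p f) (hG : IsFloquet p g)
    (hf : Continuous f) (hg : Continuous g)
    (h : ∀ n, floquetCoeff (freq n + p) f = floquetCoeff (freq n + p) g) (z : ℂ) : f z = g z := by
  have hg' : Continuous fun z => (-1) * g z := continuous_const.mul hg
  have hsub : Continuous fun z => f z + (-1) * g z := hf.add hg'
  have hae := (hF.add (hG.const_mul (-1))).ae.eq_zero_of_floquetCoeff
    (memL2loc_of_continuous hsub) fun n => by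
      rw [floquetCoeff_add (memL2loc_of_continuous hf) (memL2loc_of_continuous hg'),
        floquetCoeff_const_mul, h n]
      ring
  have hz : f z + (-1) * g z = 0 := congrFun ((hsub.ae_eq_iff_eq volume continuous_const).1 hae) z
  linear_combination hz

lemma eq_floquetSeries_of_contDiff {p : ℂ} {g : ℂ → ℂ} (hg : ContDiff ℝ ∞ g) (hF : IsFloquet p g)
    (z : ℂ) : g z = floquetSeries p (fun n => floquetCoeff (freq n + p) g) z :=
  have hs := (rapidDecay_floquetCoeff hg hF).summable
  hF.eq_of_floquetCoeff (isFloquet_floquetSeries p _) hg.continuous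
    (continuous_floquetSeries hs p) (fun n => (floquetCoeff_floquetSeries hs p n).symm) z

end SmoothCoefficients

section Potential

/-- A smooth potential with the translation and rotation symmetries of the chiral model:
`IsChiralPotential` with analyticity relaxed to smoothness and the reflection symmetry dropped. -/
structure IsSmoothChiralPotential (K : ℂ) (U : ℂ → ℂ) : Prop where
  smooth : ContDiff ℝ ∞ U
  translation : ∀ γ ∈ lattice, ∀ z, U (z + γ) = Complex.exp (Complex.I * (pair γ K : ℂ)) * U z
  rotation : ∀ z, U (ω₃ * z) = ω₃ * U z

variable {K : ℂ} {U : ℂ → ℂ}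

lemma IsChiralPotential.isSmoothChiralPotential (hU : IsChiralPotential K U) :
    IsSmoothChiralPotential K U where
  smooth := contDiff_iff_contDiffAt.2 fun z => (hU.analytic z).contDiffAt
  translation := hU.translation
  rotation := hU.rotation

lemma IsSmoothChiralPotential.isFloquet (hU : IsSmoothChiralPotential K U) (hK : IsDiracPoint K) :
    IsFloquet (-(2 * K)) U := by
  have h : IsFloquet K U := fun γ hγ z => by
    rw [hU.translation γ hγ z, wave, pair_comm]
  refine h.shift ?_
  rw [show -(2 * K) - K = -(3 * K) by ring]
  exact dualLattice_neg hK.three_mul_mem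

/-- The Fourier coefficients of the potential, at the frequencies `freq m - 2K`. -/
def potCoeff (K : ℂ) (U : ℂ → ℂ) (m : ℤ × ℤ) : ℂ := floquetCoeff (freq m + -(2 * K)) U

lemma rapidDecay_potCoeff (hU : IsSmoothChiralPotential K U) (hK : IsDiracPoint K) :
    RapidDecay (potCoeff K U) := rapidDecay_floquetCoeff hU.smooth (hU.isFloquet hK)

lemma potential_eq_floquetSeries (hU : IsSmoothChiralPotential K U) (hK : IsDiracPoint K) (z : ℂ) :
    U z = floquetSeries (-(2 * K)) (potCoeff K U) z :=
  eq_floquetSeries_of_contDiff hU.smooth (hU.isFloquet hK) z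

lemma potCoeff_rot (hU : IsSmoothChiralPotential K U) (hK : IsDiracPoint K) {τ : Equiv.Perm (ℤ × ℤ)}
    (hτ : ∀ m, freq (τ m) + -(2 * K) = ω₃ * (freq m + -(2 * K))) (m : ℤ × ℤ) :
    potCoeff K U (τ m) = ω₃ * potCoeff K U m := by
  have hs := (rapidDecay_potCoeff hU hK).summable
  have hs' : Summable fun m => ‖potCoeff K U (τ m)‖ := τ.summable_iff.2 hs
  have h : (fun z => ω₃ * U z) = floquetSeries (-(2 * K)) (fun m => potCoeff K U (τ m)) := by
    ext z
    rw [← hU.rotation, potential_eq_floquetSeries hU hK (ω₃ * z), floquetSeries,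
      floquetSeries, ← τ.tsum_eq]
    refine tsum_congr fun m => ?_
    rw [hτ, wave_omega_mul]
  rw [← floquetCoeff_floquetSeries hs' (-(2 * K)) m, ← h, floquetCoeff_const_mul]
  rfl

end Potential

section FourierSystem

/-- Index set for the Fourier coefficients of `ℂ²`-valued functions: lattice index and component. -/
abbrev Idx : Type := (ℤ × ℤ) × Fin 2

/-- The quasimomentum of the `j`-th component: the twist `diag (e^{i⟨γ, K⟩}, e^{-i⟨γ, K⟩})` shifts
`k` by `∓K`. -/
def shiftK (K k : ℂ) (j : Fin 2) : ℂ := if j = 0 then k - K else k + K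

/-- The frequencies of a `ℂ²`-valued function of quasimomentum `k`. -/
def modeFreq (K k : ℂ) (i : Idx) : ℂ := freq i.1 + shiftK K k i.2

lemma shiftIdx_involutive (m : ℤ × ℤ) :
    Function.Involutive fun i : Idx => (if i.2 = 0 then i.1 - m else i.1 + m, i.2 + 1) := by
  rintro ⟨n, j⟩
  fin_cases j <;> simp

/-- The involution of the index set induced by multiplication with the `m`-th Fourier mode of
the potential. -/
def shiftIdx (m : ℤ × ℤ) : Equiv.Perm Idx := (shiftIdx_involutive m).toPerm

lemma shiftIdx_apply (m : ℤ × ℤ) (i : Idx) :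
    shiftIdx m i = (if i.2 = 0 then i.1 - m else i.1 + m, i.2 + 1) := rfl

/-- The quasimomentum of the `j`-th off-diagonal entry, `U(z)` for `j = 0` and `U(-z)` for
`j = 1`. -/
def potShift (K : ℂ) (j : Fin 2) : ℂ := if j = 0 then -(2 * K) else 2 * K

/-- The frequencies of the `j`-th off-diagonal entry, indexed so that both entries have the same
Fourier coefficients. -/
def potFreq (K : ℂ) (j : Fin 2) (m : ℤ × ℤ) : ℂ := freq (if j = 0 then m else -m) + potShift K j

/-- The `j`-th off-diagonal entry built from the Fourier coefficients `c` of the potential. -/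
def potSeries (K : ℂ) (c : ℤ × ℤ → ℂ) (j : Fin 2) (z : ℂ) : ℂ :=
  ∑' m, c m * wave (potFreq K j m) z

lemma modeFreq_sub_potFreq (K k : ℂ) (m : ℤ × ℤ) (i : Idx) :
    modeFreq K k i - potFreq K i.2 m = modeFreq K k (shiftIdx m i) := by
  obtain ⟨n, j⟩ := i
  fin_cases j
  · simp only [modeFreq, potFreq, shiftIdx_apply, shiftK, potShift, Fin.zero_eta, reduceIte,
      freq_sub, zero_add, one_ne_zero]
    ring
  · simp only [modeFreq, potFreq, shiftIdx_apply, shiftK, potShift, Fin.mk_one, reduceIte,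
      freq_add, freq_neg, one_ne_zero, Fin.isValue, Fin.reduceAdd]
    ring

lemma potShift_add_shiftK (K k : ℂ) (j : Fin 2) :
    potShift K j + shiftK K k (j + 1) = shiftK K k j := by
  fin_cases j <;>
    simp only [potShift, shiftK, Fin.zero_eta, Fin.mk_one, reduceIte, one_ne_zero, Fin.isValue,
      Fin.reduceAdd, zero_add] <;>
    ring

lemma continuous_potSeries (K : ℂ) {c : ℤ × ℤ → ℂ} (hc : Summable fun m => ‖c m‖) (j : Fin 2) :
    Continuous (potSeries K c j) :=
  continuous_tsum (fun _ => continuous_const.mul (continuous_wave _)) hc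
    (fun n z => by simp [norm_wave])

lemma isFloquet_potSeries (K : ℂ) (c : ℤ × ℤ → ℂ) (j : Fin 2) :
    IsFloquet (potShift K j) (potSeries K c j) := by
  intro γ hγ z
  rw [potSeries, potSeries, ← tsum_mul_left]
  refine tsum_congr fun n => ?_
  rw [potFreq, wave_add_right, wave_add_left _ _ γ, wave_freq_lattice _ hγ]
  ring

lemma AEFloquet.potSeries_mul {K k : ℂ} {c : ℤ × ℤ → ℂ} {j : Fin 2} {f : ℂ → ℂ}
    (hf : AEFloquet (shiftK K k (j + 1)) f) :
    AEFloquet (shiftK K k j) fun z => potSeries K c j z * f z := by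
  intro γ hγ
  filter_upwards [hf γ hγ] with z hz
  rw [hz, isFloquet_potSeries K c j γ hγ, ← potShift_add_shiftK K k j, wave_add_left]
  ring

lemma IsFloquet.potSeries_mul {K k : ℂ} {c : ℤ × ℤ → ℂ} {j : Fin 2} {f : ℂ → ℂ}
    (hf : IsFloquet (shiftK K k (j + 1)) f) :
    IsFloquet (shiftK K k j) fun z => potSeries K c j z * f z := by
  intro γ hγ z
  simp only [hf γ hγ, isFloquet_potSeries K c j γ hγ]
  rw [← potShift_add_shiftK K k j, wave_add_left]
  ring

lemma MemL2loc.continuous_mul {f g : ℂ → ℂ} (hf : MemL2loc f) (hg : Continuous g) :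
    MemL2loc fun z => g z * f z := by
  intro s hs
  obtain ⟨C, hC⟩ := hs.exists_bound_of_continuousOn hg.continuousOn
  refine (hf s hs).of_le_mul (c := C) (hg.aestronglyMeasurable.mul (hf s hs).1) ?_
  refine ae_restrict_of_forall_mem hs.measurableSet fun z hz => ?_
  rw [norm_mul]
  exact mul_le_mul_of_nonneg_right (hC z hz) (norm_nonneg _)

lemma MemL2loc.add {f g : ℂ → ℂ} (hf : MemL2loc f) (hg : MemL2loc g) :
    MemL2loc fun z => f z + g z := fun s hs => (hf s hs).add (hg s hs)

lemma MemL2loc.const_mul {f : ℂ → ℂ} (hf : MemL2loc f) (c : ℂ) :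
    MemL2loc fun z => c * f z := fun s hs => (hf s hs).const_mul c

/-- The Fourier coefficients of a `ℂ²`-valued Floquet function of quasimomentum `k`. -/
def coeffVec (K k : ℂ) (f : Fin 2 → ℂ → ℂ) (i : Idx) : ℂ := floquetCoeff (modeFreq K k i) (f i.2)

lemma memℓp_coeffVec {K k : ℂ} {f : Fin 2 → ℂ → ℂ} (hf : ∀ j, MemL2loc (f j)) :
    Memℓp (coeffVec K k f) 2 := by
  rw [memℓp_two_iff, summable_prod_of_nonneg (fun i => by positivity)]
  refine ⟨fun n => Summable.of_finite, ?_⟩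
  simp only [tsum_fintype, Fin.sum_univ_two]
  exact (summable_sq_floquetCoeff (hf 0) _).add (summable_sq_floquetCoeff (hf 1) _)

lemma floquetCoeff_const_mul_add_neg_potSeries_mul {K k E : ℂ} {c : ℤ × ℤ → ℂ}
    (hc : Summable fun m => ‖c m‖)
    {f h : Fin 2 → ℂ → ℂ} (hf : ∀ j, MemL2loc (f j)) (hh : ∀ j, MemL2loc (h j)) (i : Idx) :
    floquetCoeff (modeFreq K k i)
        (fun z => E * h i.2 z + (-1) * (potSeries K c i.2 z * f (i.2 + 1) z)) =
      E * coeffVec K k h i - ∑' m, c m * coeffVec K k f (shiftIdx m i) := by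
  have h1 := (hf (i.2 + 1)).continuous_mul (continuous_potSeries K hc i.2)
  rw [floquetCoeff_add ((hh _).const_mul E) (h1.const_mul (-1)), floquetCoeff_const_mul,
    floquetCoeff_const_mul]
  have h2 := floquetCoeff_series_mul hc (potFreq K i.2) (hf (i.2 + 1)) (modeFreq K k i)
  have h3 : (fun z => (∑' m, c m * wave (potFreq K i.2 m) z) * f (i.2 + 1) z) =
      fun z => potSeries K c i.2 z * f (i.2 + 1) z := rfl
  rw [← h3, h2]
  simp only [modeFreq_sub_potFreq]
  rw [coeffVec, neg_one_mul, ← sub_eq_add_neg]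
  rfl

lemma coeffVec_solves_of_weak {K k E a b : ℂ} {c : ℤ × ℤ → ℂ} (hc : Summable fun m => ‖c m‖)
    {f h : Fin 2 → ℂ → ℂ} (hf : ∀ j, MemL2loc (f j)) (hh : ∀ j, MemL2loc (h j))
    (hFf : ∀ j, AEFloquet (shiftK K k j) (f j)) (hFh : ∀ j, AEFloquet (shiftK K k j) (h j))
    (hw : ∀ j, ∀ Φ : ℂ → ℂ, ContDiff ℝ ∞ Φ → HasCompactSupport Φ →
      ∫ z, diffOp a b Φ z * f j z =
        -∫ z, Φ z * (E * h j z + (-1) * (potSeries K c j z * f (j + 1) z))) (i : Idx) :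
    diffSymbol a b (modeFreq K k i) * coeffVec K k f i +
      ∑' m, c m * coeffVec K k f (shiftIdx m i) = E * coeffVec K k h i := by
  have hF : AEFloquet (shiftK K k i.2)
      (fun z => E * h i.2 z + (-1) * (potSeries K c i.2 z * f (i.2 + 1) z)) := by
    intro γ hγ
    filter_upwards [hFh i.2 γ hγ, (hFf (i.2 + 1)).potSeries_mul (c := c) γ hγ] with z h1 h2
    rw [h1, h2]
    ring
  have h1 := (hf (i.2 + 1)).continuous_mul (continuous_potSeries K hc i.2)
  have key := floquetCoeff_of_weak (q := modeFreq K k i) (hf i.2)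
    (((hh i.2).const_mul E).add (h1.const_mul (-1))) (hFf i.2) hF (hw i.2)
    (by rw [dualLattice_eq_range]; exact ⟨i.1, by simp [modeFreq]⟩)
  rw [floquetCoeff_const_mul_add_neg_potSeries_mul hc hf hh] at key
  change _ = diffSymbol a b (modeFreq K k i) * coeffVec K k f i at key
  linear_combination -key

lemma coeffVec_solves_of_off_countable {K k a b : ℂ} {c : ℤ × ℤ → ℂ} (hc : Summable fun m => ‖c m‖)
    {f : Fin 2 → ℂ → ℂ} (hf : ∀ j, Continuous (f j)) (hFf : ∀ j, IsFloquet (shiftK K k j) (f j))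
    {s : Set ℂ} (hs : s.Countable) (hd : ∀ j, ∀ z ∉ s, DifferentiableAt ℝ (f j) z)
    (he : ∀ j, ∀ z ∉ s, diffOp a b (f j) z + potSeries K c j z * f (j + 1) z = 0) (i : Idx) :
    diffSymbol a b (modeFreq K k i) * coeffVec K k f i +
      ∑' m, c m * coeffVec K k f (shiftIdx m i) = 0 := by
  have key := floquetCoeff_diffOp (a := a) (b := b) (p := shiftK K k i.2) (q := modeFreq K k i)
    (hf i.2) (G := fun z => 0 * 0 + (-1) * (potSeries K c i.2 z * f (i.2 + 1) z))
    (by have := continuous_potSeries K hc i.2; have := hf (i.2 + 1); fun_prop) hs (hd i.2)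
    (fun z hz => by have := he i.2 z hz; linear_combination -this) (hFf i.2)
    (by rw [dualLattice_eq_range]; exact ⟨i.1, by simp [modeFreq]⟩)
  rw [floquetCoeff_const_mul_add_neg_potSeries_mul (h := fun _ _ => 0) hc
    (fun j => memL2loc_of_continuous (hf j))
    (fun _ => memL2loc_of_continuous continuous_const)] at key
  change _ = diffSymbol a b (modeFreq K k i) * coeffVec K k f i at key
  linear_combination -key

/-- The `ℂ²`-valued Floquet function of quasimomentum `k` with prescribed Fourier coefficients. -/
def seriesVec (K k : ℂ) (x : Idx → ℂ) (j : Fin 2) : ℂ → ℂ :=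
  floquetSeries (shiftK K k j) fun n => x (n, j)

lemma coeffVec_seriesVec {K k : ℂ} {x : Idx → ℂ} (hx : ∀ j, RapidDecay fun n => x (n, j)) :
    coeffVec K k (seriesVec K k x) = x := by
  ext i
  exact floquetCoeff_floquetSeries (hx i.2).summable _ i.1

lemma seriesVec_solves {K k E a b : ℂ} {c : ℤ × ℤ → ℂ} (hc : Summable fun m => ‖c m‖)
    {x y : Idx → ℂ} (hx : ∀ j, RapidDecay fun n => x (n, j))
    (hy : ∀ j, RapidDecay fun n => y (n, j))
    (he : ∀ i, diffSymbol a b (modeFreq K k i) * x i + ∑' m, c m * x (shiftIdx m i) = E * y i)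
    (j : Fin 2) (z : ℂ) :
    diffOp a b (seriesVec K k x j) z + potSeries K c j z * seriesVec K k x (j + 1) z =
      E * seriesVec K k y j z := by
  have cx := fun j => continuous_floquetSeries (hx j).summable (shiftK K k j)
  have cy := fun j => continuous_floquetSeries (hy j).summable (shiftK K k j)
  have hd := ((hx j).diffSymbol_mul a b (shiftK K k j)).summable
  have hF : IsFloquet (shiftK K k j) fun z =>
      E * seriesVec K k y j z + (-1) * (potSeries K c j z * seriesVec K k x (j + 1) z) :=
    ((isFloquet_floquetSeries _ _).const_mul E).add
      (IsFloquet.const_mul _ (isFloquet_floquetSeries _ _).potSeries_mul)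
  have hR : Continuous fun z =>
      E * seriesVec K k y j z + (-1) * (potSeries K c j z * seriesVec K k x (j + 1) z) :=
    (continuous_const.mul (cy j)).add
      (continuous_const.mul ((continuous_potSeries K hc j).mul (cx (j + 1))))
  have hcoeff := fun n => floquetCoeff_const_mul_add_neg_potSeries_mul (K := K) (k := k) (E := E) hc
    (f := seriesVec K k x) (h := seriesVec K k y) (fun j => memL2loc_of_continuous (cx j))
    (fun j => memL2loc_of_continuous (cy j)) (n, j)
  rw [coeffVec_seriesVec hx, coeffVec_seriesVec hy] at hcoeff
  have key := (isFloquet_floquetSeries _ _).eq_of_floquetCoeff hF (continuous_floquetSeries hd _) hR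
    (fun n => by
      refine (floquetCoeff_floquetSeries hd _ n).trans (Eq.trans ?_ (hcoeff n).symm)
      have he' : diffSymbol a b (freq n + shiftK K k j) * x (n, j) + _ = _ := he (n, j)
      linear_combination he') z
  rw [seriesVec, diffOp_floquetSeries (hx j)]
  linear_combination key

end FourierSystem

section WeakProjection

variable {F : Type*} [NormedAddCommGroup F]

lemma MemL2loc.locallyIntegrable {f : ℂ → F} (hf : MemL2loc f) : LocallyIntegrable f := by
  rw [locallyIntegrable_iff]
  intro s hs
  have := isFiniteMeasure_restrict (μ := volume).2 hs.measure_lt_top.ne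
  exact (hf s hs).integrable (by norm_num)

variable [NormedSpace ℝ F]

lemma MemL2loc.integrable_smul {f : ℂ → F} (hf : MemL2loc f) {φ : ℂ → ℝ} (hφ : Continuous φ)
    (hc : HasCompactSupport φ) : Integrable fun z => φ z • f z :=
  hf.locallyIntegrable.integrable_smul_left_of_hasCompactSupport hφ hc

lemma continuous_fderiv_apply_of_contDiff {G : Type*} [NormedAddCommGroup G] [NormedSpace ℝ G]
    {φ : ℂ → G} (hφ : ContDiff ℝ ∞ φ) (v : ℂ) : Continuous fun z => fderiv ℝ φ z v :=
  (hφ.continuous_fderiv (by simp)).clm_apply continuous_const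

lemma MemL2loc.clm_comp {f : ℂ → F} (hf : MemL2loc f) (L : F →L[ℝ] ℂ) :
    MemL2loc fun z => L (f z) := fun s hs => L.comp_memLp' (hf s hs)

lemma IsWeakDeriv.clm_comp [CompleteSpace F] {v : ℂ} {f g : ℂ → F} (h : IsWeakDeriv v f g)
    (hf : MemL2loc f) (hg : MemL2loc g) (L : F →L[ℝ] ℂ) :
    IsWeakDeriv v (fun z => L (f z)) fun z => L (g z) := by
  intro φ hφ hc
  have h1 := L.integral_comp_comm (hf.integrable_smul
    (continuous_fderiv_apply_of_contDiff hφ v) (hc.fderiv_apply (𝕜 := ℝ) v))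
  have h2 := L.integral_comp_comm (hg.integrable_smul hφ.continuous hc)
  simp only [map_smul] at h1 h2
  rw [h1, h2, h φ hφ hc, map_neg]

lemma mul_eq_re_smul_add_I_mul_im_smul (w t : ℂ) :
    w * t = w.re • t + Complex.I * (w.im • t) := by
  rw [Complex.real_smul, Complex.real_smul]
  linear_combination -t * Complex.re_add_im w

lemma MemL2loc.integrable_mul {f : ℂ → ℂ} (hf : MemL2loc f) {Φ : ℂ → ℂ} (hΦ : Continuous Φ)
    (hc : HasCompactSupport Φ) : Integrable fun z => Φ z * f z := by
  simp only [fun z => mul_eq_re_smul_add_I_mul_im_smul (Φ z) (f z)]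
  exact (hf.integrable_smul (Complex.continuous_re.comp hΦ) (hc.comp_left Complex.zero_re)).add
    ((hf.integrable_smul (Complex.continuous_im.comp hΦ)
      (hc.comp_left Complex.zero_im)).const_mul _)

lemma MemL2loc.integral_mul {f : ℂ → ℂ} (hf : MemL2loc f) {Φ : ℂ → ℂ} (hΦ : Continuous Φ)
    (hc : HasCompactSupport Φ) :
    ∫ z, Φ z * f z = (∫ z, (Φ z).re • f z) + Complex.I * ∫ z, (Φ z).im • f z := by
  simp only [fun z => mul_eq_re_smul_add_I_mul_im_smul (Φ z) (f z)]
  rw [← integral_const_mul]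
  exact integral_add
    (hf.integrable_smul (Complex.continuous_re.comp hΦ) (hc.comp_left Complex.zero_re))
    ((hf.integrable_smul (Complex.continuous_im.comp hΦ)
      (hc.comp_left Complex.zero_im)).const_mul _)

lemma IsWeakDeriv.integral_clm_comp_smul {v : ℂ} {f g : ℂ → ℂ} (h : IsWeakDeriv v f g) {Φ : ℂ → ℂ}
    (hΦ : ContDiff ℝ ∞ Φ) (hc : HasCompactSupport Φ) (L : ℂ →L[ℝ] ℝ) :
    ∫ z, L (fderiv ℝ Φ z v) • f z = -∫ z, L (Φ z) • g z := by
  rw [← h (fun z => L (Φ z)) (L.contDiff.comp hΦ) (hc.comp_left (map_zero L))]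
  refine integral_congr_ae (Eventually.of_forall fun z => ?_)
  have hd : HasFDerivAt (fun z => L (Φ z)) _ z :=
    L.hasFDerivAt.comp z (hΦ.differentiable (by simp) z).hasFDerivAt
  simp only [hd.fderiv, ContinuousLinearMap.comp_apply]

lemma IsWeakDeriv.integral_fderiv_mul {v : ℂ} {f g : ℂ → ℂ} (h : IsWeakDeriv v f g)
    (hf : MemL2loc f) (hg : MemL2loc g) {Φ : ℂ → ℂ} (hΦ : ContDiff ℝ ∞ Φ)
    (hc : HasCompactSupport Φ) :
    ∫ z, fderiv ℝ Φ z v * f z = -∫ z, Φ z * g z := by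
  have hre := h.integral_clm_comp_smul hΦ hc Complex.reCLM
  have him := h.integral_clm_comp_smul hΦ hc Complex.imCLM
  simp only [Complex.reCLM_apply, Complex.imCLM_apply] at hre him
  rw [hf.integral_mul (continuous_fderiv_apply_of_contDiff hΦ v) (hc.fderiv_apply (𝕜 := ℝ) v),
    hg.integral_mul hΦ.continuous hc, hre, him]
  ring

lemma integral_diffOp_mul_of_isWeakDeriv {a b : ℂ} {f fx fy G : ℂ → ℂ} (hf : MemL2loc f)
    (hx : MemL2loc fx) (hy : MemL2loc fy) (h1 : IsWeakDeriv 1 f fx)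
    (h2 : IsWeakDeriv Complex.I f fy) (hG : ∀ᵐ z, a * fx z + b * fy z = G z) {Φ : ℂ → ℂ}
    (hΦ : ContDiff ℝ ∞ Φ) (hc : HasCompactSupport Φ) :
    ∫ z, diffOp a b Φ z * f z = -∫ z, Φ z * G z := by
  have hi : ∀ v, Integrable fun z => fderiv ℝ Φ z v * f z := fun v =>
    hf.integrable_mul (continuous_fderiv_apply_of_contDiff hΦ v) (hc.fderiv_apply (𝕜 := ℝ) v)
  have l : (fun z => diffOp a b Φ z * f z) = fun z => a * (fderiv ℝ Φ z 1 * f z) +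
      b * (fderiv ℝ Φ z Complex.I * f z) := by
    ext z
    rw [diffOp]
    ring
  have r : (fun z => Φ z * G z) =ᵐ[volume] fun z => a * (Φ z * fx z) + b * (Φ z * fy z) := by
    filter_upwards [hG] with z hz
    rw [← hz]
    ring
  rw [l, integral_congr_ae r, integral_add ((hi 1).const_mul _) ((hi Complex.I).const_mul _),
    integral_add ((hx.integrable_mul hΦ.continuous hc).const_mul _)
      ((hy.integrable_mul hΦ.continuous hc).const_mul _), integral_const_mul, integral_const_mul,
    integral_const_mul, integral_const_mul, h1.integral_fderiv_mul hf hx hΦ hc,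
    h2.integral_fderiv_mul hf hy hΦ hc]
  ring

lemma IsWeakDeriv.of_differentiable {f : ℂ → F} (hf : Differentiable ℝ f) (v : ℂ)
    (hc : Continuous fun z => fderiv ℝ f z v) :
    IsWeakDeriv v f fun z => fderiv ℝ f z v := by
  intro φ hφ hcs
  have hL : MemL2loc f := memL2loc_of_continuous hf.continuous
  have hL' : MemL2loc fun z => fderiv ℝ f z v := memL2loc_of_continuous hc
  have := integral_smul_fderiv_eq_neg_fderiv_smul_of_integrable (𝕜 := ℝ) (μ := volume) (v := v)
    (hL.integrable_smul (continuous_fderiv_apply_of_contDiff hφ v)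
      (hcs.fderiv_apply (𝕜 := ℝ) v))
    (hL'.integrable_smul hφ.continuous hcs) (hL.integrable_smul hφ.continuous hcs)
    (fun z _ => (hφ.differentiable (by simp)) z) (fun z _ => hf z)
  rw [this, neg_neg]

end WeakProjection

section Components

/-- The coordinate forms on `ℂ⁴ = ℂ² × ℂ²`, as real-linear maps; `b = true` is the first block. -/
def component (b : Bool) (j : Fin 2) : C4 →L[ℝ] ℂ :=
  (ContinuousLinearMap.proj j).comp
    (if b then ContinuousLinearMap.fst ℝ C2 C2 else ContinuousLinearMap.snd ℝ C2 C2)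

lemma component_true (j : Fin 2) (u : C4) : component true j u = u.1 j := rfl

lemma component_false (j : Fin 2) (u : C4) : component false j u = u.2 j := rfl

lemma wave_mul_eq_mul_iff (K γ s w t : ℂ) :
    wave K γ * s = w * t ↔ s = w * wave (-K) γ * t := by
  have hK := wave_neg_mul_wave K γ
  constructor
  · intro h
    linear_combination wave (-K) γ * h - s * hK
  · rintro rfl
    linear_combination w * t * hK

lemma transl_eq_smul_iff (K k γ : ℂ) (u : ℂ → C4) (z : ℂ) :
    transl K γ u z = Complex.exp (Complex.I * pair k γ) • u z ↔
      ∀ b j, component b j (u (z + γ)) = wave (shiftK K k j) γ * component b j (u z) := by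
  have e1 : Complex.exp (Complex.I * pair γ K) = wave K γ := by rw [wave, pair_comm]
  have e2 : Complex.exp (-(Complex.I * pair γ K)) = wave (-K) γ := by
    rw [wave, pair_neg_left, pair_comm γ]; push_cast; ring_nf
  have e3 : Complex.exp (Complex.I * pair k γ) = wave k γ := rfl
  have hs0 : wave (shiftK K k 0) γ = wave k γ * wave (-K) γ := by
    rw [shiftK, if_pos rfl, sub_eq_add_neg, wave_add_left]
  have hs1 : wave (shiftK K k 1) γ = wave k γ * wave K γ := by
    rw [shiftK, if_neg (by simp), wave_add_left]
  rw [Prod.ext_iff, funext_iff, funext_iff]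
  simp only [transl, twist, e1, e2, e3, Matrix.mulVec_diagonal, Fin.forall_fin_two, Prod.smul_fst,
    Prod.smul_snd, Pi.smul_apply, smul_eq_mul, Bool.forall_bool, component_true,
    component_false, hs0, hs1, Matrix.cons_val_zero, Matrix.cons_val_one, wave_mul_eq_mul_iff,
    neg_neg]
  tauto

lemma opH_eq_iff (U : ℂ → ℂ) (α z : ℂ) (E : ℝ) (u ux uy : C4) :
    opH U α z u ux uy = (E : ℂ) • u ↔
      ((-Complex.I) * ux.1 0 + 1 * uy.1 0 + α * U z * u.1 1 = E * u.2 0 ∧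
       (-Complex.I) * ux.1 1 + 1 * uy.1 1 + α * U (-z) * u.1 0 = E * u.2 1) ∧
      ((-Complex.I) * ux.2 0 + (-1) * uy.2 0 + conj (α * U (-z)) * u.2 1 = E * u.1 0 ∧
       (-Complex.I) * ux.2 1 + (-1) * uy.2 1 + conj (α * U z) * u.2 0 = E * u.1 1) := by
  have hI : ∀ s t : ℂ, -Complex.I * (s + Complex.I * t) = (-Complex.I) * s + 1 * t := by
    intro s t; linear_combination (-t) * Complex.I_sq
  have hI' : ∀ s t : ℂ, -Complex.I * (s - Complex.I * t) = (-Complex.I) * s + (-1) * t := by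
    intro s t; linear_combination t * Complex.I_sq
  rw [Prod.ext_iff, funext_iff, funext_iff]
  simp only [opH, opD, opDstar, potMatrix, Fin.forall_fin_two, Pi.add_apply, Pi.smul_apply,
    smul_eq_mul, Pi.sub_apply, Prod.smul_fst, Prod.smul_snd, hI, hI',
    Matrix.mulVec, dotProduct, Fin.sum_univ_two, Matrix.conjTranspose_apply, Matrix.of_apply,
    Matrix.cons_val', Matrix.cons_val_zero, Matrix.cons_val_one, Matrix.cons_val_fin_one,
    star_zero, zero_mul, zero_add, add_zero]
  exact and_comm

end Components

section ModeSystem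

/-- The Fourier coefficients of `αU`, at the frequencies `freq m - 2K`. -/
def potSeq (K : ℂ) (U : ℂ → ℂ) (α : ℂ) (m : ℤ × ℤ) : ℂ := α * potCoeff K U m

/-- The zeroth order part of `D(α)` on the Fourier side, where `D(α)` becomes
`modeFreq K k + potOp K U α`. -/
def potOp (K : ℂ) (U : ℂ → ℂ) (α : ℂ) : Ell2 Idx →L[ℂ] Ell2 Idx :=
  shiftOp (potSeq K U α) shiftIdx

lemma diffSymbol_dbar (p : ℂ) : diffSymbol (-Complex.I) 1 p = p := by
  rw [diffSymbol]
  conv_rhs => rw [← Complex.re_add_im p]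
  linear_combination (-(p.re : ℂ)) * Complex.I_sq

lemma diffSymbol_d (p : ℂ) : diffSymbol (-Complex.I) (-1) p = conj p := by
  rw [diffSymbol]
  conv_rhs => rw [← Complex.re_add_im p]
  simp only [map_add, map_mul, Complex.conj_ofReal, Complex.conj_I]
  linear_combination (-(p.re : ℂ)) * Complex.I_sq

lemma tendsto_norm_modeFreq (K k : ℂ) :
    Tendsto (fun i => ‖modeFreq K k i‖) cofinite atTop := by
  rw [tendsto_atTop]
  intro R
  have h := fun j : Fin 2 => tendsto_atTop.1 (tendsto_norm_freq_add (shiftK K k j)) R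
  simp only [eventually_cofinite] at h ⊢
  have h2 := Set.Finite.union ((h 0).image fun n => ((n, 0) : Idx))
    ((h 1).image fun n => ((n, 1) : Idx))
  refine h2.subset ?_
  rintro ⟨n, j⟩ hn
  fin_cases j
  · exact Or.inl ⟨n, hn, rfl⟩
  · exact Or.inr ⟨n, hn, rfl⟩

lemma exists_weight_le_modeFreq (K k : ℂ) :
    ∃ C, 0 ≤ C ∧ ∀ i : Idx, weight i.1 ≤ C * (1 + ‖modeFreq K k i‖) := by
  refine ⟨(1 + ‖shiftK K k 0‖) + (1 + ‖shiftK K k 1‖), by positivity, ?_⟩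
  rintro ⟨n, j⟩
  refine (weight_le_norm_freq_add (shiftK K k j) n).trans ?_
  refine mul_le_mul_of_nonneg_right ?_ (by positivity)
  fin_cases j
  · exact le_add_of_nonneg_right (by positivity)
  · exact le_add_of_nonneg_left (by positivity)

lemma weight_le_shiftIdx (m : ℤ × ℤ) (i : Idx) :
    weight i.1 ≤ weight m * weight (shiftIdx m i).1 := by
  obtain ⟨n, j⟩ := i
  rw [shiftIdx_apply]
  fin_cases j
  · simpa using weight_add_le m (n - m)
  · simpa [weight_neg] using weight_add_le (-m) (n + m)

section

variable {K : ℂ} {U : ℂ → ℂ}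

lemma rapidDecay_potSeq (hU : IsSmoothChiralPotential K U) (hK : IsDiracPoint K) (α : ℂ) :
    RapidDecay (potSeq K U α) :=
  (rapidDecay_potCoeff hU hK).mul_of_le (d := fun _ => α) (norm_nonneg α) fun n =>
    le_mul_of_one_le_right (norm_nonneg _) (one_le_weight n)

lemma summable_potSeq (hU : IsSmoothChiralPotential K U) (hK : IsDiracPoint K) (α : ℂ) :
    Summable fun m => ‖potSeq K U α m‖ := (rapidDecay_potSeq hU hK α).summable

lemma potOp_apply (hU : IsSmoothChiralPotential K U) (hK : IsDiracPoint K) (α : ℂ) (x : Ell2 Idx)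
    (i : Idx) : potOp K U α x i = ∑' m, potSeq K U α m * x (shiftIdx m i) :=
  shiftOp_apply (summable_potSeq hU hK α) _ _ _

lemma adjoint_potOp_apply (hU : IsSmoothChiralPotential K U) (hK : IsDiracPoint K) (α : ℂ)
    (x : Ell2 Idx) (i : Idx) : ContinuousLinearMap.adjoint (potOp K U α) x i =
      ∑' m, conj (potSeq K U α m) * x (shiftIdx m i) := by
  rw [potOp, adjoint_shiftOp (summable_potSeq hU hK α) shiftIdx_involutive, shiftOp_apply]
  simpa using summable_potSeq hU hK α

lemma potSeries_zero (hU : IsSmoothChiralPotential K U) (hK : IsDiracPoint K) (α z : ℂ) :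
    potSeries K (potSeq K U α) 0 z = α * U z := by
  rw [potential_eq_floquetSeries hU hK z, potSeries, floquetSeries, ← tsum_mul_left]
  refine tsum_congr fun m => ?_
  simp [potSeq, potFreq, potShift, mul_assoc]

lemma potFreq_one (K : ℂ) (m : ℤ × ℤ) : potFreq K 1 m = -potFreq K 0 m := by
  simp only [potFreq, potShift, freq_neg, one_ne_zero, reduceIte]
  ring

lemma potSeries_one (hU : IsSmoothChiralPotential K U) (hK : IsDiracPoint K) (α z : ℂ) :
    potSeries K (potSeq K U α) 1 z = α * U (-z) := by
  rw [← potSeries_zero hU hK, potSeries, potSeries]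
  refine tsum_congr fun m => ?_
  rw [potFreq_one, wave_neg_left, wave_neg_right]

lemma conj_potSeries (c : ℤ × ℤ → ℂ) (j : Fin 2) (z : ℂ) :
    conj (potSeries K c j z) = potSeries K (fun m => conj (c m)) (j + 1) z := by
  rw [potSeries, potSeries, Complex.conj_tsum]
  refine tsum_congr fun m => ?_
  rw [map_mul, conj_wave]
  fin_cases j <;> simp [potFreq_one]

lemma norm_mul_norm_le_add_tsum {M : Type*} {c g : M → ℂ} {p s t : ℂ} {E : ℝ}
    (hs : Summable fun m => ‖c m‖ * ‖g m‖) (h : p * s + ∑' m, c m * g m = E * t) :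
    ‖p‖ * ‖s‖ ≤ |E| * ‖t‖ + ∑' m, ‖c m‖ * ‖g m‖ := by
  have hs' : Summable fun m => ‖c m * g m‖ := by simpa only [norm_mul] using hs
  rw [← norm_mul, eq_sub_of_add_eq h]
  refine (norm_sub_le _ _).trans (add_le_add ?_ ?_)
  · rw [norm_mul, Complex.norm_real, Real.norm_eq_abs]
  · simpa only [norm_mul] using norm_tsum_le_tsum_norm hs'

lemma exists_weight_pow_mul_le_of_mode (hU : IsSmoothChiralPotential K U) (hK : IsDiracPoint K)
    {α k : ℂ} {E : ℝ} {x y : Ell2 Idx}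
    (h1 : ∀ i, modeFreq K k i * x i + potOp K U α x i = E * y i)
    (h2 : ∀ i, conj (modeFreq K k i) * y i + ContinuousLinearMap.adjoint (potOp K U α) y i =
      E * x i) (s : ℕ) :
    ∃ B, ∀ i : Idx, weight i.1 ^ s * (‖x i‖ + ‖y i‖) ≤ B := by
  obtain ⟨C, hC0, hC⟩ := exists_weight_le_modeFreq K k
  have hs := summable_potSeq hU hK α
  have hB : ∀ (x : Ell2 Idx) i, ‖x i‖ ≤ ‖x‖ := fun x i => lp.norm_apply_le_norm (by simp) x i
  have hsum : ∀ (x : Ell2 Idx) i, Summable fun m => ‖potSeq K U α m‖ * ‖x (shiftIdx m i)‖ :=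
    fun x i => Summable.of_nonneg_of_le (fun m => by positivity)
      (fun m => mul_le_mul_of_nonneg_left (hB x _) (norm_nonneg _)) (hs.mul_right ‖x‖)
  refine exists_forall_pow_mul_le_of_convolution_le (fun i => (weight_pos _).le)
    (fun m => (weight_pos m).le) (fun i => by positivity)
    (fun i => add_le_add (hB x i) (hB y i)) hC0 hC (fun m => norm_nonneg (potSeq K U α m))
    (rapidDecay_potSeq hU hK α).summable_mul weight_le_shiftIdx (abs_nonneg E) (fun i => ?_) s
  have e1 := norm_mul_norm_le_add_tsum (hsum x i) (by rw [← potOp_apply hU hK, h1])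
  have e2 := norm_mul_norm_le_add_tsum (c := fun m => conj (potSeq K U α m))
    (by simpa only [RCLike.norm_conj] using hsum y i) (by rw [← adjoint_potOp_apply hU hK, h2])
  simp only [RCLike.norm_conj] at e2
  simp only [mul_add]
  rw [(hsum x i).tsum_add (hsum y i)]
  linarith

lemma rapidDecay_of_mode (hU : IsSmoothChiralPotential K U) (hK : IsDiracPoint K) {α k : ℂ}
    {E : ℝ} {x y : Ell2 Idx} (h1 : ∀ i, modeFreq K k i * x i + potOp K U α x i = E * y i)
    (h2 : ∀ i, conj (modeFreq K k i) * y i + ContinuousLinearMap.adjoint (potOp K U α) y i =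
      E * x i) (j : Fin 2) :
    RapidDecay (fun n => x (n, j)) ∧ RapidDecay fun n => y (n, j) := by
  constructor <;> intro s <;>
    obtain ⟨B, hB⟩ := exists_weight_pow_mul_le_of_mode hU hK h1 h2 s <;>
    refine ⟨B, fun n => le_trans ?_ (hB (n, j))⟩ <;>
    have := pow_nonneg (weight_pos n).le s
  · exact mul_le_mul_of_nonneg_left (le_add_of_nonneg_right (norm_nonneg _)) this
  · exact mul_le_mul_of_nonneg_left (le_add_of_nonneg_left (norm_nonneg _)) this

end

end ModeSystem

section BlochToMode

lemma AEFloquet.eq_zero_of_coeffVec {K k : ℂ} {f : Fin 2 → ℂ → ℂ} (hL : ∀ j, MemL2loc (f j))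
    (hF : ∀ j, AEFloquet (shiftK K k j) (f j)) (h : coeffVec K k f = 0) (j : Fin 2) :
    f j =ᵐ[volume] 0 :=
  (hF j).eq_zero_of_floquetCoeff (hL j) fun n => congrFun h (n, j)

lemma component_fderiv {u : ℂ → C4} (hu : Differentiable ℝ u) (b : Bool) (j : Fin 2) (z v : ℂ) :
    component b j (fderiv ℝ u z v) = fderiv ℝ (fun z => component b j (u z)) z v := by
  have := ((component b j).hasFDerivAt.comp z (hu z).hasFDerivAt).fderiv
  rw [show (fun z => component b j (u z)) = component b j ∘ u from rfl, this]
  rfl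

lemma continuous_C4_iff {X : Type*} [TopologicalSpace X] {u : X → C4} :
    Continuous u ↔ ∀ b j, Continuous fun x => component b j (u x) := by
  refine ⟨fun h b j => (component b j).continuous.comp h, fun h => ?_⟩
  exact (continuous_pi fun j => h true j).prodMk (continuous_pi fun j => h false j)

lemma differentiable_C4_iff {u : ℂ → C4} :
    Differentiable ℝ u ↔ ∀ b j, Differentiable ℝ fun x => component b j (u x) := by
  refine ⟨fun h b j => (component b j).differentiable.comp h, fun h => ?_⟩
  exact (differentiable_pi.2 fun j => h true j).prodMk (differentiable_pi.2 fun j => h false j)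

lemma ae_eq_zero_C4 {u : ℂ → C4} (h : ∀ b j, (fun x => component b j (u x)) =ᵐ[volume] 0) :
    u =ᵐ[volume] 0 := by
  filter_upwards [h true 0, h true 1, h false 0, h false 1] with z h1 h2 h3 h4
  exact Prod.ext (funext (Fin.forall_fin_two.2 ⟨h1, h2⟩)) (funext (Fin.forall_fin_two.2 ⟨h3, h4⟩))

section

variable {K : ℂ} {U : ℂ → ℂ}

lemma opH_eq_smul_iff_potSeries (hU : IsSmoothChiralPotential K U) (hK : IsDiracPoint K)
    (α z : ℂ) (E : ℝ) (u ux uy : C4) :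
    opH U α z u ux uy = (E : ℂ) • u ↔
      (∀ j, (-Complex.I) * component true j ux + 1 * component true j uy +
        potSeries K (potSeq K U α) j z * component true (j + 1) u = E * component false j u) ∧
      ∀ j, (-Complex.I) * component false j ux + (-1) * component false j uy +
        potSeries K (fun m => conj (potSeq K U α m)) j z * component false (j + 1) u =
          E * component true j u := by
  have q0 := conj_potSeries (K := K) (potSeq K U α) 1 z
  have q1 := conj_potSeries (K := K) (potSeq K U α) 0 z
  rw [potSeries_one hU hK] at q0
  rw [potSeries_zero hU hK] at q1
  simp only [zero_add, show (1 : Fin 2) + 1 = 0 from rfl] at q0 q1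
  rw [opH_eq_iff, q0, q1]
  simp only [Fin.forall_fin_two, zero_add, show (1 : Fin 2) + 1 = 0 from rfl, component_true,
    component_false, potSeries_zero hU hK, potSeries_one hU hK]

lemma MemL2k.aeFloquet_component {k : ℂ} {u : ℂ → C4} (hu : MemL2k K k u) (b : Bool) (j : Fin 2) :
    AEFloquet (shiftK K k j) fun z => component b j (u z) := by
  intro γ hγ
  filter_upwards [hu.floquet γ hγ] with z hz
  exact (transl_eq_smul_iff K k γ u z).1 hz b j

lemma MemH1kWith.integral_diffOp_mul_component {k p q : ℂ} {u ux uy : ℂ → C4}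
    (hu : MemH1kWith K k u ux uy) (b : Bool) (j : Fin 2) {G : ℂ → ℂ}
    (hG : ∀ᵐ z, p * component b j (ux z) + q * component b j (uy z) = G z) {Φ : ℂ → ℂ}
    (hΦ : ContDiff ℝ ∞ Φ) (hc : HasCompactSupport Φ) :
    ∫ z, diffOp p q Φ z * component b j (u z) = -∫ z, Φ z * G z :=
  have hL := hu.memL2k.memL2loc
  integral_diffOp_mul_of_isWeakDeriv (hL.clm_comp _) (hu.memL2loc_x.clm_comp _)
    (hu.memL2loc_y.clm_comp _) (hu.deriv_x.clm_comp hL hu.memL2loc_x _)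
    (hu.deriv_y.clm_comp hL hu.memL2loc_y _) hG hΦ hc

lemma IsBlochEigenvalue.isModeEigenvalue (hU : IsSmoothChiralPotential K U) (hK : IsDiracPoint K)
    {α k : ℂ} {E : ℝ} (h : IsBlochEigenvalue K U α k E) :
    IsModeEigenvalue (modeFreq K k) (potOp K U α) E := by
  obtain ⟨u, ux, uy, hu, hne, he⟩ := h
  let f : Bool → Fin 2 → ℂ → ℂ := fun b j z => component b j (u z)
  have hLf : ∀ b j, MemL2loc (f b j) := fun b j => hu.memL2k.memL2loc.clm_comp _
  have hFf : ∀ b j, AEFloquet (shiftK K k j) (f b j) := hu.memL2k.aeFloquet_component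
  have hs := summable_potSeq hU hK α
  have hs' : Summable fun m => ‖conj (potSeq K U α m)‖ := by simpa using hs
  have he' := he.mono fun z hz => (opH_eq_smul_iff_potSeries hU hK α z E _ _ _).1 hz
  have h1 := coeffVec_solves_of_weak (E := E) (a := -Complex.I) (b := 1) hs (hLf true)
    (hLf false) (hFf true) (hFf false) fun j Φ hΦ hc =>
      hu.integral_diffOp_mul_component true j (by
        filter_upwards [he'] with z hz
        linear_combination hz.1 j) hΦ hc
  have h2 := coeffVec_solves_of_weak (E := E) (a := -Complex.I) (b := -1) hs' (hLf false)
    (hLf true) (hFf false) (hFf true) fun j Φ hΦ hc =>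
      hu.integral_diffOp_mul_component false j (by
        filter_upwards [he'] with z hz
        linear_combination hz.2 j) hΦ hc
  simp only [diffSymbol_dbar] at h1
  simp only [diffSymbol_d] at h2
  refine ⟨⟨_, memℓp_coeffVec (K := K) (k := k) (hLf true)⟩,
    ⟨_, memℓp_coeffVec (K := K) (k := k) (hLf false)⟩, ?_, fun i => ?_, fun i => ?_⟩
  · by_contra! hc
    refine hne (ae_eq_zero_C4 fun b j => AEFloquet.eq_zero_of_coeffVec (hLf b) (hFf b) ?_ j)
    cases b
    · exact congrArg Subtype.val hc.2
    · exact congrArg Subtype.val hc.1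
  · rw [potOp_apply hU hK]
    exact h1 i
  · rw [adjoint_potOp_apply hU hK]
    exact h2 i

end

end BlochToMode

section ModeToBloch

variable {K k : ℂ} {w : Bool → Idx → ℂ}

/-- The `ℂ⁴`-valued Floquet function of quasimomentum `k` whose two `ℂ²`-blocks have the
prescribed Fourier coefficients; `w true` belongs to the first block. -/
def seriesC4 (K k : ℂ) (w : Bool → Idx → ℂ) (z : ℂ) : C4 :=
  (fun j => seriesVec K k (w true) j z, fun j => seriesVec K k (w false) j z)

lemma component_seriesC4 (b : Bool) (j : Fin 2) (z : ℂ) :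
    component b j (seriesC4 K k w z) = seriesVec K k (w b) j z := by
  cases b <;> rfl

lemma differentiable_seriesC4 (hw : ∀ b j, RapidDecay fun n => w b (n, j)) :
    Differentiable ℝ (seriesC4 K k w) := differentiable_C4_iff.2 fun b j => by
  simp only [component_seriesC4]
  exact differentiable_floquetSeries (hw b j) _

lemma component_fderiv_seriesC4 (hw : ∀ b j, RapidDecay fun n => w b (n, j)) (b : Bool) (j : Fin 2)
    (z v : ℂ) :
    component b j (fderiv ℝ (seriesC4 K k w) z v) = fderiv ℝ (seriesVec K k (w b) j) z v := by
  rw [component_fderiv (differentiable_seriesC4 hw)]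
  simp only [component_seriesC4]

lemma memH1kWith_seriesC4 (hw : ∀ b j, RapidDecay fun n => w b (n, j)) :
    MemH1kWith K k (seriesC4 K k w) (fun z => fderiv ℝ (seriesC4 K k w) z 1)
      fun z => fderiv ℝ (seriesC4 K k w) z Complex.I := by
  have hd := differentiable_seriesC4 (K := K) (k := k) hw
  have hd' : ∀ v, Continuous fun z => fderiv ℝ (seriesC4 K k w) z v := fun v =>
    continuous_C4_iff.2 fun b j => by
      simp only [component_fderiv_seriesC4 hw]
      exact continuous_fderiv_floquetSeries (hw b j) _ v
  refine ⟨⟨memL2loc_of_continuous hd.continuous, fun γ hγ => ?_⟩, memL2loc_of_continuous (hd' 1),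
    memL2loc_of_continuous (hd' Complex.I), IsWeakDeriv.of_differentiable hd _ (hd' _),
    IsWeakDeriv.of_differentiable hd _ (hd' _)⟩
  refine Eventually.of_forall fun z => (transl_eq_smul_iff K k γ _ z).2 fun b j => ?_
  rw [component_seriesC4, component_seriesC4]
  exact isFloquet_floquetSeries (shiftK K k j) (fun n => w b (n, j)) γ hγ z

lemma eq_zero_of_seriesC4_ae_eq_zero (hw : ∀ b j, RapidDecay fun n => w b (n, j))
    (h : seriesC4 K k w =ᵐ[volume] 0) (b : Bool) : w b = 0 := by
  rw [← coeffVec_seriesVec (K := K) (k := k) (hw b)]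
  ext i
  have hz : seriesVec K k (w b) i.2 =ᵐ[volume] fun _ => (0 : ℂ) * 0 := by
    filter_upwards [h] with z hz
    rw [← component_seriesC4, hz, Pi.zero_apply, map_zero, mul_zero]
  rw [coeffVec, floquetCoeff_congr_ae hz, floquetCoeff_const_mul, zero_mul, Pi.zero_apply]

lemma IsModeEigenvalue.isBlochEigenvalue {U : ℂ → ℂ} (hU : IsSmoothChiralPotential K U)
    (hK : IsDiracPoint K) {α : ℂ} {E : ℝ}
    (h : IsModeEigenvalue (modeFreq K k) (potOp K U α) E) : IsBlochEigenvalue K U α k E := by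
  obtain ⟨x, y, hne, h1, h2⟩ := h
  have hs := summable_potSeq hU hK α
  have hs' : Summable fun m => ‖conj (potSeq K U α m)‖ := by simpa using hs
  have hx := fun j => (rapidDecay_of_mode hU hK h1 h2 j).1
  have hy := fun j => (rapidDecay_of_mode hU hK h1 h2 j).2
  let w : Bool → Idx → ℂ := fun b => if b then x else y
  have hw : ∀ b j, RapidDecay fun n => w b (n, j) := Bool.forall_bool.2 ⟨hy, hx⟩
  refine ⟨_, _, _, memH1kWith_seriesC4 hw, fun h0 => ?_, Eventually.of_forall fun z =>
    (opH_eq_smul_iff_potSeries hU hK α z E _ _ _).2 ⟨fun j => ?_, fun j => ?_⟩⟩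
  · have hw0 := eq_zero_of_seriesC4_ae_eq_zero hw h0
    exact hne.elim (fun h => h (lp.ext (hw0 true))) fun h => h (lp.ext (hw0 false))
  · simp only [component_fderiv_seriesC4 hw, component_seriesC4]
    exact seriesVec_solves (a := -Complex.I) (b := 1) hs hx hy
      (fun i => by rw [diffSymbol_dbar, ← potOp_apply hU hK, h1]) j z
  · simp only [component_fderiv_seriesC4 hw, component_seriesC4]
    exact seriesVec_solves (a := -Complex.I) (b := -1) hs' hy hx
      (fun i => by rw [diffSymbol_d, ← adjoint_potOp_apply hU hK, h2]) j z

end ModeToBloch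

section BlochEigenvalues

variable {K : ℂ} {U : ℂ → ℂ}

lemma isBlochEigenvalue_iff (hU : IsSmoothChiralPotential K U) (hK : IsDiracPoint K) {α k : ℂ}
    {E : ℝ} :
    IsBlochEigenvalue K U α k E ↔ IsModeEigenvalue (modeFreq K k) (potOp K U α) E :=
  ⟨fun h => h.isModeEigenvalue hU hK, fun h => h.isBlochEigenvalue hU hK⟩

lemma isLeast_E₁ (hU : IsSmoothChiralPotential K U) (hK : IsDiracPoint K) (α k : ℂ) :
    IsLeast {E : ℝ | 0 ≤ E ∧ IsBlochEigenvalue K U α k E} (E₁ K U α k) := by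
  obtain ⟨E, hE⟩ := exists_isLeast_modeEigenvalue (tendsto_norm_modeFreq K k) (potOp K U α)
  simp only [← isBlochEigenvalue_iff hU hK] at hE
  rw [E₁, hE.csInf_eq]
  exact hE

lemma E₁_eq_zero_iff (hU : IsSmoothChiralPotential K U) (hK : IsDiracPoint K) (α k : ℂ) :
    E₁ K U α k = 0 ↔ IsModeEigenvalue (modeFreq K k) (potOp K U α) 0 := by
  have h := isLeast_E₁ hU hK α k
  rw [← isBlochEigenvalue_iff hU hK]
  exact ⟨fun h0 => h0 ▸ h.1.2, fun h0 => le_antisymm (h.2 ⟨le_rfl, h0⟩) h.1.1⟩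

end BlochEigenvalues

section ProtectedState

lemma rotIdx_add (m n : ℤ × ℤ) : rotIdx (m + n) = rotIdx m + rotIdx n := by
  apply freq_injective
  simp only [freq_add, freq_rotIdx]
  ring

lemma rotIdx_sub (m n : ℤ × ℤ) : rotIdx (m - n) = rotIdx m - rotIdx n := by
  apply freq_injective
  simp only [freq_sub, freq_rotIdx]
  ring

lemma rotIdx_zero : rotIdx 0 = 0 := by
  apply freq_injective
  simp only [freq_zero, freq_rotIdx, mul_zero]

/-- The permutation of the frequencies of the sector `k = K` induced by the rotation by `ω`; to be
used with `freq b = 2 (ωK - K)`. -/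
def rotPerm (b : ℤ × ℤ) : Equiv.Perm Idx where
  toFun i := if i.2 = 0 then (rotIdx i.1, 0) else (rotIdx i.1 + b, 1)
  invFun i := if i.2 = 0 then (rotIdx.symm i.1, 0) else (rotIdx.symm (i.1 - b), 1)
  left_inv := by
    rintro ⟨n, j⟩
    fin_cases j <;> simp
  right_inv := by
    rintro ⟨n, j⟩
    fin_cases j <;> simp

/-- The permutation of the frequencies `freq m - 2K` of the potential induced by the rotation, for
the same `b` as in `rotPerm`. -/
def rotPotPerm (b : ℤ × ℤ) : Equiv.Perm (ℤ × ℤ) := rotIdx.trans (Equiv.subRight b)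

lemma shiftIdx_rotPerm (b m : ℤ × ℤ) (i : Idx) :
    shiftIdx (rotPotPerm b m) (rotPerm b i) = rotPerm b (shiftIdx m i) := by
  obtain ⟨n, j⟩ := i
  fin_cases j
  · simp only [shiftIdx_apply, rotPerm, rotPotPerm, rotIdx_sub, Equiv.coe_fn_mk, Fin.zero_eta,
      reduceIte, Equiv.trans_apply, Equiv.subRight_apply, zero_add, one_ne_zero]
    abel_nf
  · simp [shiftIdx_apply, rotPerm, rotPotPerm, rotIdx_add]

section

variable {K : ℂ} {U : ℂ → ℂ}

lemma modeFreq_rotPerm {b : ℤ × ℤ} (hb : freq b = 2 * (ω₃ * K - K)) (i : Idx) :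
    modeFreq K K (rotPerm b i) = ω₃ * modeFreq K K i := by
  obtain ⟨n, j⟩ := i
  fin_cases j
  · simp [modeFreq, rotPerm, shiftK, freq_rotIdx]
  · simp only [modeFreq, rotPerm, shiftK, freq_rotIdx, freq_add, hb, Equiv.coe_fn_mk, Fin.mk_one,
      one_ne_zero, reduceIte]
    ring

lemma potOp_rotPerm (hU : IsSmoothChiralPotential K U) (hK : IsDiracPoint K) (α : ℂ) {b : ℤ × ℤ}
    (hb : freq b = 2 * (ω₃ * K - K)) {x : Ell2 Idx} (hx : ∀ i, x (rotPerm b i) = x i) (i : Idx) :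
    potOp K U α x (rotPerm b i) = ω₃ * potOp K U α x i := by
  rw [potOp_apply hU hK, potOp_apply hU hK, ← (rotPotPerm b).tsum_eq, ← tsum_mul_left]
  refine tsum_congr fun m => ?_
  have h := potCoeff_rot hU hK (τ := rotPotPerm b) (fun m => by
    simp only [rotPotPerm, Equiv.trans_apply, Equiv.subRight_apply, freq_sub, freq_rotIdx, hb]
    ring) m
  rw [shiftIdx_rotPerm, hx, potSeq, potSeq, h]
  ring

lemma rotPerm_zero (b : ℤ × ℤ) : rotPerm b (0, 0) = (0, 0) := by simp [rotPerm, rotIdx_zero]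

/-- The symmetry class of the coefficient vectors on which the rotation acts by `ω`; at `k = K` the
operator `D(α)` maps rotation invariant vectors into it. -/
def rotClass (b : ℤ × ℤ) : Submodule ℂ (Ell2 Idx) where
  carrier := {x | ∀ i, x (rotPerm b i) = ω₃ * x i}
  add_mem' {x y} hx hy i := by simp only [lp.coeFn_add, Pi.add_apply, hx i, hy i, mul_add]
  zero_mem' i := by simp
  smul_mem' c x hx i := by
    simp only [lp.coeFn_smul, Pi.smul_apply, hx i, smul_eq_mul, mul_left_comm]

lemma isClosed_rotClass (b : ℤ × ℤ) : IsClosed (rotClass b : Set (Ell2 Idx)) := by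
  change IsClosed {x : Ell2 Idx | ∀ i, x (rotPerm b i) = ω₃ * x i}
  rw [Set.ofPred_forall]
  exact isClosed_iInter fun i => isClosed_eq
    (lp.evalCLM ℂ (fun _ : Idx => ℂ) 2 (rotPerm b i)).continuous
    (continuous_const.mul (lp.evalCLM ℂ (fun _ : Idx => ℂ) 2 i).continuous)

lemma apply_zero_of_mem_rotClass {b : ℤ × ℤ} {f : Ell2 Idx} (hf : f ∈ rotClass b) :
    f (0, 0) = 0 := by
  have h : f (rotPerm b (0, 0)) = ω₃ * f (0, 0) := hf (0, 0)
  rw [rotPerm_zero] at h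
  have h1 : (1 - ω₃) * f (0, 0) = 0 := by linear_combination h
  exact (mul_eq_zero.1 h1).resolve_left (sub_ne_zero.2 omega_ne_one.symm)

lemma modeFreq_self_eq_zero_iff (hK : IsDiracPoint K) (i : Idx) :
    modeFreq K K i = 0 ↔ i = (0, 0) := by
  obtain ⟨n, j⟩ := i
  fin_cases j
  · simp only [modeFreq, shiftK, Fin.zero_eta, if_true, sub_self, add_zero, Prod.mk.injEq,
      and_true]
    exact ⟨fun h => freq_injective (h.trans freq_zero.symm), fun h => h ▸ freq_zero⟩
  · simp only [modeFreq, shiftK, Fin.mk_one, Prod.mk.injEq, one_ne_zero, if_false, and_false,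
      iff_false]
    intro h
    refine hK.two_mul_notMem ?_
    rw [dualLattice_eq_range]
    exact ⟨-n, by rw [freq_neg]; linear_combination -h⟩

lemma IsDiracPoint.exists_freq_eq (hK : IsDiracPoint K) : ∃ b, freq b = 2 * (ω₃ * K - K) := by
  have h := dualLattice_add hK.rot hK.rot
  rw [dualLattice_eq_range] at h
  obtain ⟨b, hb⟩ := h
  exact ⟨b, hb.trans (two_mul _).symm⟩

lemma exists_kernel_diracPoint (hU : IsSmoothChiralPotential K U) (hK : IsDiracPoint K) (α : ℂ) :
    ∃ x : Ell2 Idx, x ≠ 0 ∧ ∀ i, modeFreq K K i * x i + potOp K U α x i = 0 := by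
  obtain ⟨b, hb⟩ := hK.exists_freq_eq
  have h0 := modeFreq_self_eq_zero_iff hK
  refine exists_kernel_of_symmetry_class (tendsto_norm_modeFreq K K) (potOp K U α) h0
    (isClosed_rotClass b) (fun f hf => apply_zero_of_mem_rotClass hf) (fun e he => ?_)
    fun f hf x hx => ?_
  · refine potOp_rotPerm hU hK α hb fun i => ?_
    by_cases hi : i = (0, 0)
    · rw [hi, rotPerm_zero]
    · have hi' : modeFreq K K i ≠ 0 := fun h => hi ((h0 i).1 h)
      rw [(mul_eq_zero.1 (he i)).resolve_left hi', (mul_eq_zero.1 (he (rotPerm b i))).resolve_left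
        (by rw [modeFreq_rotPerm hb]; exact mul_ne_zero omega_ne_zero hi')]
  · refine potOp_rotPerm hU hK α hb fun i => ?_
    have h : f (rotPerm b i) = ω₃ * f i := hf i
    rw [hx, hx, modeFreq_rotPerm hb, h, mul_inv]
    field_simp [omega_ne_zero]

end

end ProtectedState

section QPochhammer

/-- The infinite `q`-Pochhammer symbol `∏ (1 - qⁿ x)`, the building block of theta functions; the
factors are written as `1 + -(qⁿ x)` to match the library's infinite products. -/
def qPochhammer (q x : ℂ) : ℂ := ∏' n : ℕ, (1 + -(q ^ n * x))

variable {q : ℂ}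

lemma summable_norm_neg_pow_mul (hq : ‖q‖ < 1) (x : ℂ) :
    Summable fun n : ℕ => ‖-(q ^ n * x)‖ := by
  simpa using (summable_geometric_of_lt_one (norm_nonneg _) hq).mul_right ‖x‖

lemma qPochhammer_eq_mul (hq : ‖q‖ < 1) (x : ℂ) :
    qPochhammer q x = (1 - x) * qPochhammer q (q * x) := by
  have h : (fun n : ℕ => 1 + -(q ^ (n + 1) * x)) = fun n => 1 + -(q ^ n * (q * x)) := by
    ext n
    ring
  rw [qPochhammer, tprod_eq_zero_mul', h, qPochhammer]
  · ring
  · rw [h]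
    exact multipliable_one_add_of_summable (summable_norm_neg_pow_mul hq _)

lemma qPochhammer_ne_zero (hq : ‖q‖ < 1) {x : ℂ} (hx : ∀ n : ℕ, q ^ n * x ≠ 1) :
    qPochhammer q x ≠ 0 := by
  refine tprod_one_add_ne_zero_of_summable (fun n h => hx n ?_) (summable_norm_neg_pow_mul hq x)
  linear_combination -h

lemma differentiable_qPochhammer (hq : ‖q‖ < 1) : Differentiable ℂ (qPochhammer q) := by
  intro x
  have hsum : Summable fun n : ℕ => ‖q‖ ^ n * (‖x‖ + 1) :=
    (summable_geometric_of_lt_one (norm_nonneg _) hq).mul_right _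
  have hprod := Summable.hasProdLocallyUniformlyOn_one_add
    (f := fun (n : ℕ) (x : ℂ) => -(q ^ n * x)) (K := Metric.ball 0 (‖x‖ + 1)) Metric.isOpen_ball
    hsum
    (.of_forall fun n y hy => by
      rw [norm_neg, norm_mul, norm_pow]
      exact mul_le_mul_of_nonneg_left (by simpa using (mem_ball_zero_iff.1 hy).le) (by positivity))
    (fun n => by fun_prop)
  exact (hprod.differentiableOn (.of_forall fun _ => by
    simpa [Finset.prod_fn] using DifferentiableOn.finsetProd (fun _ _ => by fun_prop))
    Metric.isOpen_ball).differentiableAt (Metric.isOpen_ball.mem_nhds (by simp))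

end QPochhammer

section Theta

/-- The nome `e^{2πiω}` of the lattice. -/
def nome : ℂ := Complex.exp (2 * Real.pi * Complex.I * ω₃)

lemma norm_nome_lt_one : ‖nome‖ < 1 := by
  have h : (2 * (Real.pi : ℂ) * Complex.I * ω₃).re = -(Real.pi * Real.sqrt 3) := by
    simp only [Complex.mul_re, Complex.mul_im, Complex.re_ofNat, Complex.im_ofNat,
      Complex.ofReal_re, Complex.ofReal_im, Complex.I_re, Complex.I_im, omega_im]
    ring
  rw [nome, Complex.norm_exp, h, Real.exp_lt_one_iff]
  exact neg_neg_of_pos (mul_pos Real.pi_pos sqrt3_pos)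

/-- The variable `e^{2πiz}` in which theta functions are expanded. -/
def qExp (z : ℂ) : ℂ := Complex.exp (2 * Real.pi * Complex.I * z)

lemma qExp_add (z w : ℂ) : qExp (z + w) = qExp z * qExp w := by
  rw [qExp, mul_add, Complex.exp_add]
  rfl

lemma qExp_neg (z : ℂ) : qExp (-z) = (qExp z)⁻¹ := by
  rw [qExp, mul_neg, Complex.exp_neg]
  rfl

lemma qExp_ne_zero (z : ℂ) : qExp z ≠ 0 := Complex.exp_ne_zero _

lemma qExp_zero : qExp 0 = 1 := by simp [qExp]

lemma qExp_one : qExp 1 = 1 := by simp [qExp, Complex.exp_two_pi_mul_I]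

lemma qExp_omega : qExp ω₃ = nome := rfl

lemma exists_int_of_qExp_eq_one {z : ℂ} (h : qExp z = 1) : ∃ n : ℤ, z = n := by
  obtain ⟨n, hn⟩ := Complex.exp_eq_one_iff.1 h
  refine ⟨n, mul_left_cancel₀ Complex.two_pi_I_ne_zero ?_⟩
  linear_combination hn

lemma exists_qExp_eq {w : ℂ} (hw : w ≠ 0) : ∃ z, qExp z = w :=
  ⟨(2 * Real.pi * Complex.I)⁻¹ * Complex.log w, by
    rw [qExp, mul_inv_cancel_left₀ Complex.two_pi_I_ne_zero, Complex.exp_log hw]⟩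

lemma nome_pow_mul_qExp (n : ℕ) (z : ℂ) : nome ^ n * qExp z = qExp (n * ω₃ + z) := by
  rw [qExp_add, nome, ← Complex.exp_nat_mul, qExp, qExp]
  ring_nf

lemma differentiable_qExp : Differentiable ℂ qExp := by
  unfold qExp
  fun_prop

lemma hasDerivAt_qExp_zero : HasDerivAt qExp (2 * Real.pi * Complex.I) 0 := by
  unfold qExp
  simpa using ((hasDerivAt_id (0 : ℂ)).const_mul (2 * Real.pi * Complex.I)).cexp

/-- The theta function of the lattice, in product form. -/
def theta (z : ℂ) : ℂ := qPochhammer nome (qExp z) * qPochhammer nome (nome * qExp (-z))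

/-- The theta function without the factor vanishing at the origin. -/
def thetaRed (z : ℂ) : ℂ := qPochhammer nome (nome * qExp z) * qPochhammer nome (nome * qExp (-z))

lemma theta_eq_mul_thetaRed (z : ℂ) : theta z = (1 - qExp z) * thetaRed z := by
  rw [theta, thetaRed, qPochhammer_eq_mul norm_nome_lt_one (qExp z)]
  ring

lemma theta_zero : theta 0 = 0 := by
  rw [theta_eq_mul_thetaRed, qExp_zero, sub_self, zero_mul]

lemma differentiable_theta : Differentiable ℂ theta := by
  have h1 := differentiable_qPochhammer norm_nome_lt_one
  have h2 := differentiable_qExp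
  unfold theta
  fun_prop

lemma differentiable_thetaRed : Differentiable ℂ thetaRed := by
  have h1 := differentiable_qPochhammer norm_nome_lt_one
  have h2 := differentiable_qExp
  unfold thetaRed
  fun_prop

lemma thetaRed_zero_ne_zero : thetaRed 0 ≠ 0 := by
  have h : qPochhammer nome nome ≠ 0 := qPochhammer_ne_zero norm_nome_lt_one fun n h => by
    have h1 := congrArg norm h
    rw [← pow_succ, norm_pow, norm_one] at h1
    exact (pow_lt_one₀ (norm_nonneg _) norm_nome_lt_one (Nat.succ_ne_zero n)).ne h1
  simpa [thetaRed, qExp_zero] using h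

lemma theta_add_one (z : ℂ) : theta (z + 1) = theta z := by
  rw [theta, theta, neg_add, qExp_add, qExp_add, qExp_neg 1, qExp_one, inv_one, mul_one, mul_one]

lemma theta_add_omega (z : ℂ) : theta (z + ω₃) = -qExp (-z) * theta z := by
  have hz := qExp_ne_zero z
  have hn : nome ≠ 0 := Complex.exp_ne_zero _
  have e1 : qExp (z + ω₃) = nome * qExp z := by rw [qExp_add, qExp_omega, mul_comm]
  have e2 : nome * qExp (-(z + ω₃)) = qExp (-z) := by
    rw [neg_add, qExp_add, qExp_neg ω₃, qExp_omega]
    field_simp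
  rw [theta, theta, e1, e2, qPochhammer_eq_mul norm_nome_lt_one (qExp (-z)),
    qPochhammer_eq_mul norm_nome_lt_one (qExp z), qExp_neg]
  field_simp
  ring

lemma mem_lattice_of_theta_eq_zero {z : ℂ} (h : theta z = 0) : z ∈ lattice := by
  by_contra hz
  refine mul_ne_zero (qPochhammer_ne_zero norm_nome_lt_one fun n hn => hz ?_)
    (qPochhammer_ne_zero norm_nome_lt_one fun n hn => hz ?_) h
  · rw [nome_pow_mul_qExp] at hn
    obtain ⟨m, hm⟩ := exists_int_of_qExp_eq_one hn
    exact ⟨-n, m, by push_cast; linear_combination hm⟩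
  · rw [← mul_assoc, ← pow_succ, nome_pow_mul_qExp] at hn
    obtain ⟨m, hm⟩ := exists_int_of_qExp_eq_one hn
    exact ⟨n + 1, -m, by push_cast at hm ⊢; linear_combination -hm⟩

lemma lattice_eq_closure : lattice = AddSubgroup.closure {ω₃, 1} := by
  ext γ
  rw [SetLike.mem_coe, AddSubgroup.mem_closure_pair]
  exact exists₂_congr fun m n => by simp [eq_comm]

lemma lattice_add_mem {a b : ℂ} (ha : a ∈ lattice) (hb : b ∈ lattice) : a + b ∈ lattice := by
  rw [lattice_eq_closure] at *
  exact add_mem ha hb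

lemma lattice_neg_mem {a : ℂ} (ha : a ∈ lattice) : -a ∈ lattice := by
  rw [lattice_eq_closure] at *
  exact neg_mem ha

lemma lattice_induction {P : ℂ → Prop} (hone : P 1) (homega : P ω₃)
    (hadd : ∀ a b, P a → P b → P (a + b)) (hneg : ∀ a, P a → P (-a)) {γ : ℂ}
    (hγ : γ ∈ lattice) : P γ := by
  rw [lattice_eq_closure] at hγ
  refine AddSubgroup.closure_induction ?_ ?_ (fun a b _ _ => hadd a b) (fun a _ => hneg a) hγ
  · rintro x (rfl | rfl)
    exacts [homega, hone]
  · simpa using hadd _ _ hone (hneg _ hone)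

lemma theta_eq_zero_iff (z : ℂ) : theta z = 0 ↔ z ∈ lattice := by
  refine ⟨mem_lattice_of_theta_eq_zero, fun hz => ?_⟩
  have h : ∀ w, theta (w + z) = 0 ↔ theta w = 0 := by
    refine lattice_induction (P := fun γ => ∀ w, theta (w + γ) = 0 ↔ theta w = 0) (fun w => ?_)
      (fun w => ?_) (fun a b ha hb w => ?_) (fun a ha w => ?_) hz
    · rw [theta_add_one]
    · simp [theta_add_omega, qExp_ne_zero]
    · rw [← add_assoc, hb, ha]
    · rw [← ha (w + -a), neg_add_cancel_right]
  simpa using (h 0).2 theta_zero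

lemma isClosed_lattice : IsClosed lattice := by
  have h : lattice = theta ⁻¹' {0} := by
    ext z
    exact (theta_eq_zero_iff z).symm
  rw [h]
  exact isClosed_singleton.preimage differentiable_theta.continuous

lemma countable_lattice : lattice.Countable := by
  refine (Set.countable_range fun n : ℤ × ℤ => (n.1 : ℂ) * ω₃ + n.2).mono ?_
  rintro _ ⟨m, n, rfl⟩
  exact ⟨(m, n), rfl⟩

end Theta

section FloquetMultipliers

lemma IsFloquet.of_generators {p : ℂ} {f : ℂ → ℂ} (h1 : ∀ z, f (z + 1) = wave p 1 * f z)
    (hω : ∀ z, f (z + ω₃) = wave p ω₃ * f z) : IsFloquet p f := fun γ hγ => by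
  refine lattice_induction (P := fun γ => ∀ z, f (z + γ) = wave p γ * f z) h1 hω
    (fun a b ha hb w => ?_) (fun a ha w => ?_) hγ
  · rw [← add_assoc, hb, ha, wave_add_right]
    ring
  · have h := ha (w + -a)
    rw [neg_add_cancel_right] at h
    rw [h, wave_neg_right, inv_mul_cancel_left₀ (wave_ne_zero p a)]

/-- A meromorphic function of quasimomentum `p`, not identically zero, whose only poles are simple
and lie on the lattice: multiplication by it shifts the quasimomentum of solutions of the Floquet
system vanishing on the lattice. The values at the poles are junk. -/
structure IsFloquetMultiplier (p : ℂ) (F : ℂ → ℂ) : Prop where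
  floquet : IsFloquet p F
  differentiableAt : ∀ z ∉ lattice, DifferentiableAt ℂ F z
  exists_tendsto : ∃ L, Tendsto (fun z => z * F z) (𝓝[≠] 0) (𝓝 L)
  countable_zeros : {z | F z = 0}.Countable

/-- The quotient `e^{az} θ(z - c) / θ(z)`, with which the Floquet multipliers are realised. -/
def thetaQuot (a c z : ℂ) : ℂ := Complex.exp (a * z) * theta (z - c) / theta z

lemma thetaQuot_add_one (a c z : ℂ) : thetaQuot a c (z + 1) = Complex.exp a * thetaQuot a c z := by
  rw [thetaQuot, thetaQuot, theta_add_one, add_sub_right_comm, theta_add_one, mul_add,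
    Complex.exp_add, mul_one]
  ring

lemma thetaQuot_add_omega (a c z : ℂ) :
    thetaQuot a c (z + ω₃) = Complex.exp (a * ω₃) * qExp c * thetaQuot a c z := by
  have h : qExp (-(z - c)) = qExp (-z) * qExp c := by
    rw [← qExp_add]
    ring_nf
  have hnum : Complex.exp (a * z) * Complex.exp (a * ω₃) *
      (-(qExp (-z) * qExp c) * theta (z - c)) =
        -qExp (-z) * (Complex.exp (a * ω₃) * qExp c * (Complex.exp (a * z) * theta (z - c))) := by
    ring
  rw [thetaQuot, thetaQuot, theta_add_omega, add_sub_right_comm, theta_add_omega, mul_add,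
    Complex.exp_add, h, hnum, mul_div_mul_left _ _ (neg_ne_zero.2 (qExp_ne_zero _)), mul_div_assoc]

lemma differentiableAt_thetaQuot (a c : ℂ) {z : ℂ} (hz : z ∉ lattice) :
    DifferentiableAt ℂ (thetaQuot a c) z := by
  have h := differentiable_theta
  exact DifferentiableAt.div (by fun_prop) (h z) (mt (theta_eq_zero_iff z).1 hz)

lemma exists_tendsto_mul_thetaQuot (a c : ℂ) :
    ∃ L, Tendsto (fun z => z * thetaQuot a c z) (𝓝[≠] 0) (𝓝 L) := by
  have hslope := (hasDerivAt_qExp_zero.const_sub 1).tendsto_slope.inv₀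
    (neg_ne_zero.2 Complex.two_pi_I_ne_zero)
  have hcont : ContinuousAt (fun z => Complex.exp (a * z) * theta (z - c) / thetaRed z) 0 := by
    have h := differentiable_theta
    exact ContinuousAt.div (Differentiable.continuous (𝕜 := ℂ) (by fun_prop)).continuousAt
      differentiable_thetaRed.continuous.continuousAt thetaRed_zero_ne_zero
  refine ⟨_, (hslope.mul (hcont.tendsto.mono_left nhdsWithin_le_nhds)).congr fun z => ?_⟩
  simp only [thetaQuot, slope, vsub_eq_sub, smul_eq_mul, theta_eq_mul_thetaRed z, sub_zero,
    qExp_zero, sub_self, mul_inv, inv_inv, div_eq_mul_inv]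
  ring

lemma countable_zeros_thetaQuot (a c : ℂ) : {z | thetaQuot a c z = 0}.Countable := by
  refine (countable_lattice.union (countable_lattice.image fun w => w + c)).mono fun z hz => ?_
  rcases div_eq_zero_iff.1 hz with h | h
  · exact Or.inr ⟨z - c, (theta_eq_zero_iff _).1
      ((mul_eq_zero.1 h).resolve_left (Complex.exp_ne_zero _)), sub_add_cancel z c⟩
  · exact Or.inl ((theta_eq_zero_iff z).1 h)

lemma exists_isFloquetMultiplier (p : ℂ) : ∃ F, IsFloquetMultiplier p F := by
  have ha : Complex.exp (Complex.I * pair p 1) = wave p 1 := rfl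
  set a : ℂ := Complex.I * pair p 1
  obtain ⟨c, hc⟩ := exists_qExp_eq
    (mul_ne_zero (wave_ne_zero p ω₃) (Complex.exp_ne_zero (-(a * ω₃))))
  have hω : Complex.exp (a * ω₃) * qExp c = wave p ω₃ := by
    rw [hc, mul_left_comm, ← Complex.exp_add, add_neg_cancel, Complex.exp_zero, mul_one]
  exact ⟨thetaQuot a c, IsFloquet.of_generators (fun z => by rw [thetaQuot_add_one, ha])
    fun z => by rw [thetaQuot_add_omega, hω], fun z => differentiableAt_thetaQuot a c,
    exists_tendsto_mul_thetaQuot a c, countable_zeros_thetaQuot a c⟩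

end FloquetMultipliers

section Liouville

lemma exists_latPt_add_mem_lattice (z : ℂ) :
    ∃ γ ∈ lattice, ∃ x ∈ Set.Icc (0 : ℝ) 1 ×ˢ Set.Icc (0 : ℝ) 1, z = latPt x + γ := by
  obtain ⟨y, rfl⟩ := latEquiv.surjective z
  refine ⟨latPt (⌊y.1⌋, ⌊y.2⌋), latPt_int_mem _ _, (Int.fract y.1, Int.fract y.2),
    ⟨⟨Int.fract_nonneg _, (Int.fract_lt_one _).le⟩, ⟨Int.fract_nonneg _, (Int.fract_lt_one _).le⟩⟩,
    ?_⟩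
  rw [← latPt_add, Prod.mk_add_mk, Int.fract_add_floor, Int.fract_add_floor]
  rfl

lemma IsFloquet.exists_norm_le {p : ℂ} {f : ℂ → ℂ} (hF : IsFloquet p f) (hf : Continuous f) :
    ∃ C, ∀ z, ‖f z‖ ≤ C := by
  obtain ⟨C, hC⟩ := (isCompact_Icc.prod isCompact_Icc).exists_bound_of_continuousOn
    (hf.comp continuous_latPt).continuousOn (s := Set.Icc (0 : ℝ) 1 ×ˢ Set.Icc (0 : ℝ) 1)
  refine ⟨C, fun z => ?_⟩
  obtain ⟨γ, hγ, x, hx, rfl⟩ := exists_latPt_add_mem_lattice z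
  rw [hF γ hγ, norm_mul, norm_wave, one_mul]
  exact hC x hx

lemma IsFloquet.eq_zero_of_entire {p : ℂ} {f : ℂ → ℂ} (hF : IsFloquet p f)
    (hf : Differentiable ℂ f) (hp : p ∉ dualLattice) (z : ℂ) : f z = 0 := by
  obtain ⟨C, hC⟩ := hF.exists_norm_le hf.continuous
  have hb : Bornology.IsBounded (Set.range f) :=
    isBounded_iff_forall_norm_le.2 ⟨C, Set.forall_mem_range.2 hC⟩
  by_contra hz
  have hwave : ∀ γ ∈ lattice, wave p γ = 1 := fun γ hγ =>
    mul_right_cancel₀ hz (by rw [← hF γ hγ, hf.apply_eq_apply_of_bounded hb (z + γ) z, one_mul])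
  exact hp (mem_dualLattice_of_wave_eq_one (hwave _ one_mem_lattice) (hwave _ omega_mem_lattice))

end Liouville

section KernelStates

/-- A classical nonzero solution of `D u = 0` of quasimomentum `k`, where the potential has the
Fourier coefficients `c`. -/
structure IsKernelState (K : ℂ) (c : ℤ × ℤ → ℂ) (k : ℂ) (u : Fin 2 → ℂ → ℂ) : Prop where
  differentiable : ∀ j, Differentiable ℝ (u j)
  floquet : ∀ j, IsFloquet (shiftK K k j) (u j)
  eq_zero : ∀ j z, diffOp (-Complex.I) 1 (u j) z + potSeries K c j z * u (j + 1) z = 0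
  exists_ne : ∃ j z, u j z ≠ 0

lemma differentiableAt_complex_of_diffOp {f : ℂ → ℂ} {z : ℂ} (hf : DifferentiableAt ℝ f z)
    (h : diffOp (-Complex.I) 1 f z = 0) : DifferentiableAt ℂ f z := by
  refine differentiableAt_complex_iff_differentiableAt_real.2 ⟨hf, ?_⟩
  rw [diffOp] at h
  rw [smul_eq_mul]
  linear_combination h

lemma diffOp_of_differentiableAt_complex {f : ℂ → ℂ} {z : ℂ} (hf : DifferentiableAt ℂ f z) :
    diffOp (-Complex.I) 1 f z = 0 := by
  have h := (differentiableAt_complex_iff_differentiableAt_real.1 hf).2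
  rw [diffOp, h, smul_eq_mul]
  ring

lemma diffOp_congr {a b : ℂ} {f g : ℂ → ℂ} {z : ℂ} (h : f =ᶠ[𝓝 z] g) :
    diffOp a b f z = diffOp a b g z := by
  rw [diffOp, diffOp, h.fderiv_eq]

lemma diffOp_sub (a b : ℂ) {f g : ℂ → ℂ} {z : ℂ} (hf : DifferentiableAt ℝ f z)
    (hg : DifferentiableAt ℝ g z) :
    diffOp a b (fun w => f w - g w) z = diffOp a b f z - diffOp a b g z := by
  rw [diffOp, diffOp, diffOp, fderiv_fun_sub hf hg, sub_apply, sub_apply]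
  ring

end KernelStates

section Wronskian

variable {K k : ℂ} {c : ℤ × ℤ → ℂ} {u v : Fin 2 → ℂ → ℂ}

lemma IsKernelState.isFloquet_wronskian (hu : IsKernelState K c k u) (hv : IsKernelState K c K v) :
    IsFloquet (k + K) fun z => u 0 z * v 1 z - u 1 z * v 0 z := by
  intro γ hγ z
  have h1 := ((hu.floquet 0).mul (hv.floquet 1)) γ hγ z
  have h2 := ((hu.floquet 1).mul (hv.floquet 0)) γ hγ z
  have e1 : shiftK K k 0 + shiftK K K 1 = k + K := by
    simp only [shiftK, reduceIte, one_ne_zero]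
    ring
  have e2 : shiftK K k 1 + shiftK K K 0 = k + K := by
    simp only [shiftK, reduceIte, one_ne_zero]
    ring
  rw [e1] at h1
  rw [e2] at h2
  linear_combination h1 - h2

lemma IsKernelState.differentiable_wronskian (hu : IsKernelState K c k u)
    (hv : IsKernelState K c K v) : Differentiable ℂ fun z => u 0 z * v 1 z - u 1 z * v 0 z := by
  intro z
  have d₁ : DifferentiableAt ℝ (fun z => u 0 z * v 1 z) z :=
    (hu.differentiable 0 z).mul (hv.differentiable 1 z)
  have d₂ : DifferentiableAt ℝ (fun z => u 1 z * v 0 z) z :=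
    (hu.differentiable 1 z).mul (hv.differentiable 0 z)
  refine differentiableAt_complex_of_diffOp (d₁.sub d₂) ?_
  rw [diffOp_sub _ _ d₁ d₂, diffOp_mul _ _ (hu.differentiable 0 z) (hv.differentiable 1 z),
    diffOp_mul _ _ (hu.differentiable 1 z) (hv.differentiable 0 z)]
  have hu₀ := hu.eq_zero 0 z
  have hu₁ := hu.eq_zero 1 z
  have hv₀ := hv.eq_zero 0 z
  have hv₁ := hv.eq_zero 1 z
  simp only [zero_add, show (1 : Fin 2) + 1 = 0 from rfl] at hu₀ hu₁ hv₀ hv₁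
  linear_combination v 1 z * hu₀ - v 0 z * hu₁ - u 1 z * hv₀ + u 0 z * hv₁

lemma IsKernelState.wronskian_eq_zero (hu : IsKernelState K c k u) (hv : IsKernelState K c K v)
    (hk : k + K ∉ dualLattice) (z : ℂ) : u 0 z * v 1 z = u 1 z * v 0 z :=
  sub_eq_zero.1 <|
    (hu.isFloquet_wronskian hv).eq_zero_of_entire (hu.differentiable_wronskian hv) hk z

lemma exists_differentiable_eq_mul (hu : ∀ j, Differentiable ℝ (u j))
    (hv : ∀ j, Differentiable ℝ (v j)) (hne : ∀ z, ∃ j, u j z ≠ 0)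
    (hW : ∀ z, u 0 z * v 1 z = u 1 z * v 0 z) :
    ∃ f : ℂ → ℂ, Differentiable ℝ f ∧ ∀ j z, v j z = f z * u j z := by
  have hconj : ∀ j, Differentiable ℝ fun z => conj (u j z) := fun j =>
    Complex.conjCLE.differentiable.comp (hu j)
  have hden : ∀ z, conj (u 0 z) * u 0 z + conj (u 1 z) * u 1 z ≠ 0 := by
    intro z h
    rw [← Complex.normSq_eq_conj_mul_self, ← Complex.normSq_eq_conj_mul_self] at h
    norm_cast at h
    rw [add_eq_zero_iff_of_nonneg (Complex.normSq_nonneg _) (Complex.normSq_nonneg _),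
      map_eq_zero, map_eq_zero] at h
    obtain ⟨j, hj⟩ := hne z
    fin_cases j
    exacts [hj h.1, hj h.2]
  refine ⟨fun z => (conj (u 0 z) * v 0 z + conj (u 1 z) * v 1 z) *
    (conj (u 0 z) * u 0 z + conj (u 1 z) * u 1 z)⁻¹, ?_, fun j z => ?_⟩
  · exact (((hconj 0).mul (hv 0)).add ((hconj 1).mul (hv 1))).mul
      ((((hconj 0).mul (hu 0)).add ((hconj 1).mul (hu 1))).fun_inv hden)
  · rw [mul_right_comm, ← div_eq_mul_inv, eq_div_iff (hden z)]
    fin_cases j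
    · change v 0 z * _ = _ * u 0 z
      linear_combination -conj (u 1 z) * hW z
    · change v 1 z * _ = _ * u 1 z
      linear_combination conj (u 0 z) * hW z

lemma IsKernelState.exists_zero (hu : IsKernelState K c k u) (hv : IsKernelState K c K v)
    (h1 : k + K ∉ dualLattice) (h2 : K - k ∉ dualLattice) : ∃ z, ∀ j, u j z = 0 := by
  by_contra! hne
  obtain ⟨f, hf, hvf⟩ := exists_differentiable_eq_mul hu.differentiable hv.differentiable hne
    (hu.wronskian_eq_zero hv h1)
  have hfF : IsFloquet (K - k) f := by
    intro γ hγ z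
    obtain ⟨j, hj⟩ := hne z
    have hw := mul_ne_zero (wave_ne_zero (shiftK K k j) γ) hj
    have e : shiftK K K j = (K - k) + shiftK K k j := by
      simp only [shiftK]
      split_ifs <;> ring
    have h := hv.floquet j γ hγ z
    rw [hvf, hvf j z, hu.floquet j γ hγ, e, wave_add_left] at h
    exact mul_right_cancel₀ hw (by linear_combination h)
  have hfd : Differentiable ℂ f := by
    intro z
    obtain ⟨j, hj⟩ := hne z
    have hmul := diffOp_mul (-Complex.I) 1 (hf z) (hu.differentiable j z)
    rw [← funext (hvf j)] at hmul
    have hvj := hv.eq_zero j z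
    rw [hvf (j + 1)] at hvj
    refine differentiableAt_complex_of_diffOp (hf z) ((mul_eq_zero.1 ?_).resolve_right hj)
    linear_combination hvj - f z * hu.eq_zero j z - hmul
  obtain ⟨j, z, hz⟩ := hv.exists_ne
  exact hz (by rw [hvf, hfF.eq_zero_of_entire hfd h2, zero_mul])

end Wronskian

section PoleCancellation

lemma dense_sub_notMem_lattice (z₀ : ℂ) : Dense {z | z - z₀ ∉ lattice} := by
  have h : {z | z - z₀ ∈ lattice} = (fun w => w + z₀) '' lattice := by
    ext z
    exact ⟨fun h => ⟨z - z₀, h, sub_add_cancel z z₀⟩, by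
      rintro ⟨w, hw, rfl⟩
      rwa [Set.mem_ofPred_eq, add_sub_cancel_right]⟩
  exact (h ▸ countable_lattice.image _ : {z | z - z₀ ∈ lattice}.Countable).dense_compl ℝ

lemma isOpen_sub_notMem_lattice (z₀ : ℂ) : IsOpen {z | z - z₀ ∉ lattice} :=
  isClosed_lattice.isOpen_compl.preimage (continuous_id.sub continuous_const)

lemma add_sub_notMem_lattice_iff {γ : ℂ} (hγ : γ ∈ lattice) (z z₀ : ℂ) :
    z + γ - z₀ ∉ lattice ↔ z - z₀ ∉ lattice := by
  refine not_congr ⟨fun h => ?_, fun h => ?_⟩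
  · convert lattice_add_mem h (lattice_neg_mem hγ) using 1
    ring
  · convert lattice_add_mem h hγ using 1
    ring

lemma tendsto_sub_nhdsWithin {a w : ℂ} {s t : Set ℂ} (h : ∀ z ∈ s, z - a ∈ t) :
    Tendsto (fun z => z - a) (𝓝[s] w) (𝓝[t] (w - a)) :=
  (continuous_id.sub continuous_const).continuousWithinAt.tendsto_nhdsWithin h

lemma IsFloquet.exists_continuous_extension {p z₀ : ℂ} {h : ℂ → ℂ} (hF : IsFloquet p h)
    (hc : ∀ z, z - z₀ ∉ lattice → ContinuousAt h z)
    (hlim : ∃ y, Tendsto h (𝓝[{z | z - z₀ ∉ lattice}] z₀) (𝓝 y)) :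
    ∃ g : ℂ → ℂ, Continuous g ∧ IsFloquet p g ∧ ∀ z, z - z₀ ∉ lattice → g z = h z := by
  set A : Set ℂ := {z | z - z₀ ∉ lattice}
  have hA : Dense A := dense_sub_notMem_lattice z₀
  have hlim' : ∀ z, ∃ y, Tendsto h (𝓝[A] z) (𝓝 y) := by
    intro z
    by_cases hz : z ∈ A
    · exact ⟨_, (hc z hz).tendsto.mono_left nhdsWithin_le_nhds⟩
    · obtain ⟨y, hy⟩ := hlim
      have hγ : z - z₀ ∈ lattice := not_not.1 hz
      have hsub := tendsto_sub_nhdsWithin (a := z - z₀) (w := z) (s := A) (t := A) fun w hw => by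
        rw [sub_eq_add_neg]
        exact (add_sub_notMem_lattice_iff (lattice_neg_mem hγ) w z₀).2 hw
      rw [sub_sub_cancel] at hsub
      refine ⟨_, ((hy.comp hsub).const_mul (wave p (z - z₀))).congr fun w => ?_⟩
      rw [Function.comp_apply, ← hF _ hγ, sub_add_cancel]
  have hg := continuous_extendFrom hA hlim'
  have heq : ∀ z ∈ A, extendFrom A h z = h z := fun z hz =>
    extendFrom_extends (fun z hz => (hc z hz).continuousWithinAt) z hz
  refine ⟨extendFrom A h, hg, fun γ hγ => ?_, heq⟩
  refine congrFun (Continuous.ext_on hA (hg.comp (continuous_id.add continuous_const))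
    (continuous_const.mul hg) fun z hz => ?_)
  rw [heq z hz, heq _ ((add_sub_notMem_lattice_iff hγ z z₀).2 hz), hF γ hγ]

lemma exists_tendsto_mul_of_simple_pole {z₀ : ℂ} {F f : ℂ → ℂ}
    (hF : ∃ L, Tendsto (fun z => z * F z) (𝓝[≠] 0) (𝓝 L)) (hf : DifferentiableAt ℂ f z₀)
    (h0 : f z₀ = 0) : ∃ y, Tendsto (fun z => F (z - z₀) * f z) (𝓝[≠] z₀) (𝓝 y) := by
  obtain ⟨L, hL⟩ := hF
  have hsub := tendsto_sub_nhdsWithin (a := z₀) (w := z₀) (s := {z₀}ᶜ) (t := {0}ᶜ)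
    fun z hz => sub_ne_zero.2 hz
  rw [sub_self] at hsub
  refine ⟨_, ((hL.comp hsub).mul hf.hasDerivAt.tendsto_slope).congr' ?_⟩
  filter_upwards [self_mem_nhdsWithin] with z hz
  have hz' : z - z₀ ≠ 0 := sub_ne_zero.2 hz
  simp only [Function.comp_apply, slope, vsub_eq_sub, smul_eq_mul, h0, sub_zero]
  field_simp

variable {K k p z₀ : ℂ} {c : ℤ × ℤ → ℂ} {F : ℂ → ℂ} {u : Fin 2 → ℂ → ℂ}

lemma IsFloquetMultiplier.differentiableAt_sub (hF : IsFloquetMultiplier p F) {z : ℂ}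
    (hz : z - z₀ ∉ lattice) : DifferentiableAt ℂ (fun w => F (w - z₀)) z :=
  DifferentiableAt.comp (g := F) z (hF.differentiableAt _ hz) (by fun_prop)

lemma IsFloquetMultiplier.exists_continuous_mul (hF : IsFloquetMultiplier p F) {q : ℂ} {f : ℂ → ℂ}
    (hfF : IsFloquet q f) (hfd : Differentiable ℝ f) (h0 : f z₀ = 0)
    (h1 : diffOp (-Complex.I) 1 f z₀ = 0) :
    ∃ g : ℂ → ℂ, Continuous g ∧ IsFloquet (p + q) g ∧
      ∀ z, z - z₀ ∉ lattice → g z = F (z - z₀) * f z := by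
  refine IsFloquet.exists_continuous_extension (fun γ hγ z => ?_) (fun z hz => ?_) ?_
  · simp only [add_sub_right_comm z γ z₀, hF.floquet γ hγ, hfF γ hγ, wave_add_left]
    ring
  · exact (hF.differentiableAt_sub hz).continuousAt.mul (hfd z).continuousAt
  · obtain ⟨y, hy⟩ := exists_tendsto_mul_of_simple_pole hF.exists_tendsto
      (differentiableAt_complex_of_diffOp (hfd z₀) h1) h0
    refine ⟨y, hy.mono_left (nhdsWithin_mono _ fun z hz hz₀ => hz ?_)⟩
    rw [hz₀, sub_self]
    exact ⟨0, 0, by simp⟩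

lemma IsFloquetMultiplier.eq_zero_of_mul_eq_zero (hF : IsFloquetMultiplier p F) {f : ℂ → ℂ}
    (hf : Continuous f) (h : ∀ z, z - z₀ ∉ lattice → F (z - z₀) * f z = 0) (z : ℂ) : f z = 0 := by
  have hcount : ((fun w => w + z₀) '' (lattice ∪ {z | F z = 0})).Countable :=
    (countable_lattice.union hF.countable_zeros).image _
  have hzero : f = fun _ => 0 := by
    refine Continuous.ext_on (hcount.dense_compl ℝ) hf continuous_const fun w hw => ?_
    have hw' : w - z₀ ∉ lattice ∪ {z | F z = 0} := fun hm => hw ⟨w - z₀, hm, sub_add_cancel w z₀⟩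
    rw [Set.mem_union, not_or] at hw'
    exact (mul_eq_zero.1 (h w hw'.1)).resolve_left hw'.2
  exact congrFun hzero z

lemma IsKernelState.coeffVec_solves (hc : Summable fun m => ‖c m‖) (hu : IsKernelState K c k u)
    {k' : ℂ} (hF : IsFloquetMultiplier p F) {g : Fin 2 → ℂ → ℂ} (hg : ∀ j, Continuous (g j))
    (hgF : ∀ j, IsFloquet (shiftK K k' j) (g j))
    (hgu : ∀ j z, z - z₀ ∉ lattice → g j z = F (z - z₀) * u j z) (i : Idx) :
    modeFreq K k' i * coeffVec K k' g i + ∑' m, c m * coeffVec K k' g (shiftIdx m i) = 0 := by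
  have hev : ∀ j z, z - z₀ ∉ lattice → g j =ᶠ[𝓝 z] fun w => F (w - z₀) * u j w := fun j z hz =>
    mem_of_superset ((isOpen_sub_notMem_lattice z₀).mem_nhds hz) (hgu j)
  have hd : ∀ z, z - z₀ ∉ lattice → DifferentiableAt ℝ (fun w => F (w - z₀)) z := fun z hz =>
    (hF.differentiableAt_sub hz).restrictScalars ℝ
  have hs : ((fun w => w + z₀) '' lattice).Countable := countable_lattice.image _
  have hnot : ∀ z ∉ (fun w => w + z₀) '' lattice, z - z₀ ∉ lattice := fun z hz h =>
    hz ⟨z - z₀, h, sub_add_cancel z z₀⟩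
  rw [← diffSymbol_dbar (modeFreq K k' i)]
  refine coeffVec_solves_of_off_countable hc hg hgF hs (fun j z hz => ?_) (fun j z hz => ?_) i
  · exact ((hd z (hnot z hz)).mul (hu.differentiable j z)).congr_of_eventuallyEq
      (hev j z (hnot z hz))
  · rw [diffOp_congr (hev j z (hnot z hz)),
      diffOp_mul _ _ (hd z (hnot z hz)) (hu.differentiable j z),
      diffOp_of_differentiableAt_complex (hF.differentiableAt_sub (hnot z hz)),
      hgu _ z (hnot z hz)]
    linear_combination F (z - z₀) * hu.eq_zero j z

lemma IsKernelState.exists_kernel (hc : Summable fun m => ‖c m‖) (hu : IsKernelState K c k u)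
    (h0 : ∀ j, u j z₀ = 0) (k' : ℂ) :
    ∃ x : Ell2 Idx, x ≠ 0 ∧
      ∀ i, modeFreq K k' i * x i + ∑' m, c m * x (shiftIdx m i) = 0 := by
  obtain ⟨F, hF⟩ := exists_isFloquetMultiplier (k' - k)
  choose g hg hgF hgu using fun j => hF.exists_continuous_mul (hu.floquet j) (hu.differentiable j)
    (h0 j) (by simpa [h0] using hu.eq_zero j z₀)
  have hshift : ∀ j, k' - k + shiftK K k j = shiftK K k' j := by
    intro j
    simp only [shiftK]
    split_ifs <;> ring
  simp only [hshift] at hgF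
  refine ⟨⟨coeffVec K k' g, memℓp_coeffVec fun j => memL2loc_of_continuous (hg j)⟩, fun hx => ?_,
    hu.coeffVec_solves hc hF hg hgF hgu⟩
  have hcoeff : coeffVec K k' g = 0 := congrArg Subtype.val hx
  obtain ⟨j, z, hz⟩ := hu.exists_ne
  have hgz := congrFun ((continuous_zero.ae_eq_iff_eq volume (hg j)).1
    (AEFloquet.eq_zero_of_coeffVec (fun j => memL2loc_of_continuous (hg j))
      (fun j => (hgF j).ae) hcoeff j).symm)
  exact hz (hF.eq_zero_of_mul_eq_zero (hu.differentiable j).continuous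
    (fun w hw => by rw [← hgu j w hw, ← hgz w, Pi.zero_apply]) z)

end PoleCancellation

section ChiralConjugation

lemma negSwap_involutive : Function.Involutive fun i : Idx => (-i.1, i.2 + 1) := by
  rintro ⟨n, j⟩
  fin_cases j <;> simp

/-- Negation of the frequencies combined with the exchange of the two components. Up to signs and
complex conjugation it intertwines `D(α)` at `-k` with `D(α)*` at `k`. -/
def negSwap : Equiv.Perm Idx := negSwap_involutive.toPerm

lemma negSwap_apply (i : Idx) : negSwap i = (-i.1, i.2 + 1) := rfl

/-- The sign of the `j`-th component in the antilinear symmetry attached to `negSwap`. -/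
def compSign (j : Fin 2) : ℂ := if j = 0 then 1 else -1

lemma compSign_add_one (j : Fin 2) : compSign (j + 1) = -compSign j := by
  fin_cases j <;> simp [compSign]

lemma norm_compSign (j : Fin 2) : ‖compSign j‖ = 1 := by
  fin_cases j <;> simp [compSign]

lemma compSign_ne_zero (j : Fin 2) : compSign j ≠ 0 :=
  norm_ne_zero_iff.1 (by rw [norm_compSign]; exact one_ne_zero)

lemma modeFreq_neg (K k : ℂ) (i : Idx) : modeFreq K (-k) i = -modeFreq K k (negSwap i) := by
  obtain ⟨n, j⟩ := i
  simp only [negSwap_apply, modeFreq, shiftK, freq_neg]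
  fin_cases j
  · simp only [Fin.zero_eta, zero_add, one_ne_zero, reduceIte]
    ring
  · simp only [Fin.mk_one, one_ne_zero, reduceIte, show (1 : Fin 2) + 1 = 0 from rfl]
    ring

lemma negSwap_shiftIdx (m : ℤ × ℤ) (i : Idx) :
    negSwap (shiftIdx m i) = shiftIdx m (negSwap i) := by
  obtain ⟨n, j⟩ := i
  simp only [negSwap_apply, shiftIdx_apply]
  fin_cases j
  · simp [sub_eq_neg_add]
  · simp [sub_eq_neg_add, add_comm]

/-- The antilinear map of coefficient vectors attached to `negSwap`. -/
def chiralConj (y : Idx → ℂ) (i : Idx) : ℂ := compSign i.2 * conj (y (negSwap i))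

lemma memℓp_chiralConj (y : Ell2 Idx) : Memℓp (chiralConj y) 2 := by
  rw [memℓp_two_iff]
  refine (negSwap.summable_iff.2 (memℓp_two_iff.1 y.2)).congr fun i => ?_
  rw [chiralConj, norm_mul, norm_compSign, one_mul, RCLike.norm_conj, Function.comp_apply]

lemma eq_zero_of_chiralConj_eq_zero {y : Idx → ℂ} (h : chiralConj y = 0) : y = 0 := by
  ext i
  have hi := (mul_eq_zero.1 (congrFun h (negSwap.symm i))).resolve_left (compSign_ne_zero _)
  rwa [Equiv.apply_symm_apply, map_eq_zero] at hi

lemma chiralConj_solves {K k : ℂ} {c : ℤ × ℤ → ℂ} {y : Idx → ℂ}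
    (h : ∀ i, conj (modeFreq K k i) * y i + ∑' m, conj (c m) * y (shiftIdx m i) = 0) (i : Idx) :
    modeFreq K (-k) i * chiralConj y i + ∑' m, c m * chiralConj y (shiftIdx m i) = 0 := by
  have hconj := congrArg conj (h (negSwap i))
  simp only [map_add, map_mul, Complex.conj_tsum, Complex.conj_conj, map_zero] at hconj
  have hsum : ∑' m, c m * chiralConj y (shiftIdx m i) =
      -compSign i.2 * ∑' m, c m * conj (y (shiftIdx m (negSwap i))) := by
    rw [← tsum_mul_left]
    refine tsum_congr fun m => ?_
    rw [chiralConj, negSwap_shiftIdx, shiftIdx_apply, compSign_add_one]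
    ring
  rw [hsum, modeFreq_neg, chiralConj]
  linear_combination -compSign i.2 * hconj

end ChiralConjugation

section FlatBand

variable {K : ℂ} {U : ℂ → ℂ} {α k : ℂ}

lemma exists_isKernelState (hU : IsSmoothChiralPotential K U) (hK : IsDiracPoint K) {x : Ell2 Idx}
    (hx : x ≠ 0) (h : ∀ i, modeFreq K k i * x i + potOp K U α x i = 0) :
    ∃ u, IsKernelState K (potSeq K U α) k u := by
  have hs := summable_potSeq hU hK α
  have hd : ∀ j, RapidDecay fun n => x (n, j) := fun j =>
    (rapidDecay_of_mode hU hK (E := 0) (y := 0) (by simpa using h) (by simp) j).1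
  refine ⟨seriesVec K k x, fun j => differentiable_floquetSeries (hd j) _,
    fun j => isFloquet_floquetSeries _ _, fun j z => ?_, ?_⟩
  · have hsolves := seriesVec_solves (k := k) (E := 0) (a := -Complex.I) (b := 1) hs hd hd
      (fun i => by rw [diffSymbol_dbar, ← potOp_apply hU hK, zero_mul]; exact h i) j z
    rwa [zero_mul] at hsolves
  · by_contra! hzero
    have hseries : seriesVec K k x = 0 := funext₂ hzero
    refine hx (lp.ext ?_)
    rw [← coeffVec_seriesVec (K := K) (k := k) hd, hseries]
    ext i
    simp [coeffVec, floquetCoeff]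

lemma exists_kernel_neg (hU : IsSmoothChiralPotential K U) (hK : IsDiracPoint K) {y : Ell2 Idx}
    (hy : y ≠ 0)
    (h : ∀ i, conj (modeFreq K k i) * y i + ContinuousLinearMap.adjoint (potOp K U α) y i = 0) :
    ∃ x : Ell2 Idx, x ≠ 0 ∧ ∀ i, modeFreq K (-k) i * x i + potOp K U α x i = 0 := by
  simp only [adjoint_potOp_apply hU hK] at h
  refine ⟨⟨chiralConj y, memℓp_chiralConj y⟩, fun hzero =>
    hy (lp.ext (eq_zero_of_chiralConj_eq_zero (congrArg Subtype.val hzero))), fun i => ?_⟩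
  rw [potOp_apply hU hK]
  exact chiralConj_solves h i

lemma isModeEigenvalue_zero_of_kernel (hU : IsSmoothChiralPotential K U) (hK : IsDiracPoint K)
    (h1 : k + K ∉ dualLattice) (h2 : K - k ∉ dualLattice) {x : Ell2 Idx} (hx : x ≠ 0)
    (h : ∀ i, modeFreq K k i * x i + potOp K U α x i = 0) (k' : ℂ) :
    IsModeEigenvalue (modeFreq K k') (potOp K U α) 0 := by
  obtain ⟨u, hu⟩ := exists_isKernelState hU hK hx h
  obtain ⟨w, hw, hw'⟩ := exists_kernel_diracPoint hU hK α
  obtain ⟨v, hv⟩ := exists_isKernelState hU hK hw hw'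
  obtain ⟨z₀, hz₀⟩ := hu.exists_zero hv h1 h2
  obtain ⟨x', hx', he⟩ := hu.exists_kernel (summable_potSeq hU hK α) hz₀ k'
  refine ⟨x', 0, Or.inl hx', fun i => ?_, fun i => by simp⟩
  rw [potOp_apply hU hK, he i, Complex.ofReal_zero, zero_mul]

lemma notMem_dualLattice_of_notMem_add (hk : k ∉ ({-K, K} : Set ℂ) + dualLattice) :
    k + K ∉ dualLattice ∧ K - k ∉ dualLattice := by
  refine ⟨fun h => hk ⟨-K, by simp, k + K, h, by ring⟩,
    fun h => hk ⟨K, by simp, k - K, ?_, by ring⟩⟩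
  rw [← neg_sub]
  exact dualLattice_neg h

lemma isModeEigenvalue_zero_of_notMem_add (hU : IsSmoothChiralPotential K U) (hK : IsDiracPoint K)
    (hk : k ∉ ({-K, K} : Set ℂ) + dualLattice)
    (h : IsModeEigenvalue (modeFreq K k) (potOp K U α) 0) (k' : ℂ) :
    IsModeEigenvalue (modeFreq K k') (potOp K U α) 0 := by
  obtain ⟨h1, h2⟩ := notMem_dualLattice_of_notMem_add hk
  obtain ⟨x, y, hne, hx, hy⟩ := h
  simp only [Complex.ofReal_zero, zero_mul] at hx hy
  rcases hne with hne | hne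
  · exact isModeEigenvalue_zero_of_kernel hU hK h1 h2 hne hx k'
  · obtain ⟨x', hx', he⟩ := exists_kernel_neg hU hK hne hy
    refine isModeEigenvalue_zero_of_kernel hU hK ?_ ?_ hx' he k'
    · rwa [neg_add_eq_sub]
    · rwa [sub_neg_eq_add, add_comm]

lemma IsDiracPoint.zero_notMem (hK : IsDiracPoint K) :
    (0 : ℂ) ∉ ({-K, K} : Set ℂ) + dualLattice := by
  rintro ⟨a, ha, b, hb, hab⟩
  rcases ha with rfl | rfl
  · exact hK.ne_zero (neg_add_eq_zero.1 hab ▸ hb)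
  · exact hK.ne_zero (eq_neg_of_add_eq_zero_left hab ▸ dualLattice_neg hb)

end FlatBand

end ChiralTBG

end

theorem theorem1_general (K : ℂ) (hK : ChiralTBG.IsDiracPoint K)
    (U : ℂ → ℂ) (hU : ChiralTBG.IsSmoothChiralPotential K U) (α : ℂ) :
    (∀ k : ℂ, IsLeast {E : ℝ | 0 ≤ E ∧ ChiralTBG.IsBlochEigenvalue K U α k E}
      (ChiralTBG.E₁ K U α k)) ∧
    ((∃ k : ℂ, k ∉ ({-K, K} : Set ℂ) + ChiralTBG.dualLattice ∧ ChiralTBG.E₁ K U α k = 0) ↔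
      ∀ k : ℂ, ChiralTBG.E₁ K U α k = 0) := by
  refine ⟨ChiralTBG.isLeast_E₁ hU hK α, ?_, fun h => ⟨0, hK.zero_notMem, h 0⟩⟩
  rintro ⟨k, hk, h⟩ k'
  rw [ChiralTBG.E₁_eq_zero_iff hU hK] at h ⊢
  exact ChiralTBG.isModeEigenvalue_zero_of_notMem_add hU hK hk h k'

theorem theorem1 (K : ℂ) (hK : ChiralTBG.IsDiracPoint K)
    (U : ℂ → ℂ) (hU : ChiralTBG.IsChiralPotential K U) (α : ℂ) :
    (∀ k : ℂ, IsLeast {E : ℝ | 0 ≤ E ∧ ChiralTBG.IsBlochEigenvalue K U α k E}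
      (ChiralTBG.E₁ K U α k)) ∧
    ((∃ k : ℂ, k ∉ ({-K, K} : Set ℂ) + ChiralTBG.dualLattice ∧ ChiralTBG.E₁ K U α k = 0) ↔
      ∀ k : ℂ, ChiralTBG.E₁ K U α k = 0) :=
  theorem1_general K hK U hU.isSmoothChiralPotential α
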